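/- Let $\Omega\subseteq\mathbb R^N$ be open and bounded with Lipschitz boundary, let $\partial_D\Omega\subseteq\partial\Omega$ be relatively open in $\partial\Omega$, and let $\varepsilon>0$, $\eta_\varepsilon>0$. For $(u,v)\in H^1(\Omega)\times H^1(\Omega)$ let $$F_\varepsilon(u,v)=\int_\Omega(\eta_\varepsilon+v^2)|\nabla u|^2\,dx+\frac{\varepsilon}{2}\int_\Omega|\nabla v|^2\,dx+\frac1{2\varepsilon}\int_\Omega(1-v)^2\,dx\in[0,+\infty].$$ Equalities on $\partial_D\Omega$ are understood in the sense of traces, and inequalities in $\Omega$ hold almost everywhere. Let $g\in W^{1,1}([0,1];H^1(\Omega))$ (identified with its absolutely continuous representative), with time derivative $\dot g$. Then there exists a strongly measurable map $[0,1]\ni t\mapsto(u(t),v(t))\in H^1(\Omega)\times H^1(\Omega)$ such that, for all $t\in[0,1]$, $0\le v(t)\le1$ in $\Omega$, and $u(t)=g(t)$, $v(t)=1$ on $\partial_D\Omega$, and moreover: (a) for all $0\le s\le t\le1$: $v(t)\le v(s)$ in $\Omega$; (b) for all $(u,v)\in H^1(\Omega)\times H^1(\Omega)$ with $u=g(0)$,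 $v=1$ on $\partial_D\Omega$: $F_\varepsilon(u(0),v(0))\le F_\varepsilon(u,v)$; (c) for all $t\in(0,1]$ and all $(u,v)\in H^1(\Omega)\times H^1(\Omega)$ with $0\le v\le v(t)$ in $\Omega$ and $u=g(t)$, $v=1$ on $\partial_D\Omega$: $F_\varepsilon(u(t),v(t))\le F_\varepsilon(u,v)$; (d) the function $t\mapsto F_\varepsilon(u(t),v(t))$ is finite and absolutely continuous on $[0,1]$, the function $\tau\mapsto\int_\Omega(\eta_\varepsilon+v(\tau)^2)\nabla u(\tau)\cdot\nabla\dot g(\tau)\,dx$ is integrable on $[0,1]$, and for all $t\in[0,1]$ $$F_\varepsilon(u(t),v(t))=F_\varepsilon(u(0),v(0))+2\int_0^t\int_\Omega(\eta_\varepsilon+v(\tau)^2)\,\nabla u(\tau)\cdot\nabla\dot g(\tau)\,dx\,d\tau.$$ -/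

import Mathlib

open MeasureTheory Set Filter Topology
open scoped ENNReal ContDiff

namespace AmbrosioTortorelli

/-- The Euclidean space `ℝ^N`. -/
abbrev Eucl (N : ℕ) : Type := EuclideanSpace ℝ (Fin N)

/-- Integration by parts against all test functions `φ ∈ C_c^∞(Ω)`: the vector field `p` is the
distributional gradient of `u` on `Ω`, stated through all directions `w`
(`∫_Ω u ∂_w φ = - ∫_Ω φ (p · w)`). -/
def IsWeakGradient {N : ℕ} (Ω : Set (Eucl N)) (u : Eucl N → ℝ) (p : Eucl N → Eucl N) : Prop :=
  ∀ φ : Eucl N → ℝ, ContDiff ℝ ∞ φ → HasCompactSupport φ → tsupport φ ⊆ Ω → ∀ w : Eucl N,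
    ∫ x in Ω, u x * fderiv ℝ φ x w = - ∫ x in Ω, φ x * inner ℝ (p x) w

/-- The Hilbert space `L²(Ω) × L²(Ω; ℝ^N)`, with norm `(‖u‖² + ‖p‖²)^{1/2}`. -/
abbrev L2Pair {N : ℕ} (Ω : Set (Eucl N)) : Type :=
  WithLp 2 (Lp ℝ 2 (volume.restrict Ω) × Lp (Eucl N) 2 (volume.restrict Ω))

theorem memLp_fderiv_test {N : ℕ} (Ω : Set (Eucl N)) {φ : Eucl N → ℝ} (h : ContDiff ℝ ∞ φ)
    (hc : HasCompactSupport φ) (w : Eucl N) :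
    MemLp (fun x => fderiv ℝ φ x w) 2 (volume.restrict Ω) := by
  have h1 : Continuous (fun x => fderiv ℝ φ x w) :=
    (h.continuous_fderiv (by simp)).clm_apply continuous_const
  have h2 : HasCompactSupport (fun x => fderiv ℝ φ x w) :=
    (hc.fderiv (𝕜 := ℝ)).comp_left (g := fun L : Eucl N →L[ℝ] ℝ => L w) (by simp)
  exact (h1.memLp_of_hasCompactSupport h2).restrict Ω

theorem memLp_test_smul {N : ℕ} (Ω : Set (Eucl N)) {φ : Eucl N → ℝ} (h : ContDiff ℝ ∞ φ)
    (hc : HasCompactSupport φ) (w : Eucl N) :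
    MemLp (fun x => φ x • w) 2 (volume.restrict Ω) := by
  have h1 : Continuous (fun x => φ x • w) := h.continuous.smul continuous_const
  have h2 : HasCompactSupport (fun x => φ x • w) :=
    hc.comp_left (g := fun r : ℝ => r • w) (by simp)
  exact (h1.memLp_of_hasCompactSupport h2).restrict Ω

/-- Integration by parts as vanishing of a pairing in `L²(Ω) × L²(Ω; ℝ^N)`. -/
theorem weakGradient_eq_iff {N : ℕ} (Ω : Set (Eucl N)) (U : L2Pair Ω) {φ : Eucl N → ℝ}
    (h : ContDiff ℝ ∞ φ) (hc : HasCompactSupport φ) (w : Eucl N) :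
    (∫ x in Ω, U.fst x * fderiv ℝ φ x w = - ∫ x in Ω, φ x * inner ℝ (U.snd x) w) ↔
      inner ℝ ((memLp_fderiv_test Ω h hc w).toLp _) U.fst
        + inner ℝ ((memLp_test_smul Ω h hc w).toLp _) U.snd = (0 : ℝ) := by
  have e1 : inner ℝ ((memLp_fderiv_test Ω h hc w).toLp _) U.fst
      = ∫ x in Ω, U.fst x * fderiv ℝ φ x w := by
    rw [L2.inner_def]
    refine integral_congr_ae ?_
    filter_upwards [(memLp_fderiv_test Ω h hc w).coeFn_toLp] with x hx
    rw [hx]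
    simp
  have e2 : inner ℝ ((memLp_test_smul Ω h hc w).toLp _) U.snd
      = ∫ x in Ω, φ x * inner ℝ (U.snd x) w := by
    rw [L2.inner_def]
    refine integral_congr_ae ?_
    filter_upwards [(memLp_test_smul Ω h hc w).coeFn_toLp] with x hx
    rw [hx, real_inner_smul_left, real_inner_comm]
  rw [e1, e2, eq_neg_iff_add_eq_zero]

/-- The Sobolev space `H¹(Ω)`: pairs `(u, ∇u) ∈ L²(Ω) × L²(Ω; ℝ^N)` where `∇u` is the
distributional gradient of `u`. For open `Ω` the gradient is determined by `u`. The
norm inherited from `L2Pair Ω` is `(‖u‖²_{L²} + ‖∇u‖²_{L²})^{1/2}`. -/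
noncomputable def H1 {N : ℕ} (Ω : Set (Eucl N)) : Submodule ℝ (L2Pair Ω) where
  carrier := {U | IsWeakGradient Ω U.fst U.snd}
  zero_mem' := by
    intro φ h hc _ w
    rw [weakGradient_eq_iff Ω 0 h hc w]
    simp
  add_mem' := by
    intro U V hU hV φ h hc hs w
    have a := (weakGradient_eq_iff Ω U h hc w).1 (hU φ h hc hs w)
    have b := (weakGradient_eq_iff Ω V h hc w).1 (hV φ h hc hs w)
    rw [weakGradient_eq_iff Ω (U + V) h hc w]
    rw [WithLp.add_fst, WithLp.add_snd, inner_add_right, inner_add_right]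
    linarith
  smul_mem' := by
    intro c U hU φ h hc hs w
    have a := (weakGradient_eq_iff Ω U h hc w).1 (hU φ h hc hs w)
    rw [weakGradient_eq_iff Ω (c • U) h hc w]
    rw [WithLp.smul_fst, WithLp.smul_snd, real_inner_smul_right, real_inner_smul_right,
      ← mul_add, a, mul_zero]

/-- `H¹(Ω)` is complete. -/
instance {N : ℕ} (Ω : Set (Eucl N)) : CompleteSpace (H1 Ω) := by
  have hcl : IsClosed (H1 Ω : Set (L2Pair Ω)) := by
    have : (H1 Ω : Set (L2Pair Ω)) = ⋂ (φ : Eucl N → ℝ) (h : ContDiff ℝ ∞ φ)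
        (hc : HasCompactSupport φ) (_ : tsupport φ ⊆ Ω) (w : Eucl N),
        {U : L2Pair Ω | inner ℝ ((memLp_fderiv_test Ω h hc w).toLp _) U.fst
          + inner ℝ ((memLp_test_smul Ω h hc w).toLp _) U.snd = (0 : ℝ)} := by
      ext U
      simp only [mem_iInter, mem_ofPred_eq]
      exact ⟨fun hU φ h hc hs w => (weakGradient_eq_iff Ω U h hc w).1 (hU φ h hc hs w),
        fun hU φ h hc hs w => (weakGradient_eq_iff Ω U h hc w).2 (hU φ h hc hs w)⟩
    rw [this]
    refine isClosed_iInter fun φ => isClosed_iInter fun h => isClosed_iInter fun hc =>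
      isClosed_iInter fun _ => isClosed_iInter fun w => isClosed_eq ?_ continuous_const
    exact (continuous_const.inner
      (WithLp.fstL 2 ℝ (Lp ℝ 2 (volume.restrict Ω))
        (Lp (Eucl N) 2 (volume.restrict Ω))).continuous).add
      (continuous_const.inner
      (WithLp.sndL 2 ℝ (Lp ℝ 2 (volume.restrict Ω))
        (Lp (Eucl N) 2 (volume.restrict Ω))).continuous)
  exact hcl.completeSpace_coe

/-- The function underlying an element of `H¹(Ω)` (an `L²` class, read on `Ω`). -/
noncomputable def fn {N : ℕ} {Ω : Set (Eucl N)} (u : H1 Ω) : Lp ℝ 2 (volume.restrict Ω) :=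
  (u : L2Pair Ω).fst

/-- The gradient `∇u ∈ L²(Ω; ℝ^N)` of an element of `H¹(Ω)`. -/
noncomputable def grad {N : ℕ} {Ω : Set (Eucl N)} (u : H1 Ω) :
    Lp (Eucl N) 2 (volume.restrict Ω) :=
  (u : L2Pair Ω).snd

/-- Lipschitz boundary: near each boundary point `x`, in the coordinates given by some unit vector
`e` and its orthogonal complement, `Ω` is the strict epigraph of a Lipschitz function. -/
def HasLipschitzBoundary {N : ℕ} (Ω : Set (Eucl N)) : Prop :=
  ∀ x ∈ frontier Ω, ∃ (e : Eucl N) (f : (ℝ ∙ e)ᗮ → ℝ) (K : NNReal) (r : ℝ),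
    ‖e‖ = 1 ∧ LipschitzWith K f ∧ 0 < r ∧
      ∀ y ∈ Metric.ball x r, y ∈ Ω ↔ f ((ℝ ∙ e)ᗮ.orthogonalProjectionOnto y) < inner ℝ e y

/-- `h` is the trace of `u ∈ H¹(Ω)` on the part `D` of the boundary. The trace operator is the
continuous extension of the restriction `φ ↦ φ|_D` of smooth functions `φ ∈ C^∞(ℝ^N)`, as an
operator from `H¹(Ω)` to `L²(D, ℋ^{N-1})`; so `h` is the trace of `u` when some sequence of smooth
functions converges to `u` in `H¹(Ω)` while their restrictions to `D` converge to `h` in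
`L²(D, ℋ^{N-1})`. -/
def HasTraceOn {N : ℕ} {Ω : Set (Eucl N)} (D : Set (Eucl N)) (u : H1 Ω) (h : Eucl N → ℝ) : Prop :=
  AEStronglyMeasurable h ((Measure.hausdorffMeasure ((N : ℝ) - 1)).restrict D) ∧
  ∃ φ : ℕ → Eucl N → ℝ, (∀ n, ContDiff ℝ ∞ (φ n)) ∧
    Tendsto (fun n => eLpNorm (fun x => φ n x - fn u x) 2 (volume.restrict Ω)) atTop (𝓝 0) ∧
    Tendsto (fun n => eLpNorm (fun x => gradient (φ n) x - grad u x) 2 (volume.restrict Ω))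
      atTop (𝓝 0) ∧
    Tendsto (fun n => eLpNorm (fun x => φ n x - h x) 2
      ((Measure.hausdorffMeasure ((N : ℝ) - 1)).restrict D)) atTop (𝓝 0)

/-- `u = w` on `D` in the sense of traces: `u - w` has trace zero on `D`. -/
def EqOnBoundary {N : ℕ} {Ω : Set (Eucl N)} (D : Set (Eucl N)) (u w : H1 Ω) : Prop :=
  HasTraceOn D (u - w) (fun _ => 0)

/-- The Ambrosio–Tortorelli functional
`F_ε(u,v) = ∫_Ω (η + v²)|∇u|² + (ε/2) ∫_Ω |∇v|² + (1/(2ε)) ∫_Ω (1 - v)²`, with values in `[0,∞]`: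
it may be infinite where `v` is unbounded. -/
noncomputable def energy {N : ℕ} {Ω : Set (Eucl N)} (ε η : ℝ) (u v : H1 Ω) : ℝ≥0∞ :=
  (∫⁻ x in Ω, ENNReal.ofReal ((η + fn v x ^ 2) * ‖grad u x‖ ^ 2))
    + ENNReal.ofReal (ε / 2) * (∫⁻ x in Ω, ENNReal.ofReal (‖grad v x‖ ^ 2))
    + ENNReal.ofReal (1 / (2 * ε)) * (∫⁻ x in Ω, ENNReal.ofReal ((1 - fn v x) ^ 2))

/-- `∫_Ω (η + v²) ∇u · ∇w`. -/
noncomputable def power {N : ℕ} {Ω : Set (Eucl N)} (η : ℝ) (u v w : H1 Ω) : ℝ :=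
  ∫ x in Ω, (η + fn v x ^ 2) * inner ℝ (grad u x) (grad w x)

/-- `g ∈ W^{1,1}([0,1]; X)` (its absolutely continuous representative) with time derivative `g'`:
`g'` is Bochner integrable on `[0,1]` and `g(t) = g(0) + ∫_0^t g'(τ) dτ` for `t ∈ [0,1]`. -/
structure IsW11 {X : Type*} [NormedAddCommGroup X] [NormedSpace ℝ X] (g g' : ℝ → X) : Prop where
  intervalIntegrable : IntervalIntegrable g' volume 0 1
  eq_integral : ∀ t ∈ Icc (0 : ℝ) 1, g t = g 0 + ∫ τ in (0 : ℝ)..t, g' τ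

end AmbrosioTortorelli

open AmbrosioTortorelli

/-! Pass to the damage `w = 1 - v`, which grows in time, has zero trace on `D` and takes values in
[0,1], and write `u = g + z` with `z` of zero trace. For given `w` the elastic energy is a convex
quadratic functional of `z`. Minimizing it out leaves `elasticEnergy`, a bounded symmetric quadratic
form in `p = ∇g` which is jointly continuous in `(w, p)` for strong L² convergence
(`continuous_elastic`). So only the damage has to be evolved. By Rellich compactness a bound on the
surface energy gives L² convergence of subsequences; along them the elastic term is continuous and
the surface term lower semicontinuous (`exists_lift_of_tendsto`).

The evolution is a limit of incremental minimizations, each constrained to lie above the previous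
damage. While the damage is frozen, the chain rule `quadratic_sub_eq_integral` computes the work of
the datum exactly, and switching to the next minimizer does not raise the energy: this is
`discrete_energy_le`. All interpolants take values in one L²-compact set, so Tychonoff's theorem
provides a pointwise cluster curve. Monotonicity in time upgrades convergence at rational times to
convergence outside a countable set, which suffices to pass to the limit in the work integral.

Unilateral minimality survives the limit (`minimality_of_tendsto`): a competitor `w'` above the
limit is replaced by `max(xₙ, w')`, and the surface energy is submodular under pointwise min and
max. The upper energy inequality is the limit of the discrete one. The lower one
(`energy_ge_of_minimality`) comes from testing minimality at each node of a grid with the damage at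
the next node and refining the grid. The energy is then a primitive of an integrable power, hence
absolutely continuous.

This argument is carried out for an abstract `IsSobolevPair`. The remaining work verifies its
properties for H¹ functions with zero trace on `D`. Zero trace means approximability by smooth
functions that are small on `D`; this is a closed condition, stable under smooth contractions fixing
0, hence under truncation (`SmoothApprox.trunc`). Compactness follows by averaging over small cones
that stay inside the Lipschitz domain (`local_estimate`). At time zero the competitors are
unconstrained, but clamping `v` to [0,1] does not increase the energy. -/

namespace AmbrosioTortorelli

/-! ### Weak sequential compactness in Hilbert spaces -/

section Hilbert

variable {V : Type*} [NormedAddCommGroup V] [InnerProductSpace ℝ V] [CompleteSpace V]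

/-- Bounded sequences of a separable Hilbert space have weakly convergent subsequences. -/
theorem exists_weakly_tendsto_subseq [TopologicalSpace.SeparableSpace V] (x : ℕ → V) (M : ℝ)
    (hx : ∀ n, ‖x n‖ ≤ M) :
    ∃ (a : V) (φ : ℕ → ℕ), StrictMono φ ∧
      ∀ f : V →L[ℝ] ℝ, Tendsto (fun n => f (x (φ n))) atTop (𝓝 (f a)) := by
  -- Sequential Banach–Alaoglu in the dual of a separable space, carried back to `V` by the Riesz
  -- isomorphism.
  have hs := WeakDual.isSeqCompact_closedBall ℝ V (0 : StrongDual ℝ V) M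
  let y : ℕ → WeakDual ℝ V := fun n => StrongDual.toWeakDual (InnerProductSpace.toDual ℝ V (x n))
  have hy : ∀ n, y n ∈ (WeakDual.toStrongDual ⁻¹' Metric.closedBall (0 : StrongDual ℝ V) M) := by
    intro n
    simp [y, hx n]
  obtain ⟨b, -, φ, hφ, hb⟩ := hs hy
  refine ⟨(InnerProductSpace.toDual ℝ V).symm (WeakDual.toStrongDual b), φ, hφ, fun f => ?_⟩
  set z := (InnerProductSpace.toDual ℝ V).symm f with hz
  have hf : ∀ u, f u = inner ℝ u z := fun u => by
    rw [real_inner_comm, hz, InnerProductSpace.toDual_symm_apply]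
  have h1 : Tendsto (fun n => (y (φ n)) z) atTop (𝓝 (b z)) :=
    ((WeakDual.eval_continuous z).tendsto b).comp hb
  have h2 : ∀ n, f (x (φ n)) = y (φ n) z := fun n => by
    rw [hf]; simp [y]
  rw [hf, InnerProductSpace.toDual_symm_apply]
  exact h1.congr fun n => (h2 n).symm

end Hilbert

/-! ### Quadratic forms along absolutely continuous curves -/

section ChainRule

variable {F : Type*} [NormedAddCommGroup F] [InnerProductSpace ℝ F] [CompleteSpace F]

/-- Sums of increments of `f` over disjoint intervals are at most `C` times those of `F`. It is used
with `F` a primitive of an integrable function. -/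
theorem absolutelyContinuousOnInterval_of_dist_le {X Y : Type*} [PseudoMetricSpace X]
    [PseudoMetricSpace Y] {f : ℝ → X} {F : ℝ → Y} {a b C : ℝ}
    (hF : AbsolutelyContinuousOnInterval F a b)
    (h : ∀ s ∈ uIcc a b, ∀ t ∈ uIcc a b, dist (f s) (f t) ≤ C * dist (F s) (F t)) :
    AbsolutelyContinuousOnInterval f a b := by
  unfold AbsolutelyContinuousOnInterval at hF ⊢
  have h0 := hF.const_mul C
  rw [mul_zero] at h0
  refine squeeze_zero' (Eventually.of_forall fun E => Finset.sum_nonneg fun _ _ => dist_nonneg)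
    ?_ h0
  have : ∀ᶠ (E : ℕ × (ℕ → ℝ × ℝ)) in
      AbsolutelyContinuousOnInterval.totalLengthFilter ⊓
        𝓟 (AbsolutelyContinuousOnInterval.disjWithin a b),
      E ∈ AbsolutelyContinuousOnInterval.disjWithin a b := eventually_inf_principal.mpr (by simp)
  filter_upwards [this] with E hE
  rw [Finset.mul_sum]
  refine Finset.sum_le_sum fun i hi => ?_
  exact h _ (hE.1 i hi).1 _ (hE.1 i hi).2

/-- Chain rule for a symmetric quadratic form along an absolutely continuous curve. -/
theorem quadratic_sub_eq_integral (A : F →L[ℝ] F) (hA : ∀ p q, inner ℝ (A p) q = inner ℝ (A q) p)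
    {p p' : ℝ → F} (hp' : Integrable p') (hp : ∀ t, p t = p 0 + ∫ τ in (0 : ℝ)..t, p' τ)
    (a b : ℝ) :
    inner ℝ (A (p b)) (p b) - inner ℝ (A (p a)) (p a)
      = ∫ τ in a..b, 2 * inner ℝ (A (p τ)) (p' τ) := by
  have hii : ∀ s t, IntervalIntegrable p' volume s t := fun s t => hp'.intervalIntegrable
  have hsub : ∀ s t, p t - p s = ∫ τ in s..t, p' τ := fun s t => by
    rw [hp t, hp s, add_sub_add_left_eq_sub, intervalIntegral.integral_interval_sub_left
      (hii _ _) (hii _ _)]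
  have hcont : Continuous p := by
    have : Continuous fun t => p 0 + ∫ τ in (0 : ℝ)..t, p' τ :=
      continuous_const.add (intervalIntegral.continuous_primitive hii 0)
    exact this.congr fun t => (hp t).symm
  obtain ⟨B, hB⟩ := (isCompact_uIcc (a := a) (b := b)).exists_bound_of_continuousOn
    hcont.continuousOn
  have hac : AbsolutelyContinuousOnInterval (fun t => inner ℝ (A (p t)) (p t)) a b := by
    refine absolutelyContinuousOnInterval_of_dist_le (C := ‖A‖ * (2 * B))
      (hp'.norm.intervalIntegrable.absolutelyContinuousOnInterval_intervalIntegral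
        (left_mem_uIcc (a := a) (b := b))) fun s hs t ht => ?_
    -- Symmetry of `A` factors the difference of squares, so the increments of the form are bounded
    -- by those of the primitive of `‖p'‖`, the other factor being bounded on the compact interval.
    have e1 : inner ℝ (A (p s)) (p s) - inner ℝ (A (p t)) (p t)
        = inner ℝ (A (p s + p t)) (p s - p t) := by
      rw [map_add, inner_add_left, inner_sub_right, inner_sub_right, hA (p s) (p t)]
      ring
    have e2 : ‖p s - p t‖ ≤ dist (∫ τ in a..s, ‖p' τ‖) (∫ τ in a..t, ‖p' τ‖) := by
      rw [hsub, Real.dist_eq, intervalIntegral.integral_interval_sub_left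
        hp'.norm.intervalIntegrable hp'.norm.intervalIntegrable]
      exact intervalIntegral.norm_integral_le_abs_integral_norm
    rw [Real.dist_eq, e1]
    have hB0 : 0 ≤ B := (norm_nonneg _).trans (hB s hs)
    calc |inner ℝ (A (p s + p t)) (p s - p t)|
        ≤ ‖A (p s + p t)‖ * ‖p s - p t‖ := abs_real_inner_le_norm _ _
      _ ≤ (‖A‖ * (2 * B)) * ‖p s - p t‖ := by
          gcongr
          refine (A.le_opNorm _).trans ?_
          gcongr
          linarith [norm_add_le (p s) (p t), hB s hs, hB t ht]
      _ ≤ _ := by gcongr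
  rw [← hac.integral_deriv_eq_sub]
  refine intervalIntegral.integral_congr_ae ?_
  -- Lebesgue differentiation: `p` has derivative `p'` almost everywhere.
  filter_upwards [_root_.LocallyIntegrable.ae_hasDerivAt_integral hp'.locallyIntegrable] with t ht _
  have hd : HasDerivAt p (p' t) t := by
    have := (ht 0).const_add (p 0)
    exact this.congr_of_eventuallyEq (Eventually.of_forall hp)
  have h1 : HasDerivAt (fun t => A (p t)) (A (p' t)) t := A.hasFDerivAt.comp_hasDerivAt t hd
  rw [(h1.inner ℝ hd).deriv, hA (p' t) (p t)]
  ring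

end ChainRule

/-! ### Monotone curves in L² -/

section Monotone

variable {α : Type*} [MeasurableSpace α] {μ : Measure α}

theorem inner_nonneg_of_nonneg {f g : Lp ℝ 2 μ} (hf : 0 ≤ f) (hg : 0 ≤ g) : 0 ≤ inner ℝ f g := by
  rw [L2.inner_def]
  refine integral_nonneg_of_ae ?_
  filter_upwards [(Lp.coeFn_nonneg f).2 hf, (Lp.coeFn_nonneg g).2 hg] with x h1 h2
  simpa using mul_nonneg h2 h1

/-- Expanding the square of `g = f + (g - f)`, the cross term is nonnegative. Thus oscillations of a
monotone curve are controlled by those of its scalar squared norm. -/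
theorem norm_sub_sq_le {f g : Lp ℝ 2 μ} (hf : 0 ≤ f) (hfg : f ≤ g) :
    ‖g - f‖ ^ 2 ≤ ‖g‖ ^ 2 - ‖f‖ ^ 2 := by
  have h := inner_nonneg_of_nonneg (sub_nonneg.2 hfg) hf
  rw [inner_sub_left, real_inner_self_eq_norm_sq] at h
  rw [@norm_sub_sq ℝ]
  simp only [RCLike.re_to_real]
  linarith

/-- A monotone curve of nonnegative functions in `L²` is continuous outside a countable set. -/
theorem countable_not_continuousAt_Lp {w : ℝ → Lp ℝ 2 μ} (hw : Monotone w) (h0 : ∀ t, 0 ≤ w t) :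
    {t | ¬ ContinuousAt w t}.Countable := by
  -- The squared norm is a monotone real function, hence continuous outside a countable set; at its
  -- continuity points `norm_sub_sq_le` gives continuity of `w` itself.
  have hm : Monotone fun t => ‖w t‖ ^ 2 := fun s t hst => by
    have := norm_sub_sq_le (h0 s) (hw hst)
    have h2 := sq_nonneg ‖w t - w s‖
    simp only
    linarith
  refine hm.countable_not_continuousAt.mono fun t ht => ?_
  rw [mem_ofPred_eq] at ht ⊢
  refine fun hc => ht ?_
  have key : ∀ s, ‖w s - w t‖ ^ 2 ≤ |‖w s‖ ^ 2 - ‖w t‖ ^ 2| := fun s => by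
    rcases le_total s t with h | h
    · rw [norm_sub_rev, abs_sub_comm]
      exact (norm_sub_sq_le (h0 s) (hw h)).trans (le_abs_self _)
    · exact (norm_sub_sq_le (h0 t) (hw h)).trans (le_abs_self _)
  rw [ContinuousAt, tendsto_iff_norm_sub_tendsto_zero]
  have h1 : Tendsto (fun s => |‖w s‖ ^ 2 - ‖w t‖ ^ 2|) (𝓝 t) (𝓝 0) := by
    have := (hc.tendsto.sub_const (‖w t‖ ^ 2)).abs
    simpa using this
  have h2 := squeeze_zero (fun s => sq_nonneg ‖w s - w t‖) key h1
  have h3 := h2.sqrt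
  simpa [Real.sqrt_sq (norm_nonneg _)] using h3

/-- Monotone curves converging at rational times converge at every continuity time of the limit. -/
theorem tendsto_of_tendsto_rat {w : ℕ → ℝ → Lp ℝ 2 μ} {w₀ : ℝ → Lp ℝ 2 μ}
    (hw : ∀ n, Monotone (w n))
    (hq : ∀ q : ℚ, Tendsto (fun n => w n q) atTop (𝓝 (w₀ q))) {t : ℝ} (ht : ContinuousAt w₀ t) :
    Tendsto (fun n => w n t) atTop (𝓝 (w₀ t)) := by
  rw [Metric.tendsto_atTop]
  intro δ hδ
  obtain ⟨r, hr, hrt⟩ := Metric.continuousAt_iff.1 ht (δ / 8) (by positivity)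
  obtain ⟨q₁, h1, h1'⟩ := exists_rat_btwn (show t - r < t by linarith)
  obtain ⟨q₂, h2, h2'⟩ := exists_rat_btwn (show t < t + r by linarith)
  have d1 : dist (w₀ q₁) (w₀ t) < δ / 8 := hrt (by rw [Real.dist_eq, abs_lt]; constructor <;> linarith)
  have d2 : dist (w₀ q₂) (w₀ t) < δ / 8 := hrt (by rw [Real.dist_eq, abs_lt]; constructor <;> linarith)
  obtain ⟨n₁, hn1⟩ := Metric.tendsto_atTop.1 (hq q₁) (δ / 8) (by positivity)
  obtain ⟨n₂, hn2⟩ := Metric.tendsto_atTop.1 (hq q₂) (δ / 8) (by positivity)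
  refine ⟨max n₁ n₂, fun n hn => ?_⟩
  have c1 := hn1 n (le_of_max_le_left hn)
  have c2 := hn2 n (le_of_max_le_right hn)
  have m1 : w n q₁ ≤ w n t := hw n h1'.le
  have m2 : w n t ≤ w n q₂ := hw n h2.le
  -- Sandwiching `w n t` between two rational times bounds its distance to `w n q₁` by the gap of
  -- the bracket. The triangle inequalities below use six errors of size `δ / 8`.
  have s1 : ‖w n t - w n q₁‖ ≤ ‖w n q₂ - w n q₁‖ := by
    refine norm_le_norm_of_abs_le_abs ?_
    rw [abs_of_nonneg (sub_nonneg.2 m1), abs_of_nonneg (sub_nonneg.2 (m1.trans m2))]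
    exact sub_le_sub_right m2 _
  rw [← dist_eq_norm, ← dist_eq_norm] at s1
  have t1 := dist_triangle (w n t) (w n q₁) (w₀ t)
  have t2 := dist_triangle (w n q₁) (w₀ q₁) (w₀ t)
  have t3 := dist_triangle (w n q₂) (w₀ q₂) (w n q₁)
  have t4 := dist_triangle (w₀ q₂) (w₀ t) (w n q₁)
  have t5 := dist_triangle (w₀ t) (w₀ q₁) (w n q₁)
  rw [dist_comm (w₀ t) (w₀ q₁), dist_comm (w₀ q₁) (w n q₁)] at t5
  linarith

end Monotone

/-- A map that is continuous outside a countable set is measurable. -/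
theorem measurable_of_countable_not_continuousAt {X Y : Type*} [TopologicalSpace X] [T1Space X]
    [MeasurableSpace X] [BorelSpace X] [TopologicalSpace Y] [MeasurableSpace Y] [BorelSpace Y]
    {f : X → Y} (hf : {x | ¬ ContinuousAt f x}.Countable) : Measurable f := by
  refine measurable_of_isOpen fun U hU => ?_
  have : f ⁻¹' U = interior (f ⁻¹' U) ∪ (f ⁻¹' U ∩ {x | ¬ ContinuousAt f x}) := by
    ext x
    constructor
    · intro hx
      by_cases hc : ContinuousAt f x
      · exact Or.inl (mem_interior_iff_mem_nhds.2 (hc (hU.mem_nhds hx)))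
      · exact Or.inr ⟨hx, hc⟩
    · rintro (hx | hx)
      · exact interior_subset hx
      · exact hx.1
  rw [this]
  exact isOpen_interior.measurableSet.union (hf.mono inter_subset_right).measurableSet

/-! ### Superposition operators on L² -/

section Nemytskii

variable {α : Type*} [MeasurableSpace α] {μ : Measure α}
  {G : Type*} [NormedAddCommGroup G] [NormedSpace ℝ G]

theorem eLpNorm_two_sq_eq_lintegral {G : Type*} [NormedAddCommGroup G] (f : α → G) :
    eLpNorm f 2 μ ^ 2 = ∫⁻ x, ‖f x‖ₑ ^ 2 ∂μ := by
  have := eLpNorm_nnreal_pow_eq_lintegral (μ := μ) (f := f) (p := 2) (by norm_num)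
  simpa using this

theorem tendsto_zero_of_sq_tendsto_zero {ι : Type*} {l : Filter ι} {a : ι → ℝ≥0∞}
    (h : Tendsto (fun i => a i ^ 2) l (𝓝 0)) : Tendsto a l (𝓝 0) := by
  have h1 := (ENNReal.continuous_rpow_const (y := (1 / 2 : ℝ))).tendsto 0 |>.comp h
  rw [ENNReal.zero_rpow_of_pos (by norm_num)] at h1
  refine h1.congr fun i => ?_
  simp only [Function.comp]
  rw [← ENNReal.rpow_natCast, ← ENNReal.rpow_mul]
  norm_num

omit [NormedSpace ℝ G] in
/-- Dominated convergence to zero in `L²`. -/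
theorem tendsto_eLpNorm_two_zero_of_dominated {f : ℕ → α → G} {b : α → ℝ}
    (hf : ∀ n, AEStronglyMeasurable (f n) μ) (hb : MemLp b 2 μ)
    (hfb : ∀ n, ∀ᵐ x ∂μ, ‖f n x‖ ≤ b x)
    (hlim : ∀ᵐ x ∂μ, Tendsto (fun n => f n x) atTop (𝓝 0)) :
    Tendsto (fun n => eLpNorm (f n) 2 μ) atTop (𝓝 0) := by
  refine tendsto_zero_of_sq_tendsto_zero ?_
  simp only [eLpNorm_two_sq_eq_lintegral]
  have := tendsto_lintegral_of_dominated_convergence' (μ := μ) (F := fun n x => ‖f n x‖ₑ ^ 2)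
    (f := fun _ => 0) (fun x => ‖b x‖ₑ ^ 2) (fun n => (hf n).enorm.pow_const 2)
    (fun n => (hfb n).mono fun x hx => ?_) ?_ ?_
  · simpa using this
  · simp only
    gcongr
    exact enorm_le_iff_norm_le.2 (hx.trans (le_abs_self _))
  · rw [← eLpNorm_two_sq_eq_lintegral]
    exact ENNReal.pow_ne_top hb.2.ne
  · filter_upwards [hlim] with x hx
    have := ENNReal.Tendsto.pow (n := 2) hx.enorm
    simpa using this

/-- Continuity of superposition operators as multipliers on `L²`. -/
theorem tendsto_eLpNorm_comp_sub_smul {θ : ℝ → ℝ} (hθ : Continuous θ) {C : ℝ}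
    (hC : ∀ s, |θ s| ≤ C) {f : ℕ → α → ℝ} {f₀ : α → ℝ} (hf : ∀ n, AEStronglyMeasurable (f n) μ)
    (hf₀ : AEStronglyMeasurable f₀ μ)
    (hlim : Tendsto (fun n => eLpNorm (f n - f₀) 2 μ) atTop (𝓝 0)) {q : α → G}
    (hq : MemLp q 2 μ) :
    Tendsto (fun n => eLpNorm (fun x => (θ (f n x) - θ (f₀ x)) • q x) 2 μ) atTop (𝓝 0) := by
  -- Each subsequence has a further one converging almost everywhere; there dominated convergence
  -- applies with majorant `2C‖q‖`.
  refine tendsto_of_subseq_tendsto fun ns hns => ?_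
  have hm : TendstoInMeasure μ (fun n => f (ns n)) atTop f₀ :=
    tendstoInMeasure_of_tendsto_eLpNorm (by norm_num) (fun n => hf _) hf₀ (hlim.comp hns)
  obtain ⟨ms, -, hms⟩ := hm.exists_seq_tendsto_ae
  refine ⟨ms, tendsto_eLpNorm_two_zero_of_dominated (b := fun x => (2 * C) * ‖q x‖)
    (fun n => ?_) (hq.norm.const_mul _) (fun n => ?_) ?_⟩
  · exact ((hθ.comp_aestronglyMeasurable (hf _)).sub (hθ.comp_aestronglyMeasurable hf₀)).smul hq.1
  · refine Eventually.of_forall fun x => ?_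
    rw [norm_smul]
    gcongr
    rw [Real.norm_eq_abs]
    refine (abs_sub _ _).trans ?_
    linarith [hC (f (ns (ms n)) x), hC (f₀ x)]
  · filter_upwards [hms] with x hx
    have h1 := ((hθ.tendsto _).comp hx).sub_const (θ (f₀ x))
    rw [sub_self] at h1
    simpa using h1.smul_const (q x)

end Nemytskii

/-! ### The elastic weight as a multiplier -/

section Weight

/-- The elastic weight `η + (1 - s)²`, with `s` clipped to `[0,1]`. -/
noncomputable def weight (η s : ℝ) : ℝ := η + (1 - max 0 (min 1 s)) ^ 2

theorem continuous_weight (η : ℝ) : Continuous (weight η) := by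
  unfold weight; fun_prop

theorem le_weight (η s : ℝ) : η ≤ weight η s := by
  unfold weight; nlinarith [sq_nonneg (1 - max 0 (min 1 s))]

theorem weight_le (η s : ℝ) : weight η s ≤ η + 1 := by
  unfold weight
  have h0 : 0 ≤ max 0 (min 1 s) := le_max_left _ _
  have h1 : max 0 (min 1 s) ≤ 1 := max_le zero_le_one (min_le_left _ _)
  nlinarith

/-- On the physical range the clip is inactive. Outside it, the clip keeps the weight continuous and
between `η` and `η + 1`, so multiplication is a bounded operator for every `w` in L². -/
theorem weight_of_mem {η s : ℝ} (h0 : 0 ≤ s) (h1 : s ≤ 1) : weight η s = η + (1 - s) ^ 2 := by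
  unfold weight; rw [min_eq_right h1, max_eq_right h0]

theorem abs_weight_le {η : ℝ} (hη : 0 < η) (s : ℝ) : |weight η s| ≤ η + 1 := by
  rw [abs_of_nonneg (hη.le.trans (le_weight η s))]; exact weight_le η s

variable {α : Type*} [MeasurableSpace α] {μ : Measure α}
  {G : Type*} [NormedAddCommGroup G] [InnerProductSpace ℝ G]

theorem memLp_weight_smul {η : ℝ} (hη : 0 < η) (w : Lp ℝ 2 μ) (p : Lp G 2 μ) :
    MemLp (fun x => weight η (w x) • p x) 2 μ := by
  refine MemLp.of_le_mul (c := η + 1) (Lp.memLp p)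
    (((continuous_weight η).comp_aestronglyMeasurable (Lp.aestronglyMeasurable w)).smul
      (Lp.aestronglyMeasurable p)) (Eventually.of_forall fun x => ?_)
  rw [norm_smul]
  gcongr
  exact abs_weight_le hη _

/-- Multiplication by the elastic weight on `L²`. -/
noncomputable def weightMul {η : ℝ} (hη : 0 < η) (w : Lp ℝ 2 μ) : Lp G 2 μ →L[ℝ] Lp G 2 μ :=
  LinearMap.mkContinuous
    { toFun := fun p => (memLp_weight_smul hη w p).toLp _
      map_add' := fun p q => by
        apply Lp.ext
        filter_upwards [(memLp_weight_smul hη w (p + q)).coeFn_toLp,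
          (memLp_weight_smul hη w p).coeFn_toLp, (memLp_weight_smul hη w q).coeFn_toLp,
          Lp.coeFn_add p q, Lp.coeFn_add ((memLp_weight_smul hη w p).toLp _)
            ((memLp_weight_smul hη w q).toLp _)] with x h1 h2 h3 h4 h5
        rw [h1, h5, Pi.add_apply, h2, h3, h4, Pi.add_apply, smul_add]
      map_smul' := fun c p => by
        apply Lp.ext
        filter_upwards [(memLp_weight_smul hη w (c • p)).coeFn_toLp,
          (memLp_weight_smul hη w p).coeFn_toLp,
          Lp.coeFn_smul c p, Lp.coeFn_smul c ((memLp_weight_smul hη w p).toLp _)] with x h1 h2 h4 h5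
        simp only [RingHom.id_apply]
        rw [h1, h5, Pi.smul_apply, h2, h4, Pi.smul_apply, smul_comm] }
    (η + 1) fun p => by
      refine Lp.norm_le_mul_norm_of_ae_le_mul ?_
      filter_upwards [(memLp_weight_smul hη w p).coeFn_toLp] with x hx
      simp only [LinearMap.coe_mk, AddHom.coe_mk]
      rw [hx, norm_smul]
      gcongr
      exact abs_weight_le hη _

theorem coeFn_weightMul {η : ℝ} (hη : 0 < η) (w : Lp ℝ 2 μ) (p : Lp G 2 μ) :
    weightMul hη w p =ᵐ[μ] fun x => weight η (w x) • p x :=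
  (memLp_weight_smul hη w p).coeFn_toLp

theorem norm_weightMul_le {η : ℝ} (hη : 0 < η) (w : Lp ℝ 2 μ) (p : Lp G 2 μ) :
    ‖weightMul hη w p‖ ≤ (η + 1) * ‖p‖ := by
  refine Lp.norm_le_mul_norm_of_ae_le_mul ?_
  filter_upwards [coeFn_weightMul hη w p] with x hx
  rw [hx, norm_smul]
  gcongr
  exact abs_weight_le hη _

theorem inner_weightMul {η : ℝ} (hη : 0 < η) (w : Lp ℝ 2 μ) (p q : Lp G 2 μ) :
    inner ℝ (weightMul hη w p) q = ∫ x, weight η (w x) * inner ℝ (p x) (q x) ∂μ := by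
  rw [L2.inner_def]
  refine integral_congr_ae ?_
  filter_upwards [coeFn_weightMul hη w p] with x hx
  rw [hx, real_inner_smul_left]

theorem inner_weightMul_comm {η : ℝ} (hη : 0 < η) (w : Lp ℝ 2 μ) (p q : Lp G 2 μ) :
    inner ℝ (weightMul hη w p) q = inner ℝ (weightMul hη w q) p := by
  rw [inner_weightMul, inner_weightMul]
  simp only [real_inner_comm]

theorem integrable_weight_mul_inner {η : ℝ} (hη : 0 < η) (w : Lp ℝ 2 μ) (p q : Lp G 2 μ) :
    Integrable (fun x => weight η (w x) * inner ℝ (p x) (q x)) μ := by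
  refine (L2.integrable_inner (𝕜 := ℝ) (weightMul hη w p) q).congr ?_
  filter_upwards [coeFn_weightMul hη w p] with x hx
  rw [hx, real_inner_smul_left]

theorem mul_norm_sq_le_inner_weightMul {η : ℝ} (hη : 0 < η) (w : Lp ℝ 2 μ) (p : Lp G 2 μ) :
    η * ‖p‖ ^ 2 ≤ inner ℝ (weightMul hη w p) p := by
  rw [inner_weightMul, ← real_inner_self_eq_norm_sq, L2.inner_def, ← integral_const_mul]
  refine integral_mono ((L2.integrable_inner (𝕜 := ℝ) p p).const_mul _)
    (integrable_weight_mul_inner hη w p p) fun x => ?_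
  have := real_inner_self_nonneg (x := p x)
  simp only
  gcongr
  exact le_weight _ _

/-- With `p` frozen this is the continuity of superposition operators; the error `p_n - p` is
absorbed by the bound `η + 1`, uniform in the weight. -/
theorem continuous_weightMul {η : ℝ} (hη : 0 < η) :
    Continuous fun z : Lp ℝ 2 μ × Lp G 2 μ => weightMul hη z.1 z.2 := by
  rw [continuous_iff_seqContinuous]
  intro z z₀ hz
  obtain ⟨w, p⟩ := z₀
  have hw : Tendsto (fun n => (z n).1) atTop (𝓝 w) := (continuous_fst.tendsto _).comp hz
  have hp : Tendsto (fun n => (z n).2) atTop (𝓝 p) := (continuous_snd.tendsto _).comp hz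
  have h1 : Tendsto (fun n => weightMul hη (z n).1 p) atTop (𝓝 (weightMul hη w p)) := by
    rw [Lp.tendsto_Lp_iff_tendsto_eLpNorm'] at hw ⊢
    refine (tendsto_eLpNorm_comp_sub_smul (continuous_weight η) (abs_weight_le hη)
      (fun n => Lp.aestronglyMeasurable _) (Lp.aestronglyMeasurable _) hw (Lp.memLp p)).congr
      fun n => eLpNorm_congr_ae ?_
    filter_upwards [coeFn_weightMul hη (z n).1 p, coeFn_weightMul hη w p] with x h2 h3
    rw [Pi.sub_apply, h2, h3, sub_smul]
  have h2 : Tendsto (fun n => weightMul hη (z n).1 ((z n).2 - p)) atTop (𝓝 0) := by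
    refine squeeze_zero_norm (fun n => norm_weightMul_le hη _ _) ?_
    have := (tendsto_iff_norm_sub_tendsto_zero.1 hp).const_mul (η + 1)
    simpa using this
  have h3 := h1.add h2
  rw [add_zero] at h3
  refine h3.congr fun n => ?_
  simp

end Weight

/-! ### Abstract Sobolev pairs and the elastic equilibrium problem -/

section Elastic

variable {α : Type*} [MeasurableSpace α] {μ : Measure α}
  {G : Type*} [NormedAddCommGroup G] [InnerProductSpace ℝ G] [CompleteSpace G]
  {V : Type*} [NormedAddCommGroup V] [InnerProductSpace ℝ V] [CompleteSpace V]

/-- The properties of a closed subspace `V` of `H¹`, with its embedding `j` into `L²` and its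
gradient `d`, used in the existence proof: graph norm, compactness of `j`, and stability under
pointwise minima and maxima. -/
structure IsSobolevPair (j : V →L[ℝ] Lp ℝ 2 μ) (d : V →L[ℝ] Lp G 2 μ) : Prop where
  norm_sq : ∀ w, ‖w‖ ^ 2 = ‖j w‖ ^ 2 + ‖d w‖ ^ 2
  injective : Function.Injective j
  tendsto_zero : ∀ (x : ℕ → V) (M : ℝ), (∀ n, ‖x n‖ ≤ M) →
    (∀ f : V →L[ℝ] ℝ, Tendsto (fun n => f (x n)) atTop (𝓝 0)) →
    Tendsto (fun n => j (x n)) atTop (𝓝 0)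
  lattice : ∀ w₁ w₂, ∃ a b, j a = j w₁ ⊓ j w₂ ∧ j b = j w₁ ⊔ j w₂ ∧
    ‖d a‖ ^ 2 + ‖d b‖ ^ 2 ≤ ‖d w₁‖ ^ 2 + ‖d w₂‖ ^ 2

namespace IsSobolevPair

variable {j : V →L[ℝ] Lp ℝ 2 μ} {d : V →L[ℝ] Lp G 2 μ}

-- Weak compactness in `V`, combined with the compactness of `j` applied to the differences from the
-- weak limit.
omit [CompleteSpace G] in
theorem exists_subseq [TopologicalSpace.SeparableSpace V] (h : IsSobolevPair j d) (x : ℕ → V)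
    (M : ℝ) (hx : ∀ n, ‖x n‖ ≤ M) :
    ∃ (a : V) (φ : ℕ → ℕ), StrictMono φ ∧
      (∀ f : V →L[ℝ] ℝ, Tendsto (fun n => f (x (φ n))) atTop (𝓝 (f a))) ∧
      Tendsto (fun n => j (x (φ n))) atTop (𝓝 (j a)) := by
  obtain ⟨a, φ, hφ, ha⟩ := exists_weakly_tendsto_subseq x M hx
  refine ⟨a, φ, hφ, ha, ?_⟩
  have h1 := h.tendsto_zero (fun n => x (φ n) - a) (M + ‖a‖)
    (fun n => (norm_sub_le _ _).trans (by linarith [hx (φ n)])) fun f => by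
      have := (ha f).sub_const (f a)
      simpa using this
  rw [tendsto_iff_norm_sub_tendsto_zero]
  simpa using h1.norm

omit [CompleteSpace G] in
/-- Poincaré inequality on the orthogonal complement of the kernel of the gradient. -/
theorem exists_norm_le [TopologicalSpace.SeparableSpace V] (h : IsSobolevPair j d) :
    ∃ C : ℝ, 0 < C ∧ ∀ φ ∈ (d.ker)ᗮ, ‖φ‖ ≤ C * ‖d φ‖ := by
  by_contra! hcon
  have h1 : ∀ n : ℕ, ∃ φ ∈ (d.ker)ᗮ, ‖φ‖ = 1 ∧ ‖d φ‖ ≤ 1 / ((n : ℝ) + 1) := fun n => by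
    obtain ⟨φ, hφ, hlt⟩ := hcon (n + 1) (by positivity)
    have hpos : 0 < ‖φ‖ := lt_of_le_of_lt (by positivity) hlt
    refine ⟨‖φ‖⁻¹ • φ, Submodule.smul_mem _ _ hφ, ?_, ?_⟩
    · rw [norm_smul, norm_inv, norm_norm, inv_mul_cancel₀ hpos.ne']
    · rw [map_smul, norm_smul, norm_inv, norm_norm, inv_mul_eq_div, div_le_div_iff₀ hpos
        (by positivity)]
      linarith
  choose φ hφ h1φ hdφ using h1
  obtain ⟨a, ns, hns, hweak, hj⟩ := h.exists_subseq φ 1 fun n => (h1φ n).le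
  have hd0 : Tendsto (fun n => d (φ (ns n))) atTop (𝓝 0) := by
    refine squeeze_zero_norm (fun n => hdφ _) ?_
    exact tendsto_one_div_add_atTop_nhds_zero_nat.comp hns.tendsto_atTop
  have hda : d a = 0 := by
    refine ext_inner_left ℝ fun v => ?_
    have e1 := hweak ((innerSL ℝ v).comp d)
    have e2 : Tendsto (fun n => inner ℝ v (d (φ (ns n)))) atTop (𝓝 (inner ℝ v 0)) :=
      tendsto_const_nhds.inner hd0
    exact tendsto_nhds_unique e1 e2
  -- Values converge strongly by compactness and gradients tend to `0 = d a`, so the graph norm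
  -- gives strong convergence. The limit lies both in the kernel of `d` and in its orthogonal
  -- complement, yet has norm one.
  have hstrong : Tendsto (fun n => φ (ns n)) atTop (𝓝 a) := by
    rw [tendsto_iff_norm_sub_tendsto_zero]
    have e : Tendsto (fun n => ‖φ (ns n) - a‖ ^ 2) atTop (𝓝 0) := by
      have := ((tendsto_iff_norm_sub_tendsto_zero.1 hj).pow 2).add (hd0.norm.pow 2)
      simp only [norm_zero, ne_eq, OfNat.ofNat_ne_zero, not_false_eq_true, zero_pow,
        add_zero] at this
      refine this.congr fun n => ?_
      rw [h.norm_sq, map_sub, map_sub, hda, sub_zero]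
    have := e.sqrt
    simpa [Real.sqrt_sq (norm_nonneg _)] using this
  have hmem : a ∈ (d.ker)ᗮ :=
    (Submodule.isClosed_orthogonal _).mem_of_tendsto hstrong (Eventually.of_forall fun n => hφ _)
  have ha0 : a = 0 := by
    have := Submodule.inner_right_of_mem_orthogonal (K := d.ker) (u := a) (v := a)
      (LinearMap.mem_ker.2 hda) hmem
    exact inner_self_eq_zero.1 this
  have hn := hstrong.norm
  simp only [h1φ, ha0, norm_zero] at hn
  exact one_ne_zero (tendsto_nhds_unique tendsto_const_nhds hn)

/-- Solution operator of the elastic equilibrium problem with given damage `w`. -/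
theorem exists_elastic [TopologicalSpace.SeparableSpace V] (h : IsSobolevPair j d) {η : ℝ}
    (hη : 0 < η) (w : Lp ℝ 2 μ) :
    ∃ S : Lp G 2 μ →L[ℝ] V, ∀ p, S p ∈ (d.ker)ᗮ ∧
      ∀ ψ, inner ℝ (weightMul hη w (p + d (S p))) (d ψ) = (0 : ℝ) := by
  obtain ⟨C, hC, hcoer⟩ := h.exists_norm_le
  -- `D` may be too small to exclude constants, so the corrector is sought orthogonally to the
  -- kernel of `d`, where the Poincaré inequality makes the form of Lax–Milgram coercive.
  let H : Submodule ℝ V := (d.ker)ᗮ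
  let dH : H →L[ℝ] Lp G 2 μ := d.comp H.subtypeL
  let W : Lp G 2 μ →L[ℝ] Lp G 2 μ := weightMul hη w
  let T : H →L[ℝ] H := dH.adjoint.comp (W.comp dH)
  let B : H →L[ℝ] H →L[ℝ] ℝ := LinearMap.mkContinuous₂
    (LinearMap.mk₂ ℝ (fun x y => inner ℝ (T x) y)
      (fun x y z => by rw [map_add, inner_add_left])
      (fun c x y => by rw [map_smul, real_inner_smul_left, smul_eq_mul])
      (fun x y z => by rw [inner_add_right])
      (fun c x y => by rw [real_inner_smul_right, smul_eq_mul])) ‖T‖ fun x y => by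
        simp only [LinearMap.mk₂_apply]
        refine (norm_inner_le_norm _ _).trans ?_
        gcongr
        exact T.le_opNorm x
  have hB : ∀ x y : H, B x y = inner ℝ (W (d x)) (d y) := fun x y => by
    change inner ℝ (dH.adjoint (W (dH x))) y = _
    rw [ContinuousLinearMap.adjoint_inner_left]
    rfl
  have hBc : IsCoercive B := by
    -- The weight contributes `η`, and the Poincaré inequality `‖x‖ ≤ C‖d x‖` contributes `1 / C²`.
    refine ⟨η / C ^ 2, by positivity, fun x => ?_⟩
    rw [hB]
    refine le_trans ?_ (mul_norm_sq_le_inner_weightMul hη w (d x))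
    have h2 : ‖x‖ ≤ C * ‖d x‖ := hcoer x x.2
    have h3 : ‖x‖ * ‖x‖ ≤ (C * ‖d x‖) * (C * ‖d x‖) := by gcongr
    rw [div_mul_eq_mul_div, div_mul_eq_mul_div, div_le_iff₀ (by positivity)]
    nlinarith
  let L := hBc.continuousLinearEquivOfBilin
  refine ⟨-(H.subtypeL.comp ((L.symm : H →L[ℝ] H).comp (dH.adjoint.comp W))), fun p => ⟨?_, ?_⟩⟩
  · simp only [_root_.neg_apply]
    exact Submodule.neg_mem _ (Subtype.property _)
  · intro ψ
    set z : H := L.symm (dH.adjoint (W p)) with hz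
    have hSp : (-(H.subtypeL.comp ((L.symm : H →L[ℝ] H).comp (dH.adjoint.comp W)))) p = -(z : V) :=
      rfl
    rw [hSp]
    have hH : ∀ y : H, inner ℝ (W (p + d (-(z : V)))) (d y) = (0 : ℝ) := fun y => by
      have e := hBc.continuousLinearEquivOfBilin_apply z y
      rw [hB] at e
      have e2 : hBc.continuousLinearEquivOfBilin z = dH.adjoint (W p) := L.apply_symm_apply _
      rw [e2, ContinuousLinearMap.adjoint_inner_left] at e
      have e3 : dH y = d y := rfl
      rw [e3] at e
      rw [map_neg, map_add, map_neg, inner_add_left, inner_neg_left, e, add_neg_cancel]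
    have : CompleteSpace d.ker := d.isClosed_ker.completeSpace_coe
    -- The kernel component of a test function has zero gradient, so testing on the complement is
    -- enough.
    obtain ⟨y, hy, z', hz', rfl⟩ := Submodule.exists_add_mem_mem_orthogonal (K := d.ker) ψ
    have hy0 : d y = 0 := LinearMap.mem_ker.1 hy
    rw [map_add d y z', hy0, zero_add]
    exact hH ⟨z', hz'⟩

variable [TopologicalSpace.SeparableSpace V]

/-- The elastic corrector: `p + d (elastic p)` is in equilibrium for the damage `w`. -/
noncomputable def elastic (h : IsSobolevPair j d) {η : ℝ} (hη : 0 < η) (w : Lp ℝ 2 μ) :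
    Lp G 2 μ →L[ℝ] V := (h.exists_elastic hη w).choose

theorem elastic_mem (h : IsSobolevPair j d) {η : ℝ} (hη : 0 < η) (w : Lp ℝ 2 μ) (p : Lp G 2 μ) :
    h.elastic hη w p ∈ (d.ker)ᗮ := ((h.exists_elastic hη w).choose_spec p).1

/-- The stress operator `p ↦ (η + (1 - w)²)(p + d (elastic p))`. -/
noncomputable def stress (h : IsSobolevPair j d) {η : ℝ} (hη : 0 < η) (w : Lp ℝ 2 μ) :
    Lp G 2 μ →L[ℝ] Lp G 2 μ :=
  (weightMul hη w).comp (ContinuousLinearMap.id ℝ _ + d.comp (h.elastic hη w))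

theorem stress_apply (h : IsSobolevPair j d) {η : ℝ} (hη : 0 < η) (w : Lp ℝ 2 μ) (p : Lp G 2 μ) :
    h.stress hη w p = weightMul hη w (p + d (h.elastic hη w p)) := rfl

theorem inner_stress_d (h : IsSobolevPair j d) {η : ℝ} (hη : 0 < η) (w : Lp ℝ 2 μ) (p : Lp G 2 μ)
    (ψ : V) : inner ℝ (h.stress hη w p) (d ψ) = (0 : ℝ) :=
  ((h.exists_elastic hη w).choose_spec p).2 ψ

/-- The equilibrium stress is orthogonal to every `d ψ`, so any gradient may be added in the second
slot. Choosing the corrector of `q` makes `stress` visibly symmetric, as the chain rule requires. -/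
theorem inner_stress (h : IsSobolevPair j d) {η : ℝ} (hη : 0 < η) (w : Lp ℝ 2 μ) (p q : Lp G 2 μ)
    (ψ : V) : inner ℝ (h.stress hη w p) q
      = inner ℝ (weightMul hη w (p + d (h.elastic hη w p))) (q + d ψ) := by
  rw [← stress_apply, inner_add_right, inner_stress_d, add_zero]

theorem inner_stress_comm (h : IsSobolevPair j d) {η : ℝ} (hη : 0 < η) (w : Lp ℝ 2 μ)
    (p q : Lp G 2 μ) : inner ℝ (h.stress hη w p) q = inner ℝ (h.stress hη w q) p := by
  rw [h.inner_stress hη w p q (h.elastic hη w q), h.inner_stress hη w q p (h.elastic hη w p),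
    inner_weightMul_comm]

/-- The reduced elastic energy. -/
noncomputable def elasticEnergy (h : IsSobolevPair j d) {η : ℝ} (hη : 0 < η) (w : Lp ℝ 2 μ)
    (p : Lp G 2 μ) : ℝ := inner ℝ (h.stress hη w p) p

theorem elasticEnergy_def (h : IsSobolevPair j d) {η : ℝ} (hη : 0 < η) (w : Lp ℝ 2 μ)
    (p : Lp G 2 μ) : h.elasticEnergy hη w p = inner ℝ (h.stress hη w p) p := rfl

theorem elasticEnergy_eq (h : IsSobolevPair j d) {η : ℝ} (hη : 0 < η) (w : Lp ℝ 2 μ)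
    (p : Lp G 2 μ) : h.elasticEnergy hη w p
      = inner ℝ (weightMul hη w (p + d (h.elastic hη w p))) (p + d (h.elastic hη w p)) :=
  h.inner_stress hη w p p _

theorem elasticEnergy_nonneg (h : IsSobolevPair j d) {η : ℝ} (hη : 0 < η) (w : Lp ℝ 2 μ)
    (p : Lp G 2 μ) : 0 ≤ h.elasticEnergy hη w p := by
  rw [elasticEnergy_eq]
  exact le_trans (by positivity) (mul_norm_sq_le_inner_weightMul hη w _)

/-- The reduced elastic energy is the minimum of the elastic energy. -/
theorem elasticEnergy_le (h : IsSobolevPair j d) {η : ℝ} (hη : 0 < η) (w : Lp ℝ 2 μ)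
    (p : Lp G 2 μ) (ψ : V) :
    h.elasticEnergy hη w p ≤ inner ℝ (weightMul hη w (p + d ψ)) (p + d ψ) := by
  set σ := p + d (h.elastic hη w p) with hσ
  set χ := ψ - h.elastic hη w p with hχ
  have e : p + d ψ = σ + d χ := by rw [hσ, hχ, map_sub]; abel
  have h0 : inner ℝ (weightMul hη w σ) (d χ) = (0 : ℝ) := h.inner_stress_d hη w p χ
  have h1 := mul_norm_sq_le_inner_weightMul hη w (d χ)
  rw [elasticEnergy_eq, ← hσ, e]
  clear_value σ χ
  rw [map_add (weightMul hη w) σ (d χ), inner_add_left, inner_add_right, inner_add_right,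
    inner_weightMul_comm hη w (d χ) σ, h0]
  have : 0 ≤ η * ‖d χ‖ ^ 2 := by positivity
  linarith

/-- Test the equilibrium equation with the corrector itself: the weight is at least `η` on the left
and at most `η + 1` on the right. -/
theorem norm_d_elastic_le (h : IsSobolevPair j d) {η : ℝ} (hη : 0 < η) (w : Lp ℝ 2 μ)
    (p : Lp G 2 μ) : η * ‖d (h.elastic hη w p)‖ ≤ (η + 1) * ‖p‖ := by
  set z := d (h.elastic hη w p) with hz
  have h0 : inner ℝ (weightMul hη w (p + z)) z = (0 : ℝ) := h.inner_stress_d hη w p _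
  have h1 := mul_norm_sq_le_inner_weightMul hη w z
  rw [map_add, inner_add_left] at h0
  have h2 : -inner ℝ (weightMul hη w p) z ≤ (η + 1) * ‖p‖ * ‖z‖ := by
    refine (neg_le_abs _).trans ((abs_real_inner_le_norm _ _).trans ?_)
    gcongr
    exact norm_weightMul_le hη w p
  by_cases hz0 : ‖z‖ = 0
  · rw [hz0]; have := norm_nonneg p; nlinarith
  · have hpos : 0 < ‖z‖ := lt_of_le_of_ne (norm_nonneg _) (Ne.symm hz0)
    refine le_of_mul_le_mul_right ?_ hpos
    nlinarith

theorem norm_stress_le (h : IsSobolevPair j d) {η : ℝ} (hη : 0 < η) (w : Lp ℝ 2 μ)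
    (p : Lp G 2 μ) : ‖h.stress hη w p‖ ≤ (η + 1) * (1 + (η + 1) / η) * ‖p‖ := by
  rw [stress_apply]
  refine (norm_weightMul_le hη w _).trans ?_
  rw [mul_assoc]
  gcongr
  have h1 := h.norm_d_elastic_le hη w p
  have h2 : ‖d (h.elastic hη w p)‖ ≤ (η + 1) / η * ‖p‖ := by
    rw [div_mul_eq_mul_div, le_div_iff₀ hη]; linarith
  linarith [norm_add_le p (d (h.elastic hη w p))]

/-- Subtract the two equilibrium equations and test with the difference of the correctors. The
change of weight enters only through its action on the fixed field `σ`, so strong continuity of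
`weightMul` suffices. -/
theorem continuous_elastic (h : IsSobolevPair j d) {η : ℝ} (hη : 0 < η) :
    Continuous fun z : Lp ℝ 2 μ × Lp G 2 μ => h.elastic hη z.1 z.2 := by
  obtain ⟨C, hC, hcoer⟩ := h.exists_norm_le
  rw [continuous_iff_seqContinuous]
  intro z z₀ hz
  obtain ⟨w, p⟩ := z₀
  have hp : Tendsto (fun n => (z n).2) atTop (𝓝 p) := (continuous_snd.tendsto _).comp hz
  have hw : Tendsto (fun n => (z n).1) atTop (𝓝 w) := (continuous_fst.tendsto _).comp hz
  set σ := p + d (h.elastic hη w p) with hσ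
  have key : ∀ n, ‖h.elastic hη (z n).1 (z n).2 - h.elastic hη w p‖
      ≤ C / η * ((η + 1) * ‖(z n).2 - p‖ + ‖weightMul hη (z n).1 σ - weightMul hη w σ‖) := by
    intro n
    set δ := h.elastic hη (z n).1 (z n).2 - h.elastic hη w p with hδ
    set W := weightMul (G := G) hη (z n).1 with hW
    have h1 : inner ℝ (W ((z n).2 + d (h.elastic hη (z n).1 (z n).2))) (d δ) = (0 : ℝ) :=
      h.inner_stress_d hη _ _ _
    have h2 : inner ℝ (weightMul hη w σ) (d δ) = (0 : ℝ) := h.inner_stress_d hη _ _ _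
    have e : (z n).2 + d (h.elastic hη (z n).1 (z n).2) = d δ + ((z n).2 - p) + σ := by
      rw [hσ, hδ, map_sub]; abel
    rw [e, map_add, map_add, inner_add_left, inner_add_left] at h1
    have h3 := mul_norm_sq_le_inner_weightMul hη (z n).1 (d δ)
    have h4 : -inner ℝ (W ((z n).2 - p)) (d δ) ≤ ((η + 1) * ‖(z n).2 - p‖) * ‖d δ‖ := by
      refine (neg_le_abs _).trans ((abs_real_inner_le_norm _ _).trans ?_)
      gcongr
      exact norm_weightMul_le hη _ _
    have h5 : -inner ℝ (W σ - weightMul hη w σ) (d δ) ≤ ‖W σ - weightMul hη w σ‖ * ‖d δ‖ :=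
      (neg_le_abs _).trans (abs_real_inner_le_norm _ _)
    rw [inner_sub_left, h2] at h5
    have h6 : η * ‖d δ‖ ≤ (η + 1) * ‖(z n).2 - p‖ + ‖W σ - weightMul hη w σ‖ := by
      by_cases hz0 : ‖d δ‖ = 0
      · rw [hz0, mul_zero]; positivity
      · have hpos : 0 < ‖d δ‖ := lt_of_le_of_ne (norm_nonneg _) (Ne.symm hz0)
        refine le_of_mul_le_mul_right ?_ hpos
        nlinarith
    have h7 : ‖δ‖ ≤ C * ‖d δ‖ :=
      hcoer _ (Submodule.sub_mem _ (h.elastic_mem hη _ _) (h.elastic_mem hη _ _))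
    refine h7.trans ?_
    rw [div_mul_eq_mul_div, le_div_iff₀ hη, mul_assoc]
    gcongr
    linarith
  have hlim : Tendsto (fun n => C / η * ((η + 1) * ‖(z n).2 - p‖
      + ‖weightMul hη (z n).1 σ - weightMul hη w σ‖)) atTop (𝓝 0) := by
    have h1 := (tendsto_iff_norm_sub_tendsto_zero.1 hp).const_mul (η + 1)
    have h2 : Tendsto (fun n => weightMul hη (z n).1 σ) atTop (𝓝 (weightMul hη w σ)) :=
      ((continuous_weightMul (G := G) hη).tendsto (w, σ)).comp
        (hw.prodMk_nhds tendsto_const_nhds)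
    have := (h1.add (tendsto_iff_norm_sub_tendsto_zero.1 h2)).const_mul (C / η)
    simpa using this
  change Tendsto (fun n => h.elastic hη (z n).1 (z n).2) atTop (𝓝 (h.elastic hη w p))
  rw [tendsto_iff_norm_sub_tendsto_zero]
  exact squeeze_zero (fun n => norm_nonneg _) key hlim

theorem continuous_stress (h : IsSobolevPair j d) {η : ℝ} (hη : 0 < η) :
    Continuous fun z : Lp ℝ 2 μ × Lp G 2 μ => h.stress hη z.1 z.2 :=
  (continuous_weightMul hη).comp (continuous_fst.prodMk
    (continuous_snd.add (d.continuous.comp (h.continuous_elastic hη))))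

theorem continuous_elasticEnergy (h : IsSobolevPair j d) {η : ℝ} (hη : 0 < η) :
    Continuous fun z : Lp ℝ 2 μ × Lp G 2 μ => h.elasticEnergy hη z.1 z.2 :=
  (h.continuous_stress hη).inner continuous_snd

theorem tendsto_elasticEnergy (h : IsSobolevPair j d) {η : ℝ} (hη : 0 < η) {ι : Type*}
    {l : Filter ι} {w : ι → Lp ℝ 2 μ} {w₀ : Lp ℝ 2 μ} {p : ι → Lp G 2 μ} {p₀ : Lp G 2 μ}
    (hw : Tendsto w l (𝓝 w₀)) (hp : Tendsto p l (𝓝 p₀)) :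
    Tendsto (fun i => h.elasticEnergy hη (w i) (p i)) l (𝓝 (h.elasticEnergy hη w₀ p₀)) := by
  have h1 : Tendsto (fun z : Lp ℝ 2 μ × Lp G 2 μ => h.elasticEnergy hη z.1 z.2) (𝓝 (w₀, p₀))
      (𝓝 (h.elasticEnergy hη w₀ p₀)) := (h.continuous_elasticEnergy hη).tendsto (w₀, p₀)
  have h2 := h1.comp (hw.prodMk_nhds hp)
  exact h2

theorem tendsto_stress (h : IsSobolevPair j d) {η : ℝ} (hη : 0 < η) {ι : Type*}
    {l : Filter ι} {w : ι → Lp ℝ 2 μ} {w₀ : Lp ℝ 2 μ} {p : ι → Lp G 2 μ} {p₀ : Lp G 2 μ}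
    (hw : Tendsto w l (𝓝 w₀)) (hp : Tendsto p l (𝓝 p₀)) :
    Tendsto (fun i => h.stress hη (w i) (p i)) l (𝓝 (h.stress hη w₀ p₀)) := by
  have h1 : Tendsto (fun z : Lp ℝ 2 μ × Lp G 2 μ => h.stress hη z.1 z.2) (𝓝 (w₀, p₀))
      (𝓝 (h.stress hη w₀ p₀)) := (h.continuous_stress hη).tendsto (w₀, p₀)
  have h2 := h1.comp (hw.prodMk_nhds hp)
  exact h2

attribute [irreducible] elastic stress elasticEnergy

end IsSobolevPair

end Elastic

/-! ### Surface energy, minimizers and stability of unilateral minimality -/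

section Damage

variable {α : Type*} [MeasurableSpace α] {μ : Measure α}
  {G : Type*} [NormedAddCommGroup G] [InnerProductSpace ℝ G] [CompleteSpace G]
  {V : Type*} [NormedAddCommGroup V] [InnerProductSpace ℝ V] [CompleteSpace V]

theorem inf_sq_add_sup_sq (a b : ℝ) : (a ⊓ b) ^ 2 + (a ⊔ b) ^ 2 = a ^ 2 + b ^ 2 := by
  rcases le_total a b with h | h
  · rw [inf_eq_left.2 h, sup_eq_right.2 h]
  · rw [inf_eq_right.2 h, sup_eq_left.2 h, add_comm]

theorem norm_inf_sq_add_norm_sup_sq (f g : Lp ℝ 2 μ) :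
    ‖f ⊓ g‖ ^ 2 + ‖f ⊔ g‖ ^ 2 = ‖f‖ ^ 2 + ‖g‖ ^ 2 := by
  simp only [← real_inner_self_eq_norm_sq, L2.inner_def]
  rw [← integral_add (L2.integrable_inner _ _) (L2.integrable_inner _ _),
    ← integral_add (L2.integrable_inner _ _) (L2.integrable_inner _ _)]
  refine integral_congr_ae ?_
  filter_upwards [Lp.coeFn_inf f g, Lp.coeFn_sup f g] with x h1 h2
  rw [h1, h2]
  have := inf_sq_add_sup_sq (f x) (g x)
  simpa [sq] using this

/-- The surface part `(ε/2) ‖∇w‖² + (1/(2ε)) ‖w‖²` of the energy, in terms of `w = 1 - v`. -/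
noncomputable def damageEnergy (j : V →L[ℝ] Lp ℝ 2 μ) (d : V →L[ℝ] Lp G 2 μ) (ε : ℝ) (w : V) : ℝ :=
  ε / 2 * ‖d w‖ ^ 2 + 1 / (2 * ε) * ‖j w‖ ^ 2

namespace IsSobolevPair

variable {j : V →L[ℝ] Lp ℝ 2 μ} {d : V →L[ℝ] Lp G 2 μ}

omit [CompleteSpace G] [CompleteSpace V] in
theorem damageEnergy_nonneg {ε : ℝ} (hε : 0 < ε) (w : V) : 0 ≤ damageEnergy j d ε w := by
  unfold damageEnergy; positivity

-- The factors `2 / ε` and `2ε` undo the coefficients `ε / 2` and `1 / (2ε)` of the two squares.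
omit [CompleteSpace G] [CompleteSpace V] in
theorem norm_le_of_damageEnergy_le (h : IsSobolevPair j d) {ε : ℝ} (hε : 0 < ε) {w : V} {M : ℝ}
    (hw : damageEnergy j d ε w ≤ M) : ‖w‖ ≤ √((2 / ε + 2 * ε) * M) := by
  refine Real.le_sqrt_of_sq_le ?_
  unfold damageEnergy at hw
  rw [h.norm_sq]
  have h1 : 0 ≤ ε / 2 * ‖d w‖ ^ 2 := by positivity
  have h2 : 0 ≤ 1 / (2 * ε) * ‖j w‖ ^ 2 := by positivity
  have h3 : ‖d w‖ ^ 2 = (2 / ε) * (ε / 2 * ‖d w‖ ^ 2) := by field_simp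
  have h4 : ‖j w‖ ^ 2 = (2 * ε) * (1 / (2 * ε) * ‖j w‖ ^ 2) := by field_simp
  rw [h3, h4]
  have a1 : (2 / ε) * (ε / 2 * ‖d w‖ ^ 2) ≤ 2 / ε * M := by gcongr; linarith
  have a2 : (2 * ε) * (1 / (2 * ε) * ‖j w‖ ^ 2) ≤ 2 * ε * M := by gcongr; linarith
  linarith

-- Submodularity of the surface energy: pointwise min and max merely exchange the values of the two
-- functions, and the lattice property handles the gradients.
omit [CompleteSpace G] [CompleteSpace V] in
theorem exists_minmax (h : IsSobolevPair j d) {ε : ℝ} (hε : 0 < ε) (w₁ w₂ : V) :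
    ∃ a b, j a = j w₁ ⊓ j w₂ ∧ j b = j w₁ ⊔ j w₂ ∧
      damageEnergy j d ε a + damageEnergy j d ε b
        ≤ damageEnergy j d ε w₁ + damageEnergy j d ε w₂ := by
  obtain ⟨a, b, ha, hb, hd⟩ := h.lattice w₁ w₂
  refine ⟨a, b, ha, hb, ?_⟩
  unfold damageEnergy
  have h1 := norm_inf_sq_add_norm_sup_sq (j w₁) (j w₂)
  rw [← ha, ← hb] at h1
  have h2 : ε / 2 * (‖d a‖ ^ 2 + ‖d b‖ ^ 2) ≤ ε / 2 * (‖d w₁‖ ^ 2 + ‖d w₂‖ ^ 2) := by gcongr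
  have h3 : 1 / (2 * ε) * (‖j a‖ ^ 2 + ‖j b‖ ^ 2) = 1 / (2 * ε) * (‖j w₁‖ ^ 2 + ‖j w₂‖ ^ 2) := by
    rw [h1]
  linarith

variable [TopologicalSpace.SeparableSpace V]

omit [CompleteSpace G] in
/-- Closedness and lower semicontinuity of the surface energy along `L²` convergence. -/
theorem exists_lift_of_tendsto (h : IsSobolevPair j d) {ε : ℝ} (hε : 0 < ε) {x : ℕ → V}
    {ℓ : Lp ℝ 2 μ} {c : ℕ → ℝ} {c₀ : ℝ} (hx : ∀ n, damageEnergy j d ε (x n) ≤ c n)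
    (hc : Tendsto c atTop (𝓝 c₀)) (hℓ : Tendsto (fun n => j (x n)) atTop (𝓝 ℓ)) :
    ∃ w, j w = ℓ ∧ damageEnergy j d ε w ≤ c₀ := by
  obtain ⟨M, hM⟩ := hc.bddAbove_range
  obtain ⟨a, φ, hφ, hweak, hj⟩ := h.exists_subseq x _
    fun n => h.norm_le_of_damageEnergy_le hε ((hx n).trans (hM ⟨n, rfl⟩))
  have hja : j a = ℓ := tendsto_nhds_unique hj (hℓ.comp hφ.tendsto_atTop)
  refine ⟨a, hja, ?_⟩
  -- Half the differential at `a` of the quadratic energy. By convexity the energy lies above its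
  -- tangent at `a`, and the tangent is weakly continuous, which gives lower semicontinuity.
  let f : V →L[ℝ] ℝ := (ε / 2) • (innerSL ℝ (d a)).comp d + (1 / (2 * ε)) • (innerSL ℝ (j a)).comp j
  have hf : ∀ z, f z = ε / 2 * inner ℝ (d a) (d z) + 1 / (2 * ε) * inner ℝ (j a) (j z) :=
    fun z => rfl
  have key : ∀ n, damageEnergy j d ε a + 2 * (f (x (φ n)) - f a) ≤ c (φ n) := fun n => by
    refine le_trans ?_ (hx _)
    rw [hf, hf]
    unfold damageEnergy
    have e1 := @norm_sub_sq_real _ _ _ (d (x (φ n))) (d a)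
    have e2 := @norm_sub_sq_real _ _ _ (j (x (φ n))) (j a)
    rw [real_inner_comm] at e1 e2
    rw [real_inner_self_eq_norm_sq, real_inner_self_eq_norm_sq]
    have h1 : 0 ≤ ε / 2 * ‖d (x (φ n)) - d a‖ ^ 2 := by positivity
    have h2 : 0 ≤ 1 / (2 * ε) * ‖j (x (φ n)) - j a‖ ^ 2 := by positivity
    rw [e1] at h1
    rw [e2] at h2
    linarith
  have hlim : Tendsto (fun n => damageEnergy j d ε a + 2 * (f (x (φ n)) - f a)) atTop
      (𝓝 (damageEnergy j d ε a + 2 * (f a - f a))) :=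
    (((hweak f).sub_const _).const_mul _).const_add _
  rw [sub_self, mul_zero, add_zero] at hlim
  exact le_of_tendsto_of_tendsto' hlim (hc.comp hφ.tendsto_atTop) key

/-- The total reduced energy. -/
noncomputable def totalEnergy (h : IsSobolevPair j d) {η : ℝ} (hη : 0 < η) (ε : ℝ) (w : V)
    (p : Lp G 2 μ) : ℝ := h.elasticEnergy hη (j w) p + damageEnergy j d ε w

theorem totalEnergy_eq (h : IsSobolevPair j d) {η : ℝ} (hη : 0 < η) (ε : ℝ) (w : V)
    (p : Lp G 2 μ) :
    h.totalEnergy hη ε w p = h.elasticEnergy hη (j w) p + damageEnergy j d ε w := rfl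

theorem totalEnergy_nonneg (h : IsSobolevPair j d) {η ε : ℝ} (hη : 0 < η) (hε : 0 < ε) (w : V)
    (p : Lp G 2 μ) : 0 ≤ h.totalEnergy hη ε w p :=
  add_nonneg (h.elasticEnergy_nonneg hη _ _) (damageEnergy_nonneg hε _)

/-- Existence of minimizers above a given damage `w₀` and below an obstacle `e`. -/
theorem exists_minimizer (h : IsSobolevPair j d) {η ε : ℝ} (hη : 0 < η) (hε : 0 < ε)
    {e : Lp ℝ 2 μ} {w₀ : V} (hw₀ : j w₀ ≤ e) (p : Lp G 2 μ) :
    ∃ w, j w ∈ Icc (j w₀) e ∧ ∀ w', j w' ∈ Icc (j w₀) e →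
      h.totalEnergy hη ε w p ≤ h.totalEnergy hη ε w' p := by
  have hex : ∃ m : ℝ, (∀ w', j w' ∈ Icc (j w₀) e → m ≤ h.totalEnergy hη ε w' p) ∧
      ∃ x : ℕ → V, (∀ n, j (x n) ∈ Icc (j w₀) e) ∧
        Tendsto (fun n => h.totalEnergy hη ε (x n) p) atTop (𝓝 m) := by
    let f : {w : V // j w ∈ Icc (j w₀) e} → ℝ := fun w => h.totalEnergy hη ε w p
    have hne : (range f).Nonempty := ⟨_, ⟨w₀, le_rfl, hw₀⟩, rfl⟩
    have hb : BddBelow (range f) := ⟨0, by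
      rintro _ ⟨w, rfl⟩
      exact h.totalEnergy_nonneg hη hε _ _⟩
    obtain ⟨u, -, hu, huS⟩ := exists_seq_tendsto_sInf hne hb
    choose x hxu using huS
    refine ⟨sInf (range f), fun w' hw' => csInf_le hb ⟨⟨w', hw'⟩, rfl⟩, fun n => x n,
      fun n => (x n).2, hu.congr fun n => (hxu n).symm⟩
  obtain ⟨m, hm, x, hx, hu⟩ := hex
  -- Written this way the surface energies have upper bounds that converge along the subsequence,
  -- since the elastic term is L²-continuous.
  have hdx : ∀ n, damageEnergy j d ε (x n)
      ≤ h.totalEnergy hη ε (x n) p - h.elasticEnergy hη (j (x n)) p := fun n => by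
    rw [totalEnergy_eq]; linarith
  obtain ⟨M, hM⟩ := hu.bddAbove_range
  obtain ⟨a, φ, hφ, -, hj⟩ := h.exists_subseq x _
    fun n => h.norm_le_of_damageEnergy_le hε (M := M) ((hdx n).trans (by
      have := hM ⟨n, rfl⟩
      have h2 := h.elasticEnergy_nonneg hη (j (x n)) p
      linarith))
  have hel := h.tendsto_elasticEnergy hη hj (tendsto_const_nhds (x := p))
  obtain ⟨w, hw, hdw⟩ := h.exists_lift_of_tendsto hε (fun n => hdx (φ n))
    ((hu.comp hφ.tendsto_atTop).sub hel) hj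
  refine ⟨w, ?_, fun w' hw' => ?_⟩
  · rw [hw]
    exact isClosed_Icc.mem_of_tendsto hj (Eventually.of_forall fun n => hx _)
  · refine le_trans ?_ (hm w' hw')
    rw [totalEnergy_eq, hw]
    linarith

/-- Unilateral minimality is stable under `L²` convergence of the damage. -/
theorem minimality_of_tendsto (h : IsSobolevPair j d) {η ε : ℝ} (hη : 0 < η) (hε : 0 < ε)
    {e : Lp ℝ 2 μ} {x : ℕ → V} {p : ℕ → Lp G 2 μ} {w : V} {p₀ : Lp G 2 μ}
    (hxe : ∀ n, j (x n) ≤ e)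
    (hmin : ∀ n, ∀ w', j w' ∈ Icc (j (x n)) e →
      h.totalEnergy hη ε (x n) (p n) ≤ h.totalEnergy hη ε w' (p n))
    (hx : Tendsto (fun n => j (x n)) atTop (𝓝 (j w))) (hp : Tendsto p atTop (𝓝 p₀))
    {w' : V} (hw' : j w' ∈ Icc (j w) e) :
    h.totalEnergy hη ε w p₀ ≤ h.totalEnergy hη ε w' p₀ := by
  choose a b ha hb hab using fun n => h.exists_minmax hε (x n) w'
  -- The admissible competitor is `max(xₙ, w')`. Submodularity turns its surface energy into that of
  -- `w'` and of `min(xₙ, w')`, cancelling the surface energy of `xₙ`, for which no convergence is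
  -- known.
  have key : ∀ n, damageEnergy j d ε (a n) ≤ h.elasticEnergy hη (j (x n) ⊔ j w') (p n)
      + damageEnergy j d ε w' - h.elasticEnergy hη (j (x n)) (p n) := fun n => by
    have := hmin n (b n) (by rw [hb]; exact ⟨le_sup_left, sup_le (hxe n) hw'.2⟩)
    rw [totalEnergy_eq, totalEnergy_eq, hb] at this
    linarith [hab n]
  have h1 := h.tendsto_elasticEnergy hη (hx.sup_nhds (tendsto_const_nhds (x := j w'))) hp
  have h2 := h.tendsto_elasticEnergy hη hx hp
  have h3 : Tendsto (fun n => j (a n)) atTop (𝓝 (j w ⊓ j w')) := by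
    simp only [ha]
    exact hx.inf_nhds tendsto_const_nhds
  obtain ⟨z, hz, hdz⟩ := h.exists_lift_of_tendsto hε key ((h1.add_const _).sub h2) h3
  -- In the limit the minimum is `w` and the maximum is `w'`, because `w'` lies above `w`.
  rw [inf_eq_left.2 hw'.1] at hz
  rw [h.injective hz, sup_eq_right.2 hw'.1] at hdz
  rw [totalEnergy_eq, totalEnergy_eq]
  linarith

end IsSobolevPair

end Damage

/-! ### Energy inequalities for monotone damage -/

section Evolution

variable {α : Type*} [MeasurableSpace α] {μ : Measure α}
  {G : Type*} [NormedAddCommGroup G] [InnerProductSpace ℝ G] [CompleteSpace G]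
  {V : Type*} [NormedAddCommGroup V] [InnerProductSpace ℝ V] [CompleteSpace V]

theorem norm_curve_le {F : Type*} [NormedAddCommGroup F] [NormedSpace ℝ F] {p p' : ℝ → F}
    (hp' : Integrable p') (hp : ∀ t, p t = p 0 + ∫ τ in (0 : ℝ)..t, p' τ) (t : ℝ) :
    ‖p t‖ ≤ ‖p 0‖ + ∫ τ, ‖p' τ‖ := by
  rw [hp t]
  refine (norm_add_le _ _).trans ?_
  gcongr
  refine intervalIntegral.norm_integral_le_integral_norm_uIoc.trans ?_
  exact setIntegral_le_integral hp'.norm (Eventually.of_forall fun _ => norm_nonneg _)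

theorem continuous_curve {F : Type*} [NormedAddCommGroup F] [NormedSpace ℝ F] {p p' : ℝ → F}
    (hp' : Integrable p') (hp : ∀ t, p t = p 0 + ∫ τ in (0 : ℝ)..t, p' τ) : Continuous p := by
  have : Continuous fun t => p 0 + ∫ τ in (0 : ℝ)..t, p' τ :=
    continuous_const.add (intervalIntegral.continuous_primitive
      (fun _ _ => hp'.intervalIntegrable) 0)
  exact this.congr fun t => (hp t).symm

namespace IsSobolevPair

variable {j : V →L[ℝ] Lp ℝ 2 μ} {d : V →L[ℝ] Lp G 2 μ} [TopologicalSpace.SeparableSpace V]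

/-- The power expended by the boundary datum: `2 ∫ (η + (1 - w)²)(p + d (elastic p)) · q`. -/
noncomputable def stressPower (h : IsSobolevPair j d) {η : ℝ} (hη : 0 < η) (w : Lp ℝ 2 μ)
    (p q : Lp G 2 μ) : ℝ := 2 * inner ℝ (h.stress hη w p) q

theorem abs_stressPower_le (h : IsSobolevPair j d) {η : ℝ} (hη : 0 < η) (w : Lp ℝ 2 μ)
    {p q : Lp G 2 μ} {R : ℝ} (hR : ‖p‖ ≤ R) :
    ‖h.stressPower hη w p q‖ ≤ 2 * ((η + 1) * (1 + (η + 1) / η) * R) * ‖q‖ := by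
  rw [stressPower, Real.norm_eq_abs, abs_mul, abs_two, mul_assoc]
  gcongr
  refine (abs_real_inner_le_norm _ _).trans ?_
  gcongr
  refine (h.norm_stress_le hη w p).trans ?_
  gcongr

theorem tendsto_stressPower (h : IsSobolevPair j d) {η : ℝ} (hη : 0 < η) {ι : Type*}
    {l : Filter ι} {w : ι → Lp ℝ 2 μ} {w₀ : Lp ℝ 2 μ} {p q : Lp G 2 μ}
    (hw : Tendsto w l (𝓝 w₀)) :
    Tendsto (fun i => h.stressPower hη (w i) p q) l (𝓝 (h.stressPower hη w₀ p q)) := by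
  unfold stressPower
  exact ((h.tendsto_stress hη hw (tendsto_const_nhds (x := p))).inner
    tendsto_const_nhds).const_mul 2

theorem totalEnergy_sub_eq_integral (h : IsSobolevPair j d) {η ε : ℝ} (hη : 0 < η) (w : V)
    {p p' : ℝ → Lp G 2 μ} (hp' : Integrable p')
    (hp : ∀ t, p t = p 0 + ∫ τ in (0 : ℝ)..t, p' τ) (a b : ℝ) :
    h.totalEnergy hη ε w (p b) - h.totalEnergy hη ε w (p a)
      = ∫ τ in a..b, h.stressPower hη (j w) (p τ) (p' τ) := by
  have := quadratic_sub_eq_integral (h.stress hη (j w)) (h.inner_stress_comm hη (j w)) hp' hp a b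
  rw [totalEnergy_eq, totalEnergy_eq, elasticEnergy_def, elasticEnergy_def]
  unfold stressPower
  linarith

/-- The damage may jump, but at only countably many times, so the stress is measurable along the
curve. The datum is bounded, hence the power is dominated by a multiple of `‖p'‖`. -/
theorem integrable_stressPower [SecondCountableTopology (Lp G 2 μ)] (h : IsSobolevPair j d)
    {η : ℝ} (hη : 0 < η) {w : ℝ → Lp ℝ 2 μ} (hw : Monotone w) (hw0 : ∀ t, 0 ≤ w t)
    {p p' : ℝ → Lp G 2 μ} (hp' : Integrable p')
    (hp : ∀ t, p t = p 0 + ∫ τ in (0 : ℝ)..t, p' τ) :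
    Integrable fun τ => h.stressPower hη (w τ) (p τ) (p' τ) := by
  have hpc := continuous_curve hp' hp
  borelize ↥(Lp G 2 μ)
  have hm : Measurable fun τ => h.stress hη (w τ) (p τ) := by
    refine measurable_of_countable_not_continuousAt
      ((countable_not_continuousAt_Lp hw hw0).mono fun t ht => ?_)
    rw [mem_ofPred_eq] at ht ⊢
    exact fun hc => ht (h.tendsto_stress hη hc hpc.continuousAt)
  refine (hp'.norm.const_mul _).mono'
    ((hm.stronglyMeasurable.aestronglyMeasurable.inner hp'.aestronglyMeasurable).const_mul 2)
    (Eventually.of_forall fun t => h.abs_stressPower_le hη (w t) (norm_curve_le hp' hp t))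

/-- Incremental minimization. -/
theorem exists_incremental (h : IsSobolevPair j d) {η ε : ℝ} (hη : 0 < η) (hε : 0 < ε)
    {e : Lp ℝ 2 μ} {w₀ : V} (hw₀ : j w₀ ≤ e) (p : ℕ → Lp G 2 μ)
    (hmin : ∀ w', j w' ∈ Icc (j w₀) e → h.totalEnergy hη ε w₀ (p 0) ≤ h.totalEnergy hη ε w' (p 0)) :
    ∃ x : ℕ → V, x 0 = w₀ ∧ (∀ i, j (x i) ≤ e) ∧ Monotone (fun i => j (x i)) ∧
      (∀ i, h.totalEnergy hη ε (x (i + 1)) (p (i + 1)) ≤ h.totalEnergy hη ε (x i) (p (i + 1))) ∧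
      (∀ i w', j w' ∈ Icc (j (x i)) e →
        h.totalEnergy hη ε (x i) (p i) ≤ h.totalEnergy hη ε w' (p i)) := by
  have hstep : ∀ (q : Lp G 2 μ) (w : {w : V // j w ≤ e}), ∃ z : {w : V // j w ≤ e},
      j w ≤ j z ∧ ∀ w', j w' ∈ Icc (j (w : V)) e →
        h.totalEnergy hη ε z q ≤ h.totalEnergy hη ε w' q := fun q w => by
    obtain ⟨z, hz, hz'⟩ := h.exists_minimizer hη hε w.2 q
    exact ⟨⟨z, hz.2⟩, hz.1, hz'⟩
  choose F hF hF' using hstep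
  let x : ℕ → {w : V // j w ≤ e} := fun i => Nat.rec ⟨w₀, hw₀⟩ (fun i w => F (p (i + 1)) w) i
  have hx : ∀ i, x (i + 1) = F (p (i + 1)) (x i) := fun i => rfl
  have hmono : ∀ i, j (x i).1 ≤ j (x (i + 1)).1 := fun i => hF _ _
  refine ⟨fun i => (x i).1, rfl, fun i => (x i).2, monotone_nat_of_le_succ hmono, fun i => ?_,
    fun i w' hw' => ?_⟩
  · simp only [hx]
    exact hF' _ _ _ ⟨le_rfl, (x i).2⟩
  · cases i with
    | zero => exact hmin w' hw'
    | succ i =>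
      simp only [hx] at hw' ⊢
      exact hF' _ _ _ ⟨(hF _ _).trans hw'.1, hw'.2⟩

/-- Energy inequality for the piecewise constant interpolation of incremental minimizers. -/
theorem discrete_energy_le [SecondCountableTopology (Lp G 2 μ)] (h : IsSobolevPair j d) {η ε : ℝ}
    (hη : 0 < η) {p p' : ℝ → Lp G 2 μ} (hp' : Integrable p')
    (hp : ∀ t, p t = p 0 + ∫ τ in (0 : ℝ)..t, p' τ) {N : ℝ} (hN : 0 < N) {x : ℕ → V}
    (hx0 : 0 ≤ j (x 0)) (hx : Monotone fun i => j (x i))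
    (hstep : ∀ i : ℕ, h.totalEnergy hη ε (x (i + 1)) (p ((i + 1 : ℕ) / N))
      ≤ h.totalEnergy hη ε (x i) (p ((i + 1 : ℕ) / N))) {t : ℝ} (ht : 0 ≤ t) :
    h.totalEnergy hη ε (x ⌊N * t⌋₊) (p t) ≤ h.totalEnergy hη ε (x 0) (p 0)
      + ∫ τ in (0 : ℝ)..t, h.stressPower hη (j (x ⌊N * τ⌋₊)) (p τ) (p' τ) := by
  have hint : Integrable fun τ => h.stressPower hη (j (x ⌊N * τ⌋₊)) (p τ) (p' τ) :=
    h.integrable_stressPower hη (w := fun τ => j (x ⌊N * τ⌋₊))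
      (fun s t hst => hx (Nat.floor_mono (by gcongr)))
      (fun t => hx0.trans (hx (Nat.zero_le _))) hp' hp
  have key : ∀ i : ℕ, ∀ t, (i : ℝ) / N ≤ t → t ≤ (i + 1 : ℕ) / N →
      h.totalEnergy hη ε (x i) (p t) ≤ h.totalEnergy hη ε (x 0) (p 0)
      + ∫ τ in (0 : ℝ)..t, h.stressPower hη (j (x ⌊N * τ⌋₊)) (p τ) (p' τ) := by
    -- On one time step the damage is frozen at `x i`, and the chain rule gives the exact work of
    -- the datum.
    have piece : ∀ i : ℕ, ∀ t, (i : ℝ) / N ≤ t → t ≤ (i + 1 : ℕ) / N →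
        ∫ τ in ((i : ℝ) / N)..t, h.stressPower hη (j (x ⌊N * τ⌋₊)) (p τ) (p' τ)
          = h.totalEnergy hη ε (x i) (p t) - h.totalEnergy hη ε (x i) (p (i / N)) := by
      intro i t h1 h2
      rw [h.totalEnergy_sub_eq_integral hη (x i) hp' hp]
      refine intervalIntegral.integral_congr_ae ?_
      -- At `τ = t = (i + 1) / N` the floor would already be `i + 1`; this single point is
      -- discarded.
      have hne : ∀ᵐ τ : ℝ, τ ≠ t := by simp [ae_iff]
      filter_upwards [hne] with τ hτ hmem
      rw [uIoc_of_le h1] at hmem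
      have hlt : τ < t := lt_of_le_of_ne hmem.2 hτ
      have hf : ⌊N * τ⌋₊ = i := by
        rw [Nat.floor_eq_iff (mul_nonneg hN.le ((by positivity : (0 : ℝ) ≤ i / N).trans hmem.1.le))]
        constructor
        · have := hmem.1.le
          rw [div_le_iff₀ hN] at this
          linarith
        · have := hlt.trans_le h2
          rw [lt_div_iff₀ hN] at this
          push_cast at this
          linarith
      rw [hf]
    intro i
    induction i with
    | zero =>
      intro t h1 h2
      have := piece 0 t h1 h2
      simp only [CharP.cast_eq_zero, zero_div] at this
      rw [this]
      linarith
    | succ i ih =>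
      intro t h1 h2
      have e1 := piece (i + 1) t h1 h2
      -- The estimate up to the node with damage `x i`; `hstep` then switches to `x (i + 1)` at no
      -- cost.
      have e2 := ih ((i + 1 : ℕ) / N) (by gcongr; linarith) le_rfl
      have e3 := hstep i
      rw [← intervalIntegral.integral_add_adjacent_intervals
        (hint.intervalIntegrable (a := 0) (b := ((i + 1 : ℕ) : ℝ) / N))
        (hint.intervalIntegrable (a := ((i + 1 : ℕ) : ℝ) / N) (b := t)), e1]
      linarith
  have hNt : 0 ≤ N * t := by positivity
  refine key ⌊N * t⌋₊ t ?_ ?_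
  · rw [div_le_iff₀ hN, mul_comm t]
    exact Nat.floor_le hNt
  · rw [le_div_iff₀ hN, mul_comm t]
    push_cast
    exact (Nat.lt_floor_add_one _).le

/-- Unilateral minimality implies the lower energy inequality. -/
theorem energy_ge_of_minimality [SecondCountableTopology (Lp G 2 μ)] (h : IsSobolevPair j d)
    {η ε : ℝ} (hη : 0 < η) {p p' : ℝ → Lp G 2 μ} (hp' : Integrable p')
    (hp : ∀ t, p t = p 0 + ∫ τ in (0 : ℝ)..t, p' τ) {e : Lp ℝ 2 μ} {w : ℝ → V}
    (hw : Monotone fun t => j (w t)) (hwe : ∀ t, j (w t) ∈ Icc 0 e) {T : ℝ}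
    (hmin : ∀ t ∈ Icc 0 T, ∀ w', j w' ∈ Icc (j (w t)) e →
      h.totalEnergy hη ε (w t) (p t) ≤ h.totalEnergy hη ε w' (p t)) {t : ℝ} (ht : t ∈ Icc 0 T) :
    h.totalEnergy hη ε (w 0) (p 0) + ∫ τ in (0 : ℝ)..t, h.stressPower hη (j (w τ)) (p τ) (p' τ)
      ≤ h.totalEnergy hη ε (w t) (p t) := by
  rcases ht.1.eq_or_lt with rfl | ht0
  · simp
  -- Rounding up to a grid of step `t / (n + 1)`: on each step the damage is frozen at its value at
  -- the right end, which is the competitor for minimality at the left end.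
  let ρ : ℕ → ℝ → ℝ := fun n τ => ⌈(n + 1 : ℝ) / t * τ⌉ * (t / (n + 1 : ℝ))
  have hρmono : ∀ n, Monotone (ρ n) := fun n a b hab => by
    simp only [ρ]
    gcongr
  have hint : ∀ n, Integrable fun τ => h.stressPower hη (j (w (ρ n τ))) (p τ) (p' τ) := fun n =>
    h.integrable_stressPower hη (w := fun τ => j (w (ρ n τ))) (hw.comp (hρmono n))
      (fun t => (hwe _).1) hp' hp
  have hdisc : ∀ n : ℕ, h.totalEnergy hη ε (w 0) (p 0)
      + ∫ τ in (0 : ℝ)..t, h.stressPower hη (j (w (ρ n τ))) (p τ) (p' τ)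
      ≤ h.totalEnergy hη ε (w t) (p t) := by
    intro n
    set k : ℝ := t / (n + 1 : ℝ) with hk
    have hkpos : 0 < k := by positivity
    have key : ∀ i : ℕ, i ≤ n + 1 → h.totalEnergy hη ε (w 0) (p 0)
        + ∫ τ in (0 : ℝ)..(i * k), h.stressPower hη (j (w (ρ n τ))) (p τ) (p' τ)
        ≤ h.totalEnergy hη ε (w (i * k)) (p (i * k)) := by
      intro i
      induction i with
      | zero => intro _; simp
      | succ i ih =>
        intro hi
        have e1 := ih (by omega)
        have hik : (i : ℝ) * k ≤ ((i + 1 : ℕ) : ℝ) * k := by gcongr; linarith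
        have hiT : (i : ℝ) * k ∈ Icc 0 T := by
          refine ⟨by positivity, le_trans ?_ ht.2⟩
          have : (i : ℝ) ≤ n + 1 := by exact_mod_cast (by omega : i ≤ n + 1)
          calc (i : ℝ) * k ≤ (n + 1) * k := by gcongr
            _ = t := by rw [hk]; field_simp
        -- The future damage is an admissible competitor by monotonicity; what it then gains up to
        -- the next node is the work along the frozen damage.
        have e2 := hmin _ hiT (w ((i + 1 : ℕ) * k)) ⟨hw hik, (hwe _).2⟩
        have e3 : ∫ τ in ((i : ℝ) * k)..((i + 1 : ℕ) * k),
            h.stressPower hη (j (w (ρ n τ))) (p τ) (p' τ)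
            = h.totalEnergy hη ε (w ((i + 1 : ℕ) * k)) (p ((i + 1 : ℕ) * k))
              - h.totalEnergy hη ε (w ((i + 1 : ℕ) * k)) (p (i * k)) := by
          rw [h.totalEnergy_sub_eq_integral hη _ hp' hp]
          refine intervalIntegral.integral_congr_ae (Eventually.of_forall fun τ hτ => ?_)
          rw [uIoc_of_le hik] at hτ
          have hc : ⌈(n + 1 : ℝ) / t * τ⌉ = ((i + 1 : ℕ) : ℤ) := by
            have hkk : (n + 1 : ℝ) / t = 1 / k := by rw [hk, one_div_div]
            rw [Int.ceil_eq_iff, hkk]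
            have a1 := hτ.1
            have a2 := hτ.2
            push_cast at a2 ⊢
            rw [one_div, inv_mul_eq_div, lt_div_iff₀ hkpos, div_le_iff₀ hkpos]
            constructor <;> linarith
          have hρ : ρ n τ = ((i + 1 : ℕ) : ℝ) * k := by
            simp only [ρ]
            rw [hc]
            push_cast
            rfl
          rw [hρ]
        rw [← intervalIntegral.integral_add_adjacent_intervals
          ((hint n).intervalIntegrable (a := 0) (b := (i : ℝ) * k))
          ((hint n).intervalIntegrable (a := (i : ℝ) * k) (b := ((i + 1 : ℕ) : ℝ) * k)), e3]
        linarith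
    have := key (n + 1) le_rfl
    have e : ((n + 1 : ℕ) : ℝ) * k = t := by rw [hk]; push_cast; field_simp
    rwa [e] at this
  have hρlim : ∀ τ, Tendsto (fun n => ρ n τ) atTop (𝓝 τ) := by
    intro τ
    rw [tendsto_iff_norm_sub_tendsto_zero]
    refine squeeze_zero (fun _ => norm_nonneg _) (fun n => ?_)
      (g := fun n : ℕ => t * (1 / ((n : ℝ) + 1))) ?_
    · have hk : 0 < t / (n + 1 : ℝ) := by positivity
      have a1 := Int.le_ceil ((n + 1 : ℝ) / t * τ)
      have a2 := Int.ceil_lt_add_one ((n + 1 : ℝ) / t * τ)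
      have e1 : τ = ((n + 1 : ℝ) / t * τ) * (t / (n + 1 : ℝ)) := by field_simp
      have e2 : ρ n τ - τ
          = (⌈(n + 1 : ℝ) / t * τ⌉ - (n + 1 : ℝ) / t * τ) * (t / (n + 1 : ℝ)) := by
        rw [sub_mul, ← e1]
      rw [e2, Real.norm_eq_abs, abs_of_nonneg (mul_nonneg (by linarith) hk.le), mul_one_div]
      nlinarith
    · simpa using tendsto_one_div_add_atTop_nhds_zero_nat.const_mul t
  have hlim : Tendsto (fun n => ∫ τ in (0 : ℝ)..t, h.stressPower hη (j (w (ρ n τ))) (p τ) (p' τ))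
      atTop (𝓝 (∫ τ in (0 : ℝ)..t, h.stressPower hη (j (w τ)) (p τ) (p' τ))) := by
    refine intervalIntegral.tendsto_integral_filter_of_dominated_convergence _
      (Eventually.of_forall fun n => (hint n).aestronglyMeasurable.restrict)
      (Eventually.of_forall fun n => Eventually.of_forall fun τ _ =>
        h.abs_stressPower_le hη _ (norm_curve_le hp' hp τ))
      ((hp'.norm.const_mul _).intervalIntegrable) ?_
    -- As the grid is refined the rounded times tend to `τ`, so the powers converge at every
    -- continuity time of the damage.
    have hco : ∀ᵐ τ : ℝ, ContinuousAt (fun t => j (w t)) τ := by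
      rw [ae_iff]
      exact (countable_not_continuousAt_Lp hw fun t => (hwe t).1).measure_zero _
    filter_upwards [hco] with τ hτ _
    exact h.tendsto_stressPower hη (hτ.tendsto.comp (hρlim τ))
  exact le_of_tendsto' (hlim.const_add _) hdisc

end IsSobolevPair

end Evolution

/-! ### Passage to the limit in the time discretization -/

section Existence

/-- Pointwise compactness: a sequence of curves in a compact metrizable set has a pointwise cluster
curve, attained along subsequences for countably many times at once. -/
theorem exists_cluster_curve {X : Type*} [TopologicalSpace X] [FirstCountableTopology X]
    {K : Set X} (hK : IsCompact K) {f : ℕ → ℝ → X} (hf : ∀ n t, f n t ∈ K) :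
    ∃ g : ℝ → X, (∀ t, g t ∈ K) ∧ ∀ s t : ℝ, ∃ φ : ℕ → ℕ, StrictMono φ ∧
      (∀ q : ℚ, Tendsto (fun n => f (φ n) q) atTop (𝓝 (g q))) ∧
      Tendsto (fun n => f (φ n) s) atTop (𝓝 (g s)) ∧
      Tendsto (fun n => f (φ n) t) atTop (𝓝 (g t)) := by
  -- Tychonoff over all real times at once: the cluster curve is fixed before any subsequence is
  -- chosen.
  have hc : IsCompact (univ.pi fun _ : ℝ => K) := isCompact_univ_pi fun _ => hK
  obtain ⟨g, hg, hcl⟩ := hc.exists_mapClusterPt (f := atTop) (u := f)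
    (tendsto_principal.2 (Eventually.of_forall fun n t _ => hf n t))
  refine ⟨g, fun t => hg t (mem_univ t), fun s t => ?_⟩
  -- Restricted to the rational times and the two prescribed ones, the product is first countable,
  -- so a cluster point is a subsequential limit.
  let c : ℚ ⊕ Bool → ℝ := Sum.elim (fun q => (q : ℝ)) (fun b => if b then s else t)
  let r : (ℝ → X) → (ℚ ⊕ Bool → X) := fun u i => u (c i)
  have hr : Continuous r := continuous_pi fun i => continuous_apply _
  obtain ⟨φ, hφ, hlim⟩ := (hcl.continuousAt_comp hr.continuousAt).tendsto_subseq
  rw [tendsto_pi_nhds] at hlim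
  refine ⟨φ, hφ, fun q => hlim (Sum.inl q), ?_, ?_⟩
  · exact hlim (Sum.inr true)
  · exact hlim (Sum.inr false)

variable {α : Type*} [MeasurableSpace α] {μ : Measure α}
  {G : Type*} [NormedAddCommGroup G] [InnerProductSpace ℝ G] [CompleteSpace G]
  {V : Type*} [NormedAddCommGroup V] [InnerProductSpace ℝ V] [CompleteSpace V]

namespace IsSobolevPair

variable {j : V →L[ℝ] Lp ℝ 2 μ} {d : V →L[ℝ] Lp G 2 μ} [TopologicalSpace.SeparableSpace V]

-- A bound on the surface energy gives compactness in L², and lower semicontinuity together with the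
-- closed order interval keeps limits in the set.
omit [CompleteSpace G] in
theorem isCompact_image (h : IsSobolevPair j d) {ε : ℝ} (hε : 0 < ε) (e : Lp ℝ 2 μ) (M : ℝ) :
    IsCompact (j '' {w | j w ∈ Icc 0 e ∧ damageEnergy j d ε w ≤ M}) := by
  rw [isCompact_iff_isSeqCompact]
  intro y hy
  choose x hx hxy using hy
  obtain ⟨a, φ, hφ, -, hj⟩ := h.exists_subseq x _
    fun n => h.norm_le_of_damageEnergy_le hε (hx n).2
  obtain ⟨w, hw, hdw⟩ := h.exists_lift_of_tendsto hε (fun n => (hx (φ n)).2)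
    (tendsto_const_nhds (x := M)) hj
  refine ⟨j w, ⟨w, ⟨?_, hdw⟩, rfl⟩, φ, hφ, ?_⟩
  · rw [hw]
    exact isClosed_Icc.mem_of_tendsto hj (Eventually.of_forall fun n => (hx _).1)
  · rw [hw]
    exact hj.congr fun n => hxy _

/-- Existence of an irreversible quasistatic evolution. -/
theorem exists_evolution [SecondCountableTopology (Lp G 2 μ)] (h : IsSobolevPair j d) {η ε : ℝ}
    (hη : 0 < η) (hε : 0 < ε) {e : Lp ℝ 2 μ} (he : 0 ≤ e) {p p' : ℝ → Lp G 2 μ}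
    (hp' : Integrable p') (hp : ∀ t, p t = p 0 + ∫ τ in (0 : ℝ)..t, p' τ) :
    ∃ w : ℝ → V, Monotone (fun t => j (w t)) ∧ (∀ t, j (w t) ∈ Icc 0 e) ∧
      (∀ w', j w' ∈ Icc 0 e → h.totalEnergy hη ε (w 0) (p 0) ≤ h.totalEnergy hη ε w' (p 0)) ∧
      (∀ t ∈ Icc (0 : ℝ) 1, ∀ w', j w' ∈ Icc (j (w t)) e →
        h.totalEnergy hη ε (w t) (p t) ≤ h.totalEnergy hη ε w' (p t)) ∧
      ∀ t ∈ Icc (0 : ℝ) 1, h.totalEnergy hη ε (w t) (p t) = h.totalEnergy hη ε (w 0) (p 0)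
        + ∫ τ in (0 : ℝ)..t, h.stressPower hη (j (w τ)) (p τ) (p' τ) := by
  have hpc := continuous_curve hp' hp
  -- Starting above zero damage imposes only `0 ≤ w ≤ e`: the initial state has no history to
  -- respect.
  obtain ⟨w₀, hw₀, hmin₀⟩ := h.exists_minimizer hη hε (w₀ := (0 : V)) (e := e)
    (by rwa [map_zero]) (p 0)
  rw [map_zero] at hw₀ hmin₀
  have hinc := fun n : ℕ => h.exists_incremental hη hε hw₀.2
    (fun i : ℕ => p (i / ((n : ℝ) + 1))) (by
      simp only [Nat.cast_zero, zero_div]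
      exact fun w' hw' => hmin₀ w' ⟨hw₀.1.trans hw'.1, hw'.2⟩)
  choose x hx0 hxe hxm hxstep hxmin using hinc
  -- The index of the last node before `t`. The minimum freezes the curve after time 1, and the
  -- natural floor, zero at nonpositive arguments, freezes it before time 0.
  let k : ℕ → ℝ → ℕ := fun n t => ⌊((n : ℝ) + 1) * min t 1⌋₊
  have hkm : ∀ n, Monotone (k n) := fun n s t hst => by
    simp only [k]
    gcongr
  have hk0 : ∀ n, ∀ t ≤ 0, k n t = 0 := fun n t ht => by
    refine Nat.floor_of_nonpos (mul_nonpos_of_nonneg_of_nonpos (by positivity) ?_)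
    exact (min_le_left _ _).trans ht
  let W : ℕ → ℝ → V := fun n t => x n (k n t)
  have hWm : ∀ n, Monotone fun t => j (W n t) := fun n => (hxm n).comp (hkm n)
  have hW0 : ∀ n, W n 0 = w₀ := fun n => by simp only [W]; rw [hk0 n 0 le_rfl, hx0]
  have hWe : ∀ n t, j (W n t) ∈ Icc 0 e := fun n t =>
    ⟨hw₀.1.trans (by rw [← hx0 n]; exact hxm n (Nat.zero_le _)), hxe _ _⟩
  have hint : ∀ n, Integrable fun τ => h.stressPower hη (j (W n τ)) (p τ) (p' τ) := fun n =>
    h.integrable_stressPower hη (hWm n) (fun t => (hWe n t).1) hp' hp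
  have hdisc : ∀ n, ∀ t ∈ Icc (0 : ℝ) 1, h.totalEnergy hη ε (W n t) (p t)
      ≤ h.totalEnergy hη ε w₀ (p 0)
        + ∫ τ in (0 : ℝ)..t, h.stressPower hη (j (W n τ)) (p τ) (p' τ) := by
    intro n t ht
    have key := h.discrete_energy_le (ε := ε) hη hp' hp (N := (n : ℝ) + 1) (by positivity)
      (x := x n) (by rw [hx0]; exact hw₀.1) (hxm n) (hxstep n) ht.1
    rw [hx0] at key
    have e1 : W n t = x n ⌊((n : ℝ) + 1) * t⌋₊ := by simp only [W, k]; rw [min_eq_left ht.2]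
    rw [e1]
    refine key.trans_eq ?_
    congr 1
    refine intervalIntegral.integral_congr fun τ hτ => ?_
    rw [uIcc_of_le ht.1] at hτ
    simp only [W, k]
    rw [min_eq_left (hτ.2.trans ht.2)]
  set R : ℝ := ‖p 0‖ + ∫ τ, ‖p' τ‖ with hR
  set B : ℝ := 2 * ((η + 1) * (1 + (η + 1) / η) * R) with hB
  have hRpos : 0 ≤ R := (norm_nonneg _).trans (norm_curve_le hp' hp 0)
  have hBpos : 0 ≤ B := by positivity
  have hbound : ∀ (z : Lp ℝ 2 μ) τ, ‖h.stressPower hη z (p τ) (p' τ)‖ ≤ B * ‖p' τ‖ := fun z τ =>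
    h.abs_stressPower_le hη z (norm_curve_le hp' hp τ)
  set M : ℝ := h.totalEnergy hη ε w₀ (p 0) + ∫ τ, B * ‖p' τ‖ with hM
  have hdM' : ∀ n, ∀ t ∈ Icc (0 : ℝ) 1, damageEnergy j d ε (W n t) ≤ M := by
    intro n t ht
    have h1 := hdisc n t ht
    rw [totalEnergy_eq] at h1
    have h2 := h.elasticEnergy_nonneg hη (j (W n t)) (p t)
    have h3 : ∫ τ in (0 : ℝ)..t, h.stressPower hη (j (W n τ)) (p τ) (p' τ)
        ≤ ∫ τ, B * ‖p' τ‖ := by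
      refine (le_abs_self _).trans ?_
      rw [← Real.norm_eq_abs]
      refine intervalIntegral.norm_integral_le_integral_norm_uIoc.trans ?_
      refine (setIntegral_le_integral (hint n).norm
        (Eventually.of_forall fun _ => norm_nonneg _)).trans ?_
      exact integral_mono (hint n).norm (hp'.norm.const_mul _) fun τ => hbound _ τ
    linarith
  have hdM : ∀ n t, damageEnergy j d ε (W n t) ≤ M := by
    intro n t
    have e1 : W n t = W n (max 0 (min t 1)) := by
      simp only [W]
      congr 1
      rcases le_total 0 t with ht | ht
      · rw [max_eq_right (le_min ht zero_le_one)]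
        simp only [k]
        rw [min_eq_left (min_le_right t 1)]
      · rw [hk0 n t ht, max_eq_left ((min_le_left _ _).trans ht), hk0 n 0 le_rfl]
    rw [e1]
    exact hdM' n _ ⟨le_max_left _ _, max_le zero_le_one (min_le_right _ _)⟩
  obtain ⟨g, hgK, hsub⟩ := exists_cluster_curve (h.isCompact_image hε e M)
    (f := fun n t => j (W n t)) fun n t => ⟨W n t, ⟨hWe n t, hdM n t⟩, rfl⟩
  choose w hw hwg using hgK
  have hjw : (fun t => j (w t)) = g := funext hwg
  have hmono : Monotone fun t => j (w t) := by
    intro s t hst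
    obtain ⟨φ, -, -, h1, h2⟩ := hsub s t
    simp only [hwg]
    exact le_of_tendsto_of_tendsto' h1 h2 fun n => hWm _ hst
  have hw0 : w 0 = w₀ := by
    obtain ⟨φ, -, -, h1, -⟩ := hsub 0 0
    simp only [hW0] at h1
    refine h.injective ?_
    rw [hwg]
    exact tendsto_nhds_unique h1 tendsto_const_nhds
  have hmin : ∀ t ∈ Icc (0 : ℝ) 1, ∀ w', j w' ∈ Icc (j (w t)) e →
      h.totalEnergy hη ε (w t) (p t) ≤ h.totalEnergy hη ε w' (p t) := by
    intro t ht w' hw'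
    obtain ⟨φ, hφ, -, h1, -⟩ := hsub t t
    rw [← hwg] at h1
    -- The discrete state is minimal for the datum at its node, not at `t`; the node is within one
    -- step of `t`, and `p` is continuous.
    have hτ : Tendsto (fun n : ℕ => (k n t : ℝ) / ((n : ℝ) + 1)) atTop (𝓝 t) := by
      rw [tendsto_iff_norm_sub_tendsto_zero]
      refine squeeze_zero (fun _ => norm_nonneg _) (fun n => ?_)
        tendsto_one_div_add_atTop_nhds_zero_nat
      have hn : (0 : ℝ) < n + 1 := by positivity
      have a1 := Nat.floor_le (a := ((n : ℝ) + 1) * t) (mul_nonneg hn.le ht.1)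
      have a2 := Nat.lt_floor_add_one (((n : ℝ) + 1) * t)
      have e1 : k n t = ⌊((n : ℝ) + 1) * t⌋₊ := by simp only [k]; rw [min_eq_left ht.2]
      rw [e1, Real.norm_eq_abs, abs_le]
      constructor
      · rw [neg_le_sub_iff_le_add, ← add_div, le_div_iff₀ hn]; linarith
      · have : (⌊((n : ℝ) + 1) * t⌋₊ : ℝ) / (n + 1) ≤ t := by rw [div_le_iff₀ hn]; linarith
        have h0 : (0 : ℝ) ≤ 1 / ((n : ℝ) + 1) := by positivity
        linarith
    have hpτ : Tendsto (fun n => p ((k (φ n) t : ℝ) / ((φ n : ℝ) + 1))) atTop (𝓝 (p t)) :=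
      (hpc.tendsto t).comp (hτ.comp hφ.tendsto_atTop)
    exact h.minimality_of_tendsto hη hε (fun n => (hWe _ _).2) (fun n => hxmin (φ n) _) h1 hpτ hw'
  have hupper : ∀ t ∈ Icc (0 : ℝ) 1, h.totalEnergy hη ε (w t) (p t)
      ≤ h.totalEnergy hη ε (w 0) (p 0)
        + ∫ τ in (0 : ℝ)..t, h.stressPower hη (j (w τ)) (p τ) (p' τ) := by
    intro t ht
    -- The subsequence depends on `t`, but its limits at rational times are always those of the same
    -- curve `g`; hence so are its limits at almost every time.
    obtain ⟨φ, hφ, hq, h1, -⟩ := hsub t t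
    have hco : ∀ᵐ τ : ℝ, ContinuousAt (fun t => j (w t)) τ := by
      rw [ae_iff]
      exact (countable_not_continuousAt_Lp hmono fun t => (hw t).1.1).measure_zero _
    have hlim : Tendsto
        (fun n => ∫ τ in (0 : ℝ)..t, h.stressPower hη (j (W (φ n) τ)) (p τ) (p' τ)) atTop
        (𝓝 (∫ τ in (0 : ℝ)..t, h.stressPower hη (j (w τ)) (p τ) (p' τ))) := by
      refine intervalIntegral.tendsto_integral_filter_of_dominated_convergence _
        (Eventually.of_forall fun n => (hint _).aestronglyMeasurable.restrict)
        (Eventually.of_forall fun n => Eventually.of_forall fun τ _ => hbound _ τ)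
        ((hp'.norm.const_mul _).intervalIntegrable) ?_
      filter_upwards [hco] with τ hτ _
      refine h.tendsto_stressPower hη ?_
      have := tendsto_of_tendsto_rat (w := fun n t => j (W (φ n) t)) (w₀ := fun t => j (w t))
        (fun n => hWm _) (fun q => by simp only [hwg]; exact hq q) hτ
      exact this
    have hel := h.tendsto_elasticEnergy hη h1 (tendsto_const_nhds (x := p t))
    -- Lower semicontinuity is applied to the surface energy alone, its upper bound being the
    -- convergent right-hand side minus the elastic energy.
    obtain ⟨z, hz, hdz⟩ := h.exists_lift_of_tendsto hε (x := fun n => W (φ n) t)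
      (fun n => by
        have := hdisc (φ n) t ht
        rw [totalEnergy_eq] at this
        exact le_sub_iff_add_le'.2 this)
      ((hlim.const_add (h.totalEnergy hη ε w₀ (p 0))).sub hel) h1
    rw [← hwg] at hz
    rw [h.injective hz, ← hwg] at hdz
    rw [totalEnergy_eq, hw0]
    linarith
  refine ⟨w, hmono, fun t => (hw t).1, fun w' hw' => by rw [hw0]; exact hmin₀ w' hw', hmin,
    fun t ht => le_antisymm (hupper t ht) ?_⟩
  exact h.energy_ge_of_minimality hη hp' hp hmono (fun t => (hw t).1) hmin ht

end IsSobolevPair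

end Existence

/-! ### Smooth approximations of the positive part -/

section SmoothTruncation

/-- A smooth approximation of `s ↦ (s - c)⁺`, for `c ≥ 0`. -/
noncomputable def smoothTrunc (c : ℝ) (k : ℕ) (s : ℝ) : ℝ :=
  ∫ r in (0 : ℝ)..s, Real.smoothTransition (k * (r - c))

theorem contDiff_smoothStep (c : ℝ) (k : ℕ) :
    ContDiff ℝ ∞ fun r => Real.smoothTransition (k * (r - c)) :=
  Real.smoothTransition.contDiff.comp (contDiff_const.mul (contDiff_id.sub contDiff_const))

theorem hasDerivAt_smoothTrunc (c : ℝ) (k : ℕ) (s : ℝ) :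
    HasDerivAt (smoothTrunc c k) (Real.smoothTransition (k * (s - c))) s :=
  intervalIntegral.integral_hasDerivAt_right
    ((contDiff_smoothStep c k).continuous.intervalIntegrable _ _)
    (contDiff_smoothStep c k).continuous.stronglyMeasurable.stronglyMeasurableAtFilter
    (contDiff_smoothStep c k).continuous.continuousAt

theorem deriv_smoothTrunc (c : ℝ) (k : ℕ) :
    deriv (smoothTrunc c k) = fun s => Real.smoothTransition (k * (s - c)) :=
  funext fun s => (hasDerivAt_smoothTrunc c k s).deriv

theorem contDiff_smoothTrunc (c : ℝ) (k : ℕ) : ContDiff ℝ ∞ (smoothTrunc c k) := by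
  rw [contDiff_infty_iff_deriv, deriv_smoothTrunc]
  exact ⟨fun s => (hasDerivAt_smoothTrunc c k s).differentiableAt, contDiff_smoothStep c k⟩

theorem smoothTrunc_zero (c : ℝ) (k : ℕ) : smoothTrunc c k 0 = 0 := by
  simp [smoothTrunc]

theorem abs_smoothStep_le (x : ℝ) : |Real.smoothTransition x| ≤ 1 := by
  rw [abs_of_nonneg (Real.smoothTransition.nonneg x)]
  exact Real.smoothTransition.le_one x

theorem abs_smoothTrunc_le (c : ℝ) (k : ℕ) (s : ℝ) : |smoothTrunc c k s| ≤ |s| := by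
  have := intervalIntegral.norm_integral_le_of_norm_le_const (a := (0 : ℝ)) (b := s) (C := 1)
    (f := fun r => Real.smoothTransition (k * (r - c))) fun x _ => abs_smoothStep_le _
  simpa [smoothTrunc] using this

theorem tendsto_smoothStep (c s : ℝ) :
    Tendsto (fun k : ℕ => Real.smoothTransition (k * (s - c))) atTop
      (𝓝 (if c < s then 1 else 0)) := by
  split_ifs with h
  · refine tendsto_const_nhds.congr' ?_
    obtain ⟨K, hK⟩ := exists_nat_ge (1 / (s - c))
    filter_upwards [eventually_ge_atTop K] with k hk
    have hpos : 0 < s - c := sub_pos.2 h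
    refine (Real.smoothTransition.one_of_one_le ?_).symm
    rw [← div_le_iff₀ hpos]
    exact hK.trans (by exact_mod_cast hk)
  · refine tendsto_const_nhds.congr fun k => (Real.smoothTransition.zero_of_nonpos ?_).symm
    exact mul_nonpos_of_nonneg_of_nonpos (by positivity) (by linarith)

/-- Since `c ≥ 0`, integration from the base point 0 meets the step only beyond `c`, and no additive
constant appears. -/
theorem integral_step_eq {c : ℝ} (hc : 0 ≤ c) (s : ℝ) :
    ∫ r in (0 : ℝ)..s, (if c < r then (1 : ℝ) else 0) = max (s - c) 0 := by
  have hz : ∀ a, a ≤ c → ∫ r in (0 : ℝ)..a, (if c < r then (1 : ℝ) else 0) = 0 := fun a ha => by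
    rw [intervalIntegral.integral_congr (g := fun _ => (0 : ℝ)), intervalIntegral.integral_zero]
    intro r hr
    have : r ≤ c := (hr.2).trans (max_le hc ha)
    simp only [if_neg (not_lt.2 this)]
  have hm : Monotone fun r : ℝ => if c < r then (1 : ℝ) else 0 := fun a b hab => by
    simp only
    split_ifs <;> linarith
  rcases le_total s c with h | h
  · rw [hz s h, max_eq_right (by linarith)]
  · rw [← intervalIntegral.integral_add_adjacent_intervals (b := c) hm.intervalIntegrable
      hm.intervalIntegrable, hz c le_rfl, max_eq_left (by linarith), zero_add]
    rw [intervalIntegral.integral_congr_ae (g := fun _ => (1 : ℝ))]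
    · simp
    · refine Eventually.of_forall fun r hr => ?_
      rw [uIoc_of_le h] at hr
      rw [if_pos hr.1]

theorem tendsto_smoothTrunc {c : ℝ} (hc : 0 ≤ c) (s : ℝ) :
    Tendsto (fun k => smoothTrunc c k s) atTop (𝓝 (max (s - c) 0)) := by
  rw [← integral_step_eq hc s]
  unfold smoothTrunc
  refine intervalIntegral.tendsto_integral_filter_of_dominated_convergence (fun _ => 1)
    (Eventually.of_forall fun k => (contDiff_smoothStep c k).continuous.aestronglyMeasurable)
    (Eventually.of_forall fun k => Eventually.of_forall fun r _ => abs_smoothStep_le _)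
    intervalIntegrable_const
    (Eventually.of_forall fun r _ => tendsto_smoothStep c r)

end SmoothTruncation

/-! ### Smooth approximation with vanishing boundary values -/

section Approximation

variable {N : ℕ}

theorem continuous_gradient {φ : Eucl N → ℝ} (h : ContDiff ℝ ∞ φ) : Continuous (gradient φ) := by
  unfold gradient
  exact (LinearIsometryEquiv.continuous _).comp (h.continuous_fderiv (by simp))

theorem gradient_comp {T : ℝ → ℝ} (hT : Differentiable ℝ T) {φ : Eucl N → ℝ}
    (h : ContDiff ℝ ∞ φ) (x : Eucl N) :
    gradient (fun y => T (φ y)) x = deriv T (φ x) • gradient φ x := by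
  have hd : DifferentiableAt ℝ φ x := (h.differentiable (by simp)) x
  have h1 := (hT (φ x)).hasDerivAt.comp_hasFDerivAt x hd.hasFDerivAt
  unfold gradient
  rw [show (fun y => T (φ y)) = T ∘ φ from rfl, h1.fderiv, map_smul]

theorem gradient_add_smul {φ ψ : Eucl N → ℝ} (h : ContDiff ℝ ∞ φ) (h' : ContDiff ℝ ∞ ψ) (c : ℝ)
    (x : Eucl N) : gradient (fun y => φ y + c * ψ y) x = gradient φ x + c • gradient ψ x := by
  have h1 : HasFDerivAt φ _ x := ((h.differentiable (by simp)) x).hasFDerivAt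
  have h2 : HasFDerivAt ψ _ x := ((h'.differentiable (by simp)) x).hasFDerivAt
  unfold gradient
  rw [HasFDerivAt.fderiv (f := fun y => φ y + c * ψ y) (h1.add (h2.const_mul c)), map_add, map_smul]

/-- `(f, q)` is approximated in `L²(μ)` by smooth functions and their gradients, which tend to zero
in `L²(ν)`. -/
def SmoothApprox (μ ν : Measure (Eucl N)) (f : Eucl N → ℝ) (q : Eucl N → Eucl N) : Prop :=
  ∃ φ : ℕ → Eucl N → ℝ, (∀ n, ContDiff ℝ ∞ (φ n)) ∧
    Tendsto (fun n => eLpNorm (fun x => φ n x - f x) 2 μ) atTop (𝓝 0) ∧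
    Tendsto (fun n => eLpNorm (fun x => gradient (φ n) x - q x) 2 μ) atTop (𝓝 0) ∧
    Tendsto (fun n => eLpNorm (φ n) 2 ν) atTop (𝓝 0)

variable {μ ν : Measure (Eucl N)} {f : Eucl N → ℝ} {q : Eucl N → Eucl N}

/-- Simultaneous approximation within one tolerance avoids diagonal sequences when approximations
are iterated. -/
theorem smoothApprox_iff : SmoothApprox μ ν f q ↔ ∀ δ : ℝ≥0∞, 0 < δ → ∃ φ : Eucl N → ℝ,
    ContDiff ℝ ∞ φ ∧ eLpNorm (fun x => φ x - f x) 2 μ ≤ δ ∧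
      eLpNorm (fun x => gradient φ x - q x) 2 μ ≤ δ ∧ eLpNorm φ 2 ν ≤ δ := by
  constructor
  · rintro ⟨φ, hφ, h1, h2, h3⟩ δ hδ
    have hev := ((ENNReal.tendsto_nhds_zero.1 h1 δ hδ).and
      ((ENNReal.tendsto_nhds_zero.1 h2 δ hδ).and (ENNReal.tendsto_nhds_zero.1 h3 δ hδ))).exists
    obtain ⟨n, a1, a2, a3⟩ := hev
    exact ⟨φ n, hφ n, a1, a2, a3⟩
  · intro h
    -- For `n = 0` the tolerance is `∞`, which is harmless for the limit.
    have hpos : ∀ n : ℕ, (0 : ℝ≥0∞) < ((n : ℝ≥0∞))⁻¹ := fun n => by simp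
    choose φ hφ h1 h2 h3 using fun n : ℕ => h _ (hpos n)
    have hz : Tendsto (fun n : ℕ => ((n : ℝ≥0∞))⁻¹) atTop (𝓝 0) :=
      ENNReal.tendsto_inv_nat_nhds_zero
    exact ⟨φ, hφ, tendsto_of_tendsto_of_tendsto_of_le_of_le tendsto_const_nhds hz
        (fun _ => zero_le) h1,
      tendsto_of_tendsto_of_tendsto_of_le_of_le tendsto_const_nhds hz (fun _ => zero_le) h2,
      tendsto_of_tendsto_of_tendsto_of_le_of_le tendsto_const_nhds hz (fun _ => zero_le) h3⟩

theorem SmoothApprox.congr {f' : Eucl N → ℝ} {q' : Eucl N → Eucl N} (h : SmoothApprox μ ν f q)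
    (hf : f =ᵐ[μ] f') (hq : q =ᵐ[μ] q') : SmoothApprox μ ν f' q' := by
  obtain ⟨φ, hφ, h1, h2, h3⟩ := h
  refine ⟨φ, hφ, h1.congr fun n => eLpNorm_congr_ae ?_, h2.congr fun n => eLpNorm_congr_ae ?_, h3⟩
  · filter_upwards [hf] with x hx
    rw [hx]
  · filter_upwards [hq] with x hx
    rw [hx]

theorem SmoothApprox.add_smul {f' : Eucl N → ℝ} {q' : Eucl N → Eucl N}
    (h : SmoothApprox μ ν f q) (h' : SmoothApprox μ ν f' q') (c : ℝ)
    (hf : AEStronglyMeasurable f μ) (hf' : AEStronglyMeasurable f' μ)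
    (hq : AEStronglyMeasurable q μ) (hq' : AEStronglyMeasurable q' μ) :
    SmoothApprox μ ν (fun x => f x + c * f' x) (fun x => q x + c • q' x) := by
  obtain ⟨φ, hφ, h1, h2, h3⟩ := h
  obtain ⟨ψ, hψ, k1, k2, k3⟩ := h'
  have hsum : ∀ {a b : ℕ → ℝ≥0∞}, Tendsto a atTop (𝓝 0) → Tendsto b atTop (𝓝 0) →
      Tendsto (fun n => a n + ‖c‖ₑ * b n) atTop (𝓝 0) := fun ha hb => by
    have := ha.add (ENNReal.Tendsto.const_mul hb (Or.inr (enorm_ne_top (x := c))))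
    simpa using this
  refine ⟨fun n x => φ n x + c * ψ n x, fun n => (hφ n).add (contDiff_const.mul (hψ n)), ?_, ?_, ?_⟩
  · refine tendsto_of_tendsto_of_tendsto_of_le_of_le tendsto_const_nhds (hsum h1 k1)
      (fun _ => zero_le) fun n => ?_
    rw [← eLpNorm_const_smul]
    refine le_trans (le_of_eq ?_) (eLpNorm_add_le
      ((hφ n).continuous.aestronglyMeasurable.sub hf)
      (((hψ n).continuous.aestronglyMeasurable.sub hf').const_smul c) (by norm_num))
    congr 1
    ext x
    simp only [Pi.add_apply, Pi.smul_apply, smul_eq_mul]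
    ring
  · refine tendsto_of_tendsto_of_tendsto_of_le_of_le tendsto_const_nhds (hsum h2 k2)
      (fun _ => zero_le) fun n => ?_
    rw [← eLpNorm_const_smul]
    refine le_trans (le_of_eq ?_) (eLpNorm_add_le
      ((continuous_gradient (hφ n)).aestronglyMeasurable.sub hq)
      (((continuous_gradient (hψ n)).aestronglyMeasurable.sub hq').const_smul c) (by norm_num))
    congr 1
    funext x
    simp only [Pi.add_apply, Pi.smul_apply]
    rw [gradient_add_smul (hφ n) (hψ n), smul_sub]
    abel
  · refine tendsto_of_tendsto_of_tendsto_of_le_of_le tendsto_const_nhds (hsum h3 k3)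
      (fun _ => zero_le) fun n => ?_
    rw [← eLpNorm_const_smul]
    exact eLpNorm_add_le (hφ n).continuous.aestronglyMeasurable
      ((hψ n).continuous.aestronglyMeasurable.const_smul c) (by norm_num)

/-- The approximable pairs are closed in `L²`. -/
theorem smoothApprox_of_close (hf : AEStronglyMeasurable f μ) (hq : AEStronglyMeasurable q μ)
    (h : ∀ δ : ℝ≥0∞, 0 < δ → ∃ f' q', SmoothApprox μ ν f' q' ∧ AEStronglyMeasurable f' μ ∧
      AEStronglyMeasurable q' μ ∧ eLpNorm (fun x => f' x - f x) 2 μ ≤ δ ∧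
      eLpNorm (fun x => q' x - q x) 2 μ ≤ δ) : SmoothApprox μ ν f q := by
  rw [smoothApprox_iff]
  intro δ hδ
  have hδ2 : 0 < δ / 2 := ENNReal.half_pos hδ.ne'
  obtain ⟨f', q', ha, hf', hq', h1, h2⟩ := h _ hδ2
  obtain ⟨φ, hφ, k1, k2, k3⟩ := smoothApprox_iff.1 ha _ hδ2
  refine ⟨φ, hφ, ?_, ?_, k3.trans ENNReal.half_le_self⟩
  · rw [← ENNReal.add_halves δ]
    refine le_trans (le_of_eq ?_) ((eLpNorm_add_le
      (hφ.continuous.aestronglyMeasurable.sub hf') (hf'.sub hf) (by norm_num)).trans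
      (add_le_add k1 h1))
    congr 1
    funext x
    simp
  · rw [← ENNReal.add_halves δ]
    refine le_trans (le_of_eq ?_) ((eLpNorm_add_le
      ((continuous_gradient hφ).aestronglyMeasurable.sub hq') (hq'.sub hq) (by norm_num)).trans
      (add_le_add k2 h2))
    congr 1
    funext x
    simp

/-- Chain rule: smooth contractions act on approximable pairs. -/
theorem SmoothApprox.comp {T : ℝ → ℝ} (hT : ContDiff ℝ ∞ T) (hT0 : T 0 = 0)
    (hT' : ∀ s, |deriv T s| ≤ 1) (h : SmoothApprox μ ν f q) (hf : AEStronglyMeasurable f μ)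
    (hq : MemLp q 2 μ) :
    SmoothApprox μ ν (fun x => T (f x)) (fun x => deriv T (f x) • q x) := by
  obtain ⟨φ, hφ, h1, h2, h3⟩ := h
  have hTd : Differentiable ℝ T := hT.differentiable (by simp)
  have hTc : Continuous (deriv T) := hT.continuous_deriv (by simp)
  have hlip : ∀ a b, |T a - T b| ≤ |a - b| := fun a b => by
    have := Convex.norm_image_sub_le_of_norm_deriv_le (f := T) (s := univ) (C := 1)
      (fun x _ => hTd x) (fun x _ => hT' x) convex_univ (mem_univ b) (mem_univ a)
    simpa using this
  refine ⟨fun n x => T (φ n x), fun n => hT.comp (hφ n), ?_, ?_, ?_⟩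
  · refine tendsto_of_tendsto_of_tendsto_of_le_of_le tendsto_const_nhds h1
      (fun _ => zero_le) fun n => eLpNorm_mono fun x => hlip _ _
  -- The gradient error splits as `T'(φₙ)(∇φₙ - q) + (T'(φₙ) - T'(f)) q`; the second term is a
  -- superposition operator acting on the fixed field `q`.
  · have k1 := tendsto_eLpNorm_comp_sub_smul (μ := μ) hTc hT'
      (fun n => (hφ n).continuous.aestronglyMeasurable) hf h1 hq
    have k2 := h2.add k1
    rw [add_zero] at k2
    refine tendsto_of_tendsto_of_tendsto_of_le_of_le tendsto_const_nhds k2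
      (fun _ => zero_le) fun n => ?_
    have m1 : AEStronglyMeasurable (fun x => deriv T (φ n x) • (gradient (φ n) x - q x)) μ :=
      (hTc.comp (hφ n).continuous).aestronglyMeasurable.smul
        ((continuous_gradient (hφ n)).aestronglyMeasurable.sub hq.1)
    have m2 : AEStronglyMeasurable (fun x => (deriv T (φ n x) - deriv T (f x)) • q x) μ :=
      ((hTc.comp (hφ n).continuous).aestronglyMeasurable.sub
        (hTc.comp_aestronglyMeasurable hf)).smul hq.1
    refine le_trans (le_of_eq ?_) ((eLpNorm_add_le m1 m2 (by norm_num)).trans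
      (add_le_add_left ?_ _))
    · congr 1
      funext x
      simp only [Pi.add_apply]
      rw [gradient_comp hTd (hφ n), smul_sub, sub_smul]
      abel
    · refine eLpNorm_mono fun x => ?_
      rw [norm_smul]
      exact mul_le_of_le_one_left (norm_nonneg _) (hT' _)
  -- A contraction fixing 0 does not enlarge the boundary values.
  · refine tendsto_of_tendsto_of_tendsto_of_le_of_le tendsto_const_nhds h3
      (fun _ => zero_le) fun n => eLpNorm_mono fun x => ?_
    have := hlip (φ n x) 0
    rwa [hT0, sub_zero, sub_zero] at this

/-- Truncation of approximable pairs from below. -/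
theorem SmoothApprox.trunc {c : ℝ} (hc : 0 ≤ c) (h : SmoothApprox μ ν f q) (hf : MemLp f 2 μ)
    (hq : MemLp q 2 μ) :
    SmoothApprox μ ν (fun x => max (f x - c) 0) (fun x => (if c < f x then (1 : ℝ) else 0) • q x) := by
  have hT' : ∀ k s, |deriv (smoothTrunc c k) s| ≤ 1 := fun k s => by
    rw [deriv_smoothTrunc]; exact abs_smoothStep_le _
  have happ := fun k => h.comp (contDiff_smoothTrunc c k) (smoothTrunc_zero c k) (hT' k) hf.1 hq
  have hm1 : ∀ k, AEStronglyMeasurable (fun x => smoothTrunc c k (f x)) μ := fun k =>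
    (contDiff_smoothTrunc c k).continuous.comp_aestronglyMeasurable hf.1
  have hm2 : ∀ k, AEStronglyMeasurable (fun x => deriv (smoothTrunc c k) (f x) • q x) μ := fun k =>
    (((contDiff_smoothTrunc c k).continuous_deriv (by simp)).comp_aestronglyMeasurable hf.1).smul
      hq.1
  have hl1 : ∀ x, Tendsto (fun k => smoothTrunc c k (f x)) atTop (𝓝 (max (f x - c) 0)) := fun x =>
    tendsto_smoothTrunc hc _
  have hl2 : ∀ x, Tendsto (fun k => deriv (smoothTrunc c k) (f x) • q x) atTop
      (𝓝 ((if c < f x then (1 : ℝ) else 0) • q x)) := fun x => by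
    simp only [deriv_smoothTrunc]
    exact (tendsto_smoothStep c (f x)).smul_const _
  have hM1 : AEStronglyMeasurable (fun x => max (f x - c) 0) μ :=
    aestronglyMeasurable_of_tendsto_ae atTop hm1 (Eventually.of_forall hl1)
  have hM2 : AEStronglyMeasurable (fun x => (if c < f x then (1 : ℝ) else 0) • q x) μ :=
    aestronglyMeasurable_of_tendsto_ae atTop hm2 (Eventually.of_forall hl2)
  have hb1 : ∀ x, |max (f x - c) 0| ≤ |f x| := fun x => by
    rw [abs_of_nonneg (le_max_right _ _)]
    exact max_le (by linarith [le_abs_self (f x)]) (abs_nonneg _)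
  have hb2 : ∀ x, ‖(if c < f x then (1 : ℝ) else 0) • q x‖ ≤ ‖q x‖ := fun x => by
    split_ifs <;> simp
  have t1 := tendsto_eLpNorm_two_zero_of_dominated (μ := μ)
    (f := fun k x => smoothTrunc c k (f x) - max (f x - c) 0) (b := fun x => 2 * ‖f x‖)
    (fun k => (hm1 k).sub hM1) (hf.norm.const_mul 2)
    (fun k => Eventually.of_forall fun x => by
      refine (norm_sub_le _ _).trans ?_
      rw [Real.norm_eq_abs, Real.norm_eq_abs, Real.norm_eq_abs]
      linarith [hb1 x, abs_smoothTrunc_le c k (f x)])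
    (Eventually.of_forall fun x => by simpa using (hl1 x).sub_const (max (f x - c) 0))
  have t2 := tendsto_eLpNorm_two_zero_of_dominated (μ := μ)
    (f := fun k x => deriv (smoothTrunc c k) (f x) • q x - (if c < f x then (1 : ℝ) else 0) • q x)
    (b := fun x => 2 * ‖q x‖)
    (fun k => (hm2 k).sub hM2) (hq.norm.const_mul 2)
    (fun k => Eventually.of_forall fun x => by
      refine (norm_sub_le _ _).trans ?_
      have : ‖deriv (smoothTrunc c k) (f x) • q x‖ ≤ ‖q x‖ := by
        rw [norm_smul]
        exact mul_le_of_le_one_left (norm_nonneg _) (hT' _ _)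
      linarith [hb2 x])
    (Eventually.of_forall fun x => by
      have := (hl2 x).sub_const ((if c < f x then (1 : ℝ) else 0) • q x)
      rwa [sub_self] at this)
  refine smoothApprox_of_close hM1 hM2 fun δ hδ => ?_
  obtain ⟨k, a1, a2⟩ := ((ENNReal.tendsto_nhds_zero.1 t1 δ hδ).and
    (ENNReal.tendsto_nhds_zero.1 t2 δ hδ)).exists
  exact ⟨_, _, happ k, hm1 k, hm2 k, a1, a2⟩

end Approximation

/-! ### The space H¹ and its subspace of zero trace -/

section H1

variable {N : ℕ} {Ω : Set (Eucl N)}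

/-- Separability of L² is stated for finite exponents. -/
instance : Fact ((2 : ℝ≥0∞) ≠ ⊤) := ⟨by simp⟩

instance : SecondCountableTopology (L2Pair Ω) := by
  have h1 : SecondCountableTopology (Lp ℝ 2 (volume.restrict Ω)) := inferInstance
  have h2 : SecondCountableTopology (Lp (Eucl N) 2 (volume.restrict Ω)) := inferInstance
  have h3 : SecondCountableTopology
      (Lp ℝ 2 (volume.restrict Ω) × Lp (Eucl N) 2 (volume.restrict Ω)) :=
    @TopologicalSpace.instSecondCountableTopologyProd _ _ _ _ h1 h2
  exact (WithLp.homeomorphProd 2 (Lp ℝ 2 (volume.restrict Ω))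
    (Lp (Eucl N) 2 (volume.restrict Ω))).secondCountableTopology

instance : SecondCountableTopology (H1 Ω) :=
  TopologicalSpace.Subtype.secondCountableTopology (H1 Ω : Set (L2Pair Ω))

/-- The embedding `H¹(Ω) → L²(Ω)`. -/
noncomputable def fnL (Ω : Set (Eucl N)) : H1 Ω →L[ℝ] Lp ℝ 2 (volume.restrict Ω) :=
  (WithLp.fstL 2 ℝ (Lp ℝ 2 (volume.restrict Ω)) (Lp (Eucl N) 2 (volume.restrict Ω))).comp
    (H1 Ω).subtypeL

/-- The gradient as a continuous linear map. -/
noncomputable def gradL (Ω : Set (Eucl N)) : H1 Ω →L[ℝ] Lp (Eucl N) 2 (volume.restrict Ω) :=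
  (WithLp.sndL 2 ℝ (Lp ℝ 2 (volume.restrict Ω)) (Lp (Eucl N) 2 (volume.restrict Ω))).comp
    (H1 Ω).subtypeL

theorem fnL_apply (u : H1 Ω) : fnL Ω u = fn u := rfl

theorem gradL_apply (u : H1 Ω) : gradL Ω u = grad u := rfl

theorem norm_sq_H1 (u : H1 Ω) : ‖u‖ ^ 2 = ‖fnL Ω u‖ ^ 2 + ‖gradL Ω u‖ ^ 2 :=
  WithLp.prod_norm_sq_eq_of_L2 (u : L2Pair Ω)

theorem isClosed_H1 : IsClosed (H1 Ω : Set (L2Pair Ω)) :=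
  (completeSpace_coe_iff_isComplete.1 (inferInstance : CompleteSpace (H1 Ω))).isClosed

theorem isFiniteMeasure_restrict (hΩb : Bornology.IsBounded Ω) :
    IsFiniteMeasure (volume.restrict Ω) :=
  ⟨by rw [Measure.restrict_apply_univ]; exact hΩb.measure_lt_top⟩

/-- The gradient is determined by the function. -/
theorem fnL_injective (hΩ : IsOpen Ω) (hΩb : Bornology.IsBounded Ω) :
    Function.Injective (fnL Ω) := by
  have := isFiniteMeasure_restrict hΩb
  rw [injective_iff_map_eq_zero]
  intro u hu
  have hfn : fn u = 0 := hu
  have hint : Integrable (grad u) (volume.restrict Ω) := (Lp.memLp (grad u)).integrable (by norm_num)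
  have hgrad : ∀ᵐ x, x ∈ Ω → grad u x = 0 := by
    -- Fundamental lemma of the calculus of variations: a weak gradient of 0 has zero integral
    -- against every test function.
    refine hΩ.ae_eq_zero_of_integral_contDiff_smul_eq_zero
      (IntegrableOn.locallyIntegrableOn hint) fun ψ hψ hψc hψs => ?_
    rw [← setIntegral_eq_integral_of_forall_compl_eq_zero (s := Ω) fun x hx => by
      rw [image_eq_zero_of_notMem_tsupport fun h => hx (hψs h), zero_smul]]
    have hi2 : Integrable (fun x => ψ x • grad u x) (volume.restrict Ω) := by
      obtain ⟨C, hC⟩ := hψ.continuous.bounded_above_of_compact_support hψc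
      exact hint.bdd_smul C hψ.continuous.aestronglyMeasurable (Eventually.of_forall hC)
    refine ext_inner_left ℝ fun w => ?_
    rw [← integral_inner hi2, inner_zero_right]
    have hw := u.2 ψ hψ hψc hψs w
    have h0 : ∫ x in Ω, (u : L2Pair Ω).fst x * fderiv ℝ ψ x w = 0 := by
      refine integral_eq_zero_of_ae ?_
      have h1 : (fn u : Eucl N → ℝ) =ᵐ[volume.restrict Ω] 0 := by
        rw [hfn]; exact Lp.coeFn_zero _ _ _
      filter_upwards [h1] with x hx
      have : (u : L2Pair Ω).fst x = 0 := hx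
      simp [this]
    rw [h0] at hw
    have h2 := neg_eq_zero.1 hw.symm
    rw [← h2]
    refine integral_congr_ae (Eventually.of_forall fun x => ?_)
    simp only
    rw [real_inner_smul_right, real_inner_comm]
    rfl
  have hg0 : grad u = 0 := by
    refine Lp.ext ?_
    filter_upwards [(ae_restrict_iff' hΩ.measurableSet).2 hgrad,
      Lp.coeFn_zero (Eucl N) 2 (volume.restrict Ω)] with x h1 h2
    rw [h1, h2]; rfl
  have hn := norm_sq_H1 u
  rw [hu, gradL_apply, hg0] at hn
  simpa using hn

theorem memLp_of_continuous (hΩ : IsOpen Ω) (hΩb : Bornology.IsBounded Ω) {F : Type*}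
    [NormedAddCommGroup F] [SecondCountableTopology F] {φ : Eucl N → F} (hφ : Continuous φ) :
    MemLp φ 2 (volume.restrict Ω) := by
  have := isFiniteMeasure_restrict hΩb
  obtain ⟨C, hC⟩ := hΩb.isCompact_closure.exists_bound_of_continuousOn hφ.continuousOn
  refine MemLp.of_bound hφ.aestronglyMeasurable C ?_
  filter_upwards [ae_restrict_mem hΩ.measurableSet] with x hx
  exact hC x (subset_closure hx)

/-- Integration by parts for smooth functions. -/
theorem isWeakGradient_gradient {φ : Eucl N → ℝ} (hφ : ContDiff ℝ ∞ φ) :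
    IsWeakGradient Ω φ (gradient φ) := by
  intro ψ hψ hψc hψs w
  have hz : ∀ x, x ∉ Ω → ψ x = 0 := fun x hx =>
    image_eq_zero_of_notMem_tsupport fun h => hx (hψs h)
  have hz' : ∀ x, x ∉ Ω → fderiv ℝ ψ x w = 0 := fun x hx => by
    rw [image_eq_zero_of_notMem_tsupport (f := fderiv ℝ ψ)
      fun h => hx (hψs (tsupport_fderiv_subset ℝ h))]
    rfl
  rw [setIntegral_eq_integral_of_forall_compl_eq_zero fun x hx => by rw [hz' x hx, mul_zero],
    setIntegral_eq_integral_of_forall_compl_eq_zero fun x hx => by rw [hz x hx, zero_mul]]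
  have c1 : Continuous fun x => fderiv ℝ ψ x w :=
    (hψ.continuous_fderiv (by simp)).clm_apply continuous_const
  have c2 : Continuous fun x => fderiv ℝ φ x w :=
    (hφ.continuous_fderiv (by simp)).clm_apply continuous_const
  have s1 : HasCompactSupport fun x => fderiv ℝ ψ x w :=
    (hψc.fderiv (𝕜 := ℝ)).comp_left (g := fun L : Eucl N →L[ℝ] ℝ => L w) (by simp)
  rw [integral_mul_fderiv_eq_neg_fderiv_mul_of_integrable]
  · congr 1
    refine integral_congr_ae (Eventually.of_forall fun x => ?_)
    simp only
    rw [inner_gradient_left, mul_comm]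
  · exact (c2.mul hψ.continuous).integrable_of_hasCompactSupport hψc.mul_left
  · exact (hφ.continuous.mul c1).integrable_of_hasCompactSupport s1.mul_left
  · exact (hφ.continuous.mul hψ.continuous).integrable_of_hasCompactSupport hψc.mul_left
  · exact fun x _ => (hφ.differentiable (by simp)) x
  · exact fun x _ => (hψ.differentiable (by simp)) x

theorem IsWeakGradient.congr {u u' : Eucl N → ℝ} {p p' : Eucl N → Eucl N}
    (h : IsWeakGradient Ω u p) (hu : u =ᵐ[volume.restrict Ω] u')
    (hp : p =ᵐ[volume.restrict Ω] p') : IsWeakGradient Ω u' p' := by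
  intro φ h1 h2 h3 w
  have e1 : ∫ x in Ω, u' x * fderiv ℝ φ x w = ∫ x in Ω, u x * fderiv ℝ φ x w :=
    integral_congr_ae (by filter_upwards [hu] with x hx; rw [hx])
  have e2 : ∫ x in Ω, φ x * inner ℝ (p' x) w = ∫ x in Ω, φ x * inner ℝ (p x) w :=
    integral_congr_ae (by filter_upwards [hp] with x hx; rw [hx])
  rw [e1, e2]
  exact h φ h1 h2 h3 w

/-- Approximable pairs define elements of `H¹(Ω)`. -/
theorem SmoothApprox.exists_H1 (hΩ : IsOpen Ω) (hΩb : Bornology.IsBounded Ω)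
    {ν : Measure (Eucl N)} {f : Eucl N → ℝ} {q : Eucl N → Eucl N}
    (h : SmoothApprox (volume.restrict Ω) ν f q) (hf : MemLp f 2 (volume.restrict Ω))
    (hq : MemLp q 2 (volume.restrict Ω)) :
    ∃ u : H1 Ω, fn u =ᵐ[volume.restrict Ω] f ∧ grad u =ᵐ[volume.restrict Ω] q := by
  obtain ⟨φ, hφ, h1, h2, -⟩ := h
  have m1 : ∀ n, MemLp (φ n) 2 (volume.restrict Ω) := fun n =>
    memLp_of_continuous hΩ hΩb (hφ n).continuous
  have m2 : ∀ n, MemLp (gradient (φ n)) 2 (volume.restrict Ω) := fun n =>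
    memLp_of_continuous hΩ hΩb (continuous_gradient (hφ n))
  let U : ℕ → L2Pair Ω := fun n => WithLp.toLp 2 ((m1 n).toLp _, (m2 n).toLp _)
  let U₀ : L2Pair Ω := WithLp.toLp 2 (hf.toLp _, hq.toLp _)
  have hU : ∀ n, U n ∈ H1 Ω := fun n =>
    (isWeakGradient_gradient (hφ n)).congr (m1 n).coeFn_toLp.symm (m2 n).coeFn_toLp.symm
  have l1 : Tendsto (fun n => (m1 n).toLp (φ n)) atTop (𝓝 (hf.toLp f)) :=
    (Lp.tendsto_Lp_iff_tendsto_eLpNorm'' _ m1 _ hf).2 h1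
  have l2 : Tendsto (fun n => (m2 n).toLp (gradient (φ n))) atTop (𝓝 (hq.toLp q)) :=
    (Lp.tendsto_Lp_iff_tendsto_eLpNorm'' _ m2 _ hq).2 h2
  have hlim : Tendsto U atTop (𝓝 U₀) :=
    ((WithLp.prod_continuous_toLp 2 _ _).tendsto _).comp (l1.prodMk_nhds l2)
  have hU₀ : U₀ ∈ H1 Ω := isClosed_H1.mem_of_tendsto hlim (Eventually.of_forall hU)
  exact ⟨⟨U₀, hU₀⟩, hf.coeFn_toLp, hq.coeFn_toLp⟩

theorem coeFn_fn_add_smul (u v : H1 Ω) (c : ℝ) :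
    fn (u + c • v) =ᵐ[volume.restrict Ω] fun x => fn u x + c * fn v x := by
  have e : fn (u + c • v) = fn u + c • fn v := by
    rw [← fnL_apply, map_add, map_smul]; rfl
  rw [e]
  filter_upwards [Lp.coeFn_add (fn u) (c • fn v), Lp.coeFn_smul c (fn v)] with x h1 h2
  rw [h1, Pi.add_apply, h2, Pi.smul_apply, smul_eq_mul]

theorem coeFn_grad_add_smul (u v : H1 Ω) (c : ℝ) :
    grad (u + c • v) =ᵐ[volume.restrict Ω] fun x => grad u x + c • grad v x := by
  have e : grad (u + c • v) = grad u + c • grad v := by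
    rw [← gradL_apply, map_add, map_smul]; rfl
  rw [e]
  filter_upwards [Lp.coeFn_add (grad u) (c • grad v), Lp.coeFn_smul c (grad v)] with x h1 h2
  rw [h1, Pi.add_apply, h2, Pi.smul_apply]

/-- The surface measure on `D`. -/
noncomputable abbrev surf (D : Set (Eucl N)) : Measure (Eucl N) :=
  (Measure.hausdorffMeasure ((N : ℝ) - 1)).restrict D

theorem hasTraceOn_zero_iff {D : Set (Eucl N)} {u : H1 Ω} :
    HasTraceOn D u (fun _ => 0) ↔ SmoothApprox (volume.restrict Ω) (surf D) (fn u) (grad u) := by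
  simp only [HasTraceOn, SmoothApprox, sub_zero]
  exact ⟨fun h => h.2, fun h => ⟨aestronglyMeasurable_const, h⟩⟩

/-- The elements of `H¹(Ω)` with zero trace on `D`. -/
def traceZero (Ω D : Set (Eucl N)) : Submodule ℝ (H1 Ω) where
  carrier := {u | HasTraceOn D u (fun _ => 0)}
  zero_mem' := by
    rw [mem_ofPred_eq, hasTraceOn_zero_iff]
    refine SmoothApprox.congr (f := fun _ => 0) (q := fun _ => 0)
      ⟨fun _ _ => 0, fun _ => contDiff_const, ?_, ?_, ?_⟩
      (Lp.coeFn_zero ℝ 2 (volume.restrict Ω)).symm (Lp.coeFn_zero (Eucl N) 2 (volume.restrict Ω)).symm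
    · simp
    · simp [gradient]
    · simp
  add_mem' := by
    intro u v hu hv
    rw [mem_ofPred_eq, hasTraceOn_zero_iff] at *
    have h := hu.add_smul hv 1 (Lp.aestronglyMeasurable _) (Lp.aestronglyMeasurable _)
      (Lp.aestronglyMeasurable _) (Lp.aestronglyMeasurable _)
    have e : u + v = u + (1 : ℝ) • v := by rw [one_smul]
    rw [e]
    exact h.congr (coeFn_fn_add_smul u v 1).symm (coeFn_grad_add_smul u v 1).symm
  smul_mem' := by
    intro c u hu
    rw [mem_ofPred_eq, hasTraceOn_zero_iff] at *
    have h := hu.add_smul hu (c - 1) (Lp.aestronglyMeasurable _) (Lp.aestronglyMeasurable _)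
      (Lp.aestronglyMeasurable _) (Lp.aestronglyMeasurable _)
    -- This form lets the approximation of sums cover scalar multiples as well.
    have e : c • u = u + (c - 1) • u := by rw [sub_smul, one_smul]; abel
    rw [e]
    exact h.congr (coeFn_fn_add_smul u u (c - 1)).symm (coeFn_grad_add_smul u u (c - 1)).symm

theorem mem_traceZero {D : Set (Eucl N)} {u : H1 Ω} :
    u ∈ traceZero Ω D ↔ HasTraceOn D u (fun _ => 0) := Iff.rfl

/-- Approximability within every tolerance is inherited by limits of functions and gradients, so no
bounded trace operator is needed to obtain a Hilbert space. -/
theorem isClosed_traceZero (D : Set (Eucl N)) : IsClosed (traceZero Ω D : Set (H1 Ω)) := by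
  rw [← isSeqClosed_iff_isClosed]
  intro x u hx hlim
  change HasTraceOn D u (fun _ => 0)
  rw [hasTraceOn_zero_iff]
  have l1 : Tendsto (fun n => fn (x n)) atTop (𝓝 (fn u)) := ((fnL Ω).continuous.tendsto u).comp hlim
  have l2 : Tendsto (fun n => grad (x n)) atTop (𝓝 (grad u)) :=
    ((gradL Ω).continuous.tendsto u).comp hlim
  rw [Lp.tendsto_Lp_iff_tendsto_eLpNorm'] at l1 l2
  refine smoothApprox_of_close (Lp.aestronglyMeasurable _) (Lp.aestronglyMeasurable _)
    fun δ hδ => ?_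
  obtain ⟨n, a1, a2⟩ := ((ENNReal.tendsto_nhds_zero.1 l1 δ hδ).and
    (ENNReal.tendsto_nhds_zero.1 l2 δ hδ)).exists
  exact ⟨_, _, hasTraceOn_zero_iff.1 (hx n), Lp.aestronglyMeasurable _, Lp.aestronglyMeasurable _,
    a1, a2⟩

instance (D : Set (Eucl N)) : CompleteSpace (traceZero Ω D) :=
  (isClosed_traceZero D).completeSpace_coe

instance (D : Set (Eucl N)) : SecondCountableTopology (traceZero Ω D) :=
  TopologicalSpace.Subtype.secondCountableTopology (traceZero Ω D : Set (H1 Ω))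

/-- Truncation from below in the space of functions with zero trace. -/
theorem exists_trunc (hΩ : IsOpen Ω) (hΩb : Bornology.IsBounded Ω) {D : Set (Eucl N)} {u : H1 Ω}
    (hu : u ∈ traceZero Ω D) {c : ℝ} (hc : 0 ≤ c) :
    ∃ z ∈ traceZero Ω D, fn z =ᵐ[volume.restrict Ω] (fun x => max (fn u x - c) 0) ∧
      grad z =ᵐ[volume.restrict Ω] fun x => (if c < fn u x then (1 : ℝ) else 0) • grad u x := by
  have hs := (hasTraceOn_zero_iff.1 hu).trunc hc (Lp.memLp _) (Lp.memLp _)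
  have m1 : MemLp (fun x => max (fn u x - c) 0) 2 (volume.restrict Ω) := by
    refine (Lp.memLp (fn u)).mono
      ((((Lp.aestronglyMeasurable (fn u)).sub aestronglyMeasurable_const).sup
        aestronglyMeasurable_const)) (Eventually.of_forall fun x => ?_)
    rw [Real.norm_eq_abs, Real.norm_eq_abs, abs_of_nonneg (le_max_right _ _)]
    exact max_le (by linarith [le_abs_self (fn u x)]) (abs_nonneg _)
  have m2 : MemLp (fun x => (if c < fn u x then (1 : ℝ) else 0) • grad u x) 2
      (volume.restrict Ω) := by
    have hmeas : Measurable fun s : ℝ => if c < s then (1 : ℝ) else 0 :=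
      Measurable.ite measurableSet_Ioi measurable_const measurable_const
    refine (Lp.memLp (grad u)).mono
      ((hmeas.comp_aemeasurable (Lp.aestronglyMeasurable (fn u)).aemeasurable).aestronglyMeasurable.smul
        (Lp.aestronglyMeasurable (grad u))) (Eventually.of_forall fun x => ?_)
    split_ifs <;> simp
  obtain ⟨z, hz1, hz2⟩ := hs.exists_H1 hΩ hΩb m1 m2
  exact ⟨z, hasTraceOn_zero_iff.2 (hs.congr hz1.symm hz2.symm), hz1, hz2⟩

end H1

/-! ### Cone property and translation estimates -/

section Rellich

variable {N : ℕ} {Ω : Set (Eucl N)}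

/-- Local uniform cone property of Lipschitz domains. -/
theorem exists_cone (hΩ : IsOpen Ω) (hL : HasLipschitzBoundary Ω) {x : Eucl N}
    (hx : x ∈ closure Ω) :
    ∃ (r : ℝ) (z₀ : Eucl N) (κ h₀ : ℝ), 0 < r ∧ 0 < κ ∧ 0 < h₀ ∧
      ∀ y ∈ Ω, y ∈ Metric.ball x r → ∀ z ∈ Metric.ball z₀ κ, ∀ s ∈ Icc 0 h₀, y + s • z ∈ Ω := by
  by_cases hxΩ : x ∈ Ω
  · obtain ⟨r, hr, hsub⟩ := Metric.isOpen_iff.1 hΩ x hxΩ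
    refine ⟨r / 2, 0, r / 2, 1, by positivity, by positivity, one_pos,
      fun y _ hy z hz s hs => hsub ?_⟩
    rw [mem_ball_zero_iff] at hz
    rw [Metric.mem_ball, dist_eq_norm] at hy ⊢
    have e : y + s • z - x = (y - x) + s • z := by abel
    rw [e]
    have h2 : ‖s • z‖ ≤ ‖z‖ := by
      rw [norm_smul, Real.norm_of_nonneg hs.1]
      exact mul_le_of_le_one_left (norm_nonneg _) hs.2
    linarith [norm_add_le (y - x) (s • z)]
  · have hfr : x ∈ frontier Ω := ⟨hx, fun h => hxΩ (interior_subset h)⟩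
    obtain ⟨e, f, K, r, he, hf, hr, hΩr⟩ := hL x hfr
    -- The choice makes `Kκ = 1 - κ`. A direction within `κ` of `e` rises at rate at least `1 - κ`,
    -- while the graph below rises at rate at most `Kκ`, so a point above the graph stays above it.
    set κ : ℝ := 1 / (1 + K) with hκ
    have hK : (0 : ℝ) ≤ K := K.2
    have hκpos : 0 < κ := by positivity
    have hκ1 : κ ≤ 1 := by
      rw [hκ, div_le_one (by positivity)]; linarith
    have hKκ : K * κ ≤ 1 - κ := by
      rw [hκ]
      field_simp
      linarith
    refine ⟨r / 2, e, κ, r / 4, by positivity, hκpos, by positivity, fun y hyΩ hy z hz s hs => ?_⟩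
    have hy2 : y ∈ Metric.ball x r := Metric.ball_subset_ball (by linarith) hy
    rw [Metric.mem_ball, dist_eq_norm] at hz hy
    have hzn : ‖z‖ ≤ 2 := by
      have : z = (z - e) + e := by abel
      rw [this]
      linarith [norm_add_le (z - e) e]
    have hball : y + s • z ∈ Metric.ball x r := by
      rw [Metric.mem_ball, dist_eq_norm]
      have e1 : y + s • z - x = (y - x) + s • z := by abel
      rw [e1]
      have h2 : ‖s • z‖ ≤ r / 4 * 2 := by
        rw [norm_smul, Real.norm_of_nonneg hs.1]
        exact mul_le_mul hs.2 hzn (norm_nonneg _) (by positivity)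
      linarith [norm_add_le (y - x) (s • z)]
    rw [hΩr _ hball]
    have h0 := (hΩr _ hy2).1 hyΩ
    set P := (ℝ ∙ e)ᗮ.orthogonalProjectionOnto with hP
    have hPe : P e = 0 := by
      rw [hP]
      apply Submodule.orthogonalProjectionOnto_eq_zero_iff.2
      rw [Submodule.orthogonal_orthogonal]
      exact Submodule.mem_span_singleton_self e
    have hPz : ‖P z‖ ≤ κ := by
      have : P z = P (z - e) := by rw [map_sub, hPe, sub_zero]
      rw [this]
      exact (Submodule.norm_orthogonalProjectionOnto_apply_le _ _).trans hz.le
    have hfd : f (P (y + s • z)) ≤ f (P y) + K * (s * κ) := by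
      have h1 := hf.dist_le_mul (P (y + s • z)) (P y)
      rw [Real.dist_eq, dist_eq_norm, map_add, map_smul, add_sub_cancel_left, norm_smul,
        Real.norm_of_nonneg hs.1] at h1
      have h2 : (K : ℝ) * (s * ‖P z‖) ≤ K * (s * κ) := by
        gcongr
        exact hs.1
      rw [map_add, map_smul]
      linarith [le_abs_self (f (P y + s • P z) - f (P y))]
    have hin : 1 - κ ≤ inner ℝ e z := by
      have e1 : inner ℝ e z = inner ℝ e e + inner ℝ e (z - e) := by
        rw [← inner_add_right]; congr 1; abel
      rw [e1, real_inner_self_eq_norm_sq, he]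
      have h2 := abs_real_inner_le_norm e (z - e)
      rw [he, one_mul] at h2
      linarith [neg_abs_le (inner ℝ e (z - e))]
    rw [inner_add_right, real_inner_smul_right]
    have h3 : s * (K * κ) ≤ s * inner ℝ e z :=
      mul_le_mul_of_nonneg_left (hKκ.trans hin) hs.1
    calc f (P (y + s • z)) ≤ f (P y) + K * (s * κ) := hfd
      _ = f (P y) + s * (K * κ) := by ring
      _ < inner ℝ e y + s * inner ℝ e z := by linarith

/-- Cauchy–Schwarz against the constant function 1. -/
theorem sq_lintegral_le {α : Type*} [MeasurableSpace α] {μ : Measure α} {F : Type*}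
    [NormedAddCommGroup F] {f : α → F} (hf : AEStronglyMeasurable f μ) :
    (∫⁻ x, ‖f x‖ₑ ∂μ) ^ 2 ≤ μ univ * ∫⁻ x, ‖f x‖ₑ ^ 2 ∂μ := by
  have h := eLpNorm_le_eLpNorm_mul_rpow_measure_univ (μ := μ) (p := 1) (q := 2) (f := f)
    (by norm_num) hf
  rw [eLpNorm_one_eq_lintegral_enorm] at h
  have h2 := pow_le_pow_left₀ (zero_le) h 2
  refine h2.trans (le_of_eq ?_)
  rw [mul_pow, eLpNorm_two_sq_eq_lintegral, mul_comm, ← ENNReal.rpow_natCast, ← ENNReal.rpow_mul]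
  norm_num

theorem lintegral_translate_le {W : Set (Eucl N)} (hW : MeasurableSet W) (hΩ : MeasurableSet Ω)
    {a : Eucl N} (ha : ∀ y ∈ W, y + a ∈ Ω) (F : Eucl N → ℝ≥0∞) :
    ∫⁻ y in W, F (y + a) ≤ ∫⁻ x in Ω, F x := by
  rw [← lintegral_indicator hW, ← lintegral_indicator hΩ,
    ← lintegral_add_right_eq_self (μ := volume) (Ω.indicator F) a]
  refine lintegral_mono fun y => ?_
  by_cases hy : y ∈ W
  · rw [indicator_of_mem hy, indicator_of_mem (ha y hy)]
  · rw [indicator_of_notMem hy]; exact zero_le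

/-- Translation estimate by the gradient. -/
theorem lintegral_translate_sub_le {W : Set (Eucl N)} (hW : MeasurableSet W) (hΩ : MeasurableSet Ω)
    {φ : Eucl N → ℝ} (hφ : ContDiff ℝ ∞ φ) {z : Eucl N} {t : ℝ} (ht : 0 ≤ t)
    (hz : ∀ y ∈ W, ∀ s ∈ Icc 0 t, y + s • z ∈ Ω) :
    ∫⁻ y in W, ‖φ (y + t • z) - φ y‖ₑ ^ 2
      ≤ ENNReal.ofReal t ^ 2 * (‖z‖ₑ ^ 2 * ∫⁻ x in Ω, ‖gradient φ x‖ₑ ^ 2) := by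
  have hgc := continuous_gradient hφ
  -- Fundamental theorem of calculus along the segment, then Cauchy–Schwarz in `s`, whence one
  -- factor `t`. Integrating over `W` and exchanging integrals gives the second factor.
  have hpt : ∀ y, ‖φ (y + t • z) - φ y‖ₑ ^ 2
      ≤ ENNReal.ofReal t * ∫⁻ s in Ioc 0 t, ‖z‖ₑ ^ 2 * ‖gradient φ (y + s • z)‖ₑ ^ 2 := by
    intro y
    have hd : ∀ s, HasDerivAt (fun s : ℝ => φ (y + s • z)) (fderiv ℝ φ (y + s • z) z) s := by
      intro s
      have h1 : HasDerivAt (fun s : ℝ => y + s • z) z s := by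
        simpa using ((hasDerivAt_id s).smul_const z).const_add y
      exact ((hφ.differentiable (by simp)) _).hasFDerivAt.comp_hasDerivAt s h1
    have hc : Continuous fun s : ℝ => fderiv ℝ φ (y + s • z) z :=
      ((hφ.continuous_fderiv (by simp)).comp (by fun_prop)).clm_apply continuous_const
    have hftc := intervalIntegral.integral_eq_sub_of_hasDerivAt (a := 0) (b := t)
      (fun s _ => hd s) (hc.intervalIntegrable _ _)
    rw [zero_smul, add_zero] at hftc
    rw [← hftc, intervalIntegral.integral_of_le ht]
    have h2 := enorm_integral_le_lintegral_enorm (μ := volume.restrict (Ioc 0 t))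
      (fun s : ℝ => fderiv ℝ φ (y + s • z) z)
    have h3 := sq_lintegral_le (μ := volume.restrict (Ioc 0 t))
      (f := fun s : ℝ => fderiv ℝ φ (y + s • z) z) hc.aestronglyMeasurable
    rw [Measure.restrict_apply_univ, Real.volume_Ioc, sub_zero] at h3
    refine (pow_le_pow_left₀ zero_le h2 2).trans (h3.trans ?_)
    gcongr with s
    rw [← mul_pow]
    gcongr
    rw [← inner_gradient_left, mul_comm]
    rw [← ofReal_norm, ← ofReal_norm, ← ofReal_norm, ← ENNReal.ofReal_mul (norm_nonneg _)]
    exact ENNReal.ofReal_le_ofReal (norm_inner_le_norm _ _)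
  calc ∫⁻ y in W, ‖φ (y + t • z) - φ y‖ₑ ^ 2
      ≤ ∫⁻ y in W, ENNReal.ofReal t *
          ∫⁻ s in Ioc 0 t, ‖z‖ₑ ^ 2 * ‖gradient φ (y + s • z)‖ₑ ^ 2 := lintegral_mono hpt
    _ = ENNReal.ofReal t * ∫⁻ y in W,
          ∫⁻ s in Ioc 0 t, ‖z‖ₑ ^ 2 * ‖gradient φ (y + s • z)‖ₑ ^ 2 :=
        lintegral_const_mul' _ _ ENNReal.ofReal_ne_top
    _ = ENNReal.ofReal t * ∫⁻ s in Ioc 0 t,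
          ∫⁻ y in W, ‖z‖ₑ ^ 2 * ‖gradient φ (y + s • z)‖ₑ ^ 2 := by
        rw [lintegral_lintegral_swap]
        have hcont : Continuous fun w : Eucl N × ℝ => gradient φ (w.1 + w.2 • z) :=
          hgc.comp (by fun_prop)
        exact ((hcont.enorm.measurable.pow_const 2).const_mul _).aemeasurable
    _ ≤ ENNReal.ofReal t * ∫⁻ s in Ioc 0 t, ‖z‖ₑ ^ 2 * ∫⁻ x in Ω, ‖gradient φ x‖ₑ ^ 2 := by
        gcongr _ * ?_
        refine setLIntegral_mono' measurableSet_Ioc fun s hs => ?_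
        rw [lintegral_const_mul' _ _ (by simp)]
        gcongr _ * ?_
        exact lintegral_translate_le hW hΩ (fun y hy => hz y hy s ⟨hs.1.le, hs.2⟩)
          fun x => ‖gradient φ x‖ₑ ^ 2
    _ = _ := by
        rw [lintegral_const, Measure.restrict_apply_univ, Real.volume_Ioc, sub_zero]
        ring

/-- The mean over `y + t B`, as a function of `y`, is an integral over a translated ball. -/
theorem integral_ball_comp_eq (φ : Eucl N → ℝ) {t κ : ℝ} (ht : 0 < t) (z₀ y : Eucl N) :
    ∫ z in Metric.ball z₀ κ, φ (y + t • z)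
      = |(t ^ N)⁻¹| * ∫ x in Metric.ball (y + t • z₀) (t * κ), φ x := by
  rw [← integral_indicator Metric.isOpen_ball.measurableSet,
    ← integral_indicator Metric.isOpen_ball.measurableSet]
  set g := (Metric.ball (y + t • z₀) (t * κ)).indicator φ with hg
  have h1 : ∀ z, (Metric.ball z₀ κ).indicator (fun z => φ (y + t • z)) z = g (y + t • z) := by
    intro z
    have hiff : y + t • z ∈ Metric.ball (y + t • z₀) (t * κ) ↔ z ∈ Metric.ball z₀ κ := by
      rw [Metric.mem_ball, Metric.mem_ball, dist_add_left, dist_eq_norm, ← smul_sub, norm_smul,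
        Real.norm_of_nonneg ht.le, dist_eq_norm, mul_lt_mul_iff_right₀ ht]
    by_cases hz : z ∈ Metric.ball z₀ κ
    · rw [indicator_of_mem hz, hg, indicator_of_mem (hiff.2 hz)]
    · rw [indicator_of_notMem hz, hg, indicator_of_notMem (fun h => hz (hiff.1 h))]
  simp only [h1]
  have h2 := Measure.integral_comp_smul (volume : Measure (Eucl N)) (fun x => g (y + x)) t
  rw [h2, integral_add_left_eq_self, finrank_euclideanSpace, Fintype.card_fin, smul_eq_mul]

theorem add_sq_le_two_mul (a b : ℝ≥0∞) : (a + b) ^ 2 ≤ 2 * a ^ 2 + 2 * b ^ 2 := by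
  have h := ENNReal.rpow_add_le_mul_rpow_add_rpow a b (p := 2) (by norm_num)
  norm_num at h
  rw [← mul_add]
  exact h

/-- Up to the factor `|B|`, the value `φ y` is an average over `y + tB` plus an error controlled by
translations. The averages are compact under weak convergence, and the squared error is of order
`t²` times the Dirichlet energy. -/
theorem local_estimate {W : Set (Eucl N)} (hW : MeasurableSet W) (hΩ : MeasurableSet Ω)
    {φ : Eucl N → ℝ} (hφ : ContDiff ℝ ∞ φ) {z₀ : Eucl N} {κ t : ℝ} (ht : 0 ≤ t)
    (hz : ∀ y ∈ W, ∀ z ∈ Metric.ball z₀ κ, ∀ s ∈ Icc 0 t, y + s • z ∈ Ω) :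
    volume (Metric.ball z₀ κ) ^ 2 * ∫⁻ y in W, ‖φ y‖ₑ ^ 2
      ≤ 2 * (∫⁻ y in W, ‖∫ z in Metric.ball z₀ κ, φ (y + t • z)‖ₑ ^ 2)
        + 2 * (volume (Metric.ball z₀ κ) ^ 2 * (ENNReal.ofReal t ^ 2 *
          (ENNReal.ofReal (‖z₀‖ + κ) ^ 2 * ∫⁻ x in Ω, ‖gradient φ x‖ₑ ^ 2))) := by
  set B := Metric.ball z₀ κ with hB
  have hBm : MeasurableSet B := Metric.isOpen_ball.measurableSet
  have hBfin : volume B ≠ ⊤ := Metric.isBounded_ball.measure_lt_top.ne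
  have hφc := hφ.continuous
  have hcont2 : Continuous fun w : Eucl N × Eucl N => φ (w.1 + t • w.2) - φ w.1 := by fun_prop
  have hbi : ∀ {g : Eucl N → ℝ}, Continuous g → IntegrableOn g B := fun hg =>
    (hg.continuousOn.integrableOn_compact (isCompact_closedBall z₀ κ)).mono_set
      Metric.ball_subset_closedBall
  have hpt : ∀ y, volume B ^ 2 * ‖φ y‖ₑ ^ 2 ≤ 2 * ‖∫ z in B, φ (y + t • z)‖ₑ ^ 2
      + 2 * (volume B * ∫⁻ z in B, ‖φ (y + t • z) - φ y‖ₑ ^ 2) := by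
    intro y
    have hc : Continuous fun z => φ (y + t • z) := by fun_prop
    have e1 : volume.real B * φ y
        = (∫ z in B, φ (y + t • z)) - ∫ z in B, (φ (y + t • z) - φ y) := by
      rw [integral_sub (hbi hc) (hbi continuous_const), setIntegral_const, smul_eq_mul]
      ring
    have e2 : volume B * ‖φ y‖ₑ ≤ ‖∫ z in B, φ (y + t • z)‖ₑ
        + ∫⁻ z in B, ‖φ (y + t • z) - φ y‖ₑ := by
      have h1 : volume B * ‖φ y‖ₑ = ‖volume.real B * φ y‖ₑ := by
        rw [enorm_mul, Real.enorm_of_nonneg measureReal_nonneg, Measure.real,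
          ENNReal.ofReal_toReal hBfin]
      rw [h1, e1]
      refine (enorm_sub_le).trans ?_
      gcongr
      exact enorm_integral_le_lintegral_enorm _
    have h3 := sq_lintegral_le (μ := volume.restrict B) (f := fun z => φ (y + t • z) - φ y)
      (hc.sub continuous_const).aestronglyMeasurable
    rw [Measure.restrict_apply_univ] at h3
    rw [← mul_pow]
    refine (pow_le_pow_left₀ zero_le e2 2).trans ((add_sq_le_two_mul _ _).trans ?_)
    gcongr
  have hmeas : Measurable fun y => 2 * ‖∫ z in B, φ (y + t • z)‖ₑ ^ 2 := by
    have hsm : StronglyMeasurable fun w : Eucl N × Eucl N => φ (w.1 + t • w.2) :=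
      (by fun_prop : Continuous fun w : Eucl N × Eucl N => φ (w.1 + t • w.2)).stronglyMeasurable
    exact ((hsm.integral_prod_right' (ν := volume.restrict B)).measurable.enorm.pow_const 2).const_mul 2
  calc volume B ^ 2 * ∫⁻ y in W, ‖φ y‖ₑ ^ 2
      = ∫⁻ y in W, volume B ^ 2 * ‖φ y‖ₑ ^ 2 :=
        (lintegral_const_mul' _ _ (ENNReal.pow_ne_top hBfin)).symm
    _ ≤ ∫⁻ y in W, (2 * ‖∫ z in B, φ (y + t • z)‖ₑ ^ 2
        + 2 * (volume B * ∫⁻ z in B, ‖φ (y + t • z) - φ y‖ₑ ^ 2)) := lintegral_mono hpt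
    _ = 2 * (∫⁻ y in W, ‖∫ z in B, φ (y + t • z)‖ₑ ^ 2)
        + 2 * (volume B * ∫⁻ y in W, ∫⁻ z in B, ‖φ (y + t • z) - φ y‖ₑ ^ 2) := by
        rw [lintegral_add_left hmeas, lintegral_const_mul' _ _ (by simp),
          lintegral_const_mul' _ _ (by simp), lintegral_const_mul' _ _ hBfin]
    _ = 2 * (∫⁻ y in W, ‖∫ z in B, φ (y + t • z)‖ₑ ^ 2)
        + 2 * (volume B * ∫⁻ z in B, ∫⁻ y in W, ‖φ (y + t • z) - φ y‖ₑ ^ 2) := by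
        rw [lintegral_lintegral_swap]
        exact (hcont2.enorm.measurable.pow_const 2).aemeasurable
    _ ≤ 2 * (∫⁻ y in W, ‖∫ z in B, φ (y + t • z)‖ₑ ^ 2)
        + 2 * (volume B * ∫⁻ _ in B, (ENNReal.ofReal t ^ 2 *
          (ENNReal.ofReal (‖z₀‖ + κ) ^ 2 * ∫⁻ x in Ω, ‖gradient φ x‖ₑ ^ 2))) := by
        gcongr _ + 2 * (_ * ?_)
        refine setLIntegral_mono' hBm fun z hzB => ?_
        refine (lintegral_translate_sub_le hW hΩ hφ ht fun y hy => hz y hy z hzB).trans ?_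
        gcongr
        rw [← ofReal_norm]
        refine ENNReal.ofReal_le_ofReal ?_
        rw [hB, Metric.mem_ball, dist_eq_norm] at hzB
        have : z = z₀ + (z - z₀) := by abel
        rw [this]
        linarith [norm_add_le z₀ (z - z₀)]
    _ = _ := by
        rw [setLIntegral_const]
        ring

end Rellich

/-! ### Rellich compactness on Lipschitz domains -/

section Compactness

variable {N : ℕ} {Ω : Set (Eucl N)}

/-- First fix `t` so small that the gradient error is below `δ / 2`; then weak convergence makes the
averages at scale `t` vanish, with a bound allowing dominated convergence. -/
theorem exists_local_compactness (hΩ : IsOpen Ω) (hΩb : Bornology.IsBounded Ω)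
    (hL : HasLipschitzBoundary Ω) {φ : ℕ → Eucl N → ℝ} (hφ : ∀ n, ContDiff ℝ ∞ (φ n)) {I : ℝ≥0∞}
    (hI : I ≠ ⊤) (hgrad : ∀ n, ∫⁻ x in Ω, ‖gradient (φ n) x‖ₑ ^ 2 ≤ I) {M : ℝ}
    (hM : ∀ n, ∫ x in Ω, |φ n x| ≤ M)
    (hweak : ∀ A, MeasurableSet A → A ⊆ Ω → Tendsto (fun n => ∫ x in A, φ n x) atTop (𝓝 0))
    {x : Eucl N} (hx : x ∈ closure Ω) :
    ∃ r > 0, Tendsto (fun n => ∫⁻ y in Ω ∩ Metric.ball x r, ‖φ n y‖ₑ ^ 2) atTop (𝓝 0) := by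
  obtain ⟨r, z₀, κ, h₀, hr, hκ, hh₀, hcone⟩ := exists_cone hΩ hL hx
  refine ⟨r, hr, ?_⟩
  have := isFiniteMeasure_restrict hΩb
  set W := Ω ∩ Metric.ball x r with hW
  have hWm : MeasurableSet W := hΩ.measurableSet.inter Metric.isOpen_ball.measurableSet
  set B := Metric.ball z₀ κ with hB
  have hBpos : volume B ≠ 0 := (Metric.measure_ball_pos volume z₀ hκ).ne'
  have hBfin : volume B ≠ ⊤ := Metric.isBounded_ball.measure_lt_top.ne
  have hB2 : volume B ^ 2 ≠ 0 := pow_ne_zero 2 hBpos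
  have hB2' : volume B ^ 2 ≠ ⊤ := ENNReal.pow_ne_top hBfin
  have hWfin : volume W ≠ ⊤ := (hΩb.subset inter_subset_left).measure_lt_top.ne
  have hint : ∀ n, IntegrableOn (φ n) Ω := fun n =>
    (memLp_of_continuous hΩ hΩb (hφ n).continuous).integrable (by norm_num)
  have hmean : ∀ t, 0 < t → t ≤ h₀ →
      Tendsto (fun n => ∫⁻ y in W, ‖∫ z in B, φ n (y + t • z)‖ₑ ^ 2) atTop (𝓝 0) := by
    intro t ht hth
    -- The ball is `y + tB`, so the cone property at `s = t` places it in `Ω`.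
    have hsub : ∀ y ∈ W, Metric.ball (y + t • z₀) (t * κ) ⊆ Ω := by
      intro y hy a ha
      have e : a = y + t • (t⁻¹ • (a - y)) := by
        rw [smul_smul, mul_inv_cancel₀ ht.ne', one_smul]; abel
      rw [e]
      refine hcone y hy.1 hy.2 _ ?_ t ⟨ht.le, hth⟩
      rw [Metric.mem_ball, dist_eq_norm] at ha ⊢
      have e2 : t⁻¹ • (a - y) - z₀ = t⁻¹ • (a - (y + t • z₀)) := by
        rw [smul_sub, smul_sub, smul_add, smul_smul, inv_mul_cancel₀ ht.ne', one_smul]; abel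
      rw [e2, norm_smul, norm_inv, Real.norm_of_nonneg ht.le, inv_mul_lt_iff₀ ht]
      exact ha
    set C : ℝ := |(t ^ N)⁻¹| * M with hC
    have hbd : ∀ n, ∀ y ∈ W, ‖∫ z in B, φ n (y + t • z)‖ ≤ C := by
      intro n y hy
      rw [integral_ball_comp_eq _ ht, norm_mul, Real.norm_eq_abs, abs_abs]
      refine mul_le_mul_of_nonneg_left ?_ (abs_nonneg _)
      refine (norm_integral_le_integral_norm _).trans (le_trans ?_ (hM n))
      exact setIntegral_mono_set (hint n).abs (Eventually.of_forall fun _ => abs_nonneg _)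
        (LE.le.eventuallyLE (hsub y hy))
    have hmeas : ∀ n, Measurable fun y => ‖∫ z in B, φ n (y + t • z)‖ₑ ^ 2 := fun n => by
      have hc := (hφ n).continuous
      have hsm : StronglyMeasurable fun w : Eucl N × Eucl N => φ n (w.1 + t • w.2) :=
        (by fun_prop : Continuous fun w : Eucl N × Eucl N => φ n (w.1 + t • w.2)).stronglyMeasurable
      exact (hsm.integral_prod_right' (ν := volume.restrict B)).measurable.enorm.pow_const 2
    have := tendsto_lintegral_of_dominated_convergence (μ := volume.restrict W)
      (F := fun n y => ‖∫ z in B, φ n (y + t • z)‖ₑ ^ 2) (f := fun _ => 0)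
      (fun _ => ENNReal.ofReal C ^ 2) hmeas
      (fun n => by
        filter_upwards [ae_restrict_mem hWm] with y hy
        gcongr
        rw [← ofReal_norm]
        exact ENNReal.ofReal_le_ofReal (hbd n y hy))
      (by
        rw [lintegral_const, Measure.restrict_apply_univ]
        exact ENNReal.mul_ne_top (ENNReal.pow_ne_top ENNReal.ofReal_ne_top) hWfin)
      (by
        filter_upwards [ae_restrict_mem hWm] with y hy
        have h1 := (hweak _ Metric.isOpen_ball.measurableSet (hsub y hy)).const_mul |(t ^ N)⁻¹|
        simp only [← integral_ball_comp_eq _ ht, mul_zero] at h1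
        have h2 := ENNReal.Tendsto.pow (n := 2) h1.enorm
        simpa using h2)
    simpa using this
  rw [ENNReal.tendsto_nhds_zero]
  intro δ hδ
  set c : ℝ≥0∞ := ENNReal.ofReal (‖z₀‖ + κ) ^ 2 * I with hc
  have hcfin : c ≠ ⊤ := ENNReal.mul_ne_top (ENNReal.pow_ne_top ENNReal.ofReal_ne_top) hI
  have hsmall : ∃ t, 0 < t ∧ t ≤ h₀ ∧ 2 * (ENNReal.ofReal t ^ 2 * c) ≤ δ / 2 := by
    have hlim : Tendsto (fun t : ℝ => 2 * (ENNReal.ofReal t ^ 2 * c)) (𝓝[>] 0) (𝓝 0) := by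
      have h1 : Tendsto (fun t : ℝ => ENNReal.ofReal t) (𝓝[>] 0) (𝓝 0) := by
        have := (ENNReal.continuous_ofReal.tendsto 0).mono_left
          (nhdsWithin_le_nhds (s := Ioi (0 : ℝ)))
        simpa using this
      have h2 := ENNReal.Tendsto.pow (n := 2) h1
      have h3 := ENNReal.Tendsto.const_mul (a := 2)
        (ENNReal.Tendsto.mul_const (b := c) h2 (Or.inr hcfin)) (Or.inr (by simp))
      simpa using h3
    have h1 := ENNReal.tendsto_nhds_zero.1 hlim (δ / 2) (ENNReal.half_pos hδ.ne')
    have h2 : ∀ᶠ t in 𝓝[>] (0 : ℝ), t ∈ Ioc 0 h₀ := Ioc_mem_nhdsGT hh₀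
    obtain ⟨t, ht1, ht2⟩ := (h1.and h2).exists
    exact ⟨t, ht2.1, ht2.2, ht1⟩
  obtain ⟨t, ht, hth, htδ⟩ := hsmall
  have hm2 : Tendsto (fun n => (volume B ^ 2)⁻¹ * (2 * ∫⁻ y in W, ‖∫ z in B, φ n (y + t • z)‖ₑ ^ 2))
      atTop (𝓝 0) := by
    have h3 := ENNReal.Tendsto.const_mul (a := (volume B ^ 2)⁻¹)
        (ENNReal.Tendsto.const_mul (a := 2) (hmean t ht hth) (Or.inr (by simp)))
        (Or.inr (by simpa using hBpos))
    simpa using h3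
  filter_upwards [ENNReal.tendsto_nhds_zero.1 hm2 (δ / 2) (ENNReal.half_pos hδ.ne')] with n hn
  have hest := local_estimate hWm hΩ.measurableSet (hφ n) (z₀ := z₀) (κ := κ) ht.le
    (fun y hy z hz s hs => hcone y hy.1 hy.2 z hz s ⟨hs.1, hs.2.trans hth⟩)
  rw [← hB] at hest
  have hX : ∫⁻ y in W, ‖φ n y‖ₑ ^ 2
      = (volume B ^ 2)⁻¹ * (volume B ^ 2 * ∫⁻ y in W, ‖φ n y‖ₑ ^ 2) := by
    rw [← mul_assoc, ENNReal.inv_mul_cancel hB2 hB2', one_mul]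
  rw [hX, ← ENNReal.add_halves δ]
  calc (volume B ^ 2)⁻¹ * (volume B ^ 2 * ∫⁻ y in W, ‖φ n y‖ₑ ^ 2)
      ≤ (volume B ^ 2)⁻¹ * (2 * (∫⁻ y in W, ‖∫ z in B, φ n (y + t • z)‖ₑ ^ 2)
        + 2 * (volume B ^ 2 * (ENNReal.ofReal t ^ 2 *
          (ENNReal.ofReal (‖z₀‖ + κ) ^ 2 * ∫⁻ x in Ω, ‖gradient (φ n) x‖ₑ ^ 2)))) := by
        gcongr
    _ ≤ (volume B ^ 2)⁻¹ * (2 * (∫⁻ y in W, ‖∫ z in B, φ n (y + t • z)‖ₑ ^ 2)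
        + 2 * (volume B ^ 2 * (ENNReal.ofReal t ^ 2 * c))) := by
        rw [hc]
        gcongr
        exact hgrad n
    _ = (volume B ^ 2)⁻¹ * (2 * (∫⁻ y in W, ‖∫ z in B, φ n (y + t • z)‖ₑ ^ 2))
        + ((volume B ^ 2)⁻¹ * volume B ^ 2) * (2 * (ENNReal.ofReal t ^ 2 * c)) := by ring
    _ ≤ δ / 2 + δ / 2 := by
        rw [ENNReal.inv_mul_cancel hB2 hB2', one_mul]
        gcongr

/-- Rellich compactness for smooth functions on a bounded Lipschitz domain. -/
theorem tendsto_lintegral_sq_of_weak (hΩ : IsOpen Ω) (hΩb : Bornology.IsBounded Ω)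
    (hL : HasLipschitzBoundary Ω) {φ : ℕ → Eucl N → ℝ} (hφ : ∀ n, ContDiff ℝ ∞ (φ n)) {I : ℝ≥0∞}
    (hI : I ≠ ⊤) (hgrad : ∀ n, ∫⁻ x in Ω, ‖gradient (φ n) x‖ₑ ^ 2 ≤ I) {M : ℝ}
    (hM : ∀ n, ∫ x in Ω, |φ n x| ≤ M)
    (hweak : ∀ A, MeasurableSet A → A ⊆ Ω → Tendsto (fun n => ∫ x in A, φ n x) atTop (𝓝 0)) :
    Tendsto (fun n => ∫⁻ y in Ω, ‖φ n y‖ₑ ^ 2) atTop (𝓝 0) := by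
  -- The convergence is inherited by subsets and finite unions, so compactness of the closure makes
  -- the local result global.
  have key := hΩb.isCompact_closure.induction_on
    (p := fun S => Tendsto (fun n => ∫⁻ y in Ω ∩ S, ‖φ n y‖ₑ ^ 2) atTop (𝓝 0)) (by simp)
    (fun S T hST hT => tendsto_of_tendsto_of_tendsto_of_le_of_le tendsto_const_nhds hT
      (fun _ => zero_le) fun n => lintegral_mono_set (inter_subset_inter_right _ hST))
    (fun S T hS hT => by
      have h := hS.add hT
      rw [add_zero] at h
      refine tendsto_of_tendsto_of_tendsto_of_le_of_le tendsto_const_nhds h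
        (fun _ => zero_le) fun n => ?_
      rw [inter_union_distrib_left]
      exact lintegral_union_le _ _ _)
    (fun x hx => by
      obtain ⟨r, hr, hlim⟩ := exists_local_compactness hΩ hΩb hL hφ hI hgrad hM hweak hx
      exact ⟨Metric.ball x r, mem_nhdsWithin_of_mem_nhds (Metric.ball_mem_nhds x hr), hlim⟩)
  rwa [inter_eq_left.2 subset_closure] at key

theorem eLpNorm_le_add_of_sub {F : Type*} [NormedAddCommGroup F] {μ : Measure (Eucl N)}
    {f g : Eucl N → F} (hf : AEStronglyMeasurable f μ) (hg : AEStronglyMeasurable g μ)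
    {a b : ℝ≥0∞} (hfg : eLpNorm (fun x => f x - g x) 2 μ ≤ a) (hgb : eLpNorm g 2 μ ≤ b) :
    eLpNorm f 2 μ ≤ a + b := by
  have e : f = (fun y => f y - g y) + g := by funext y; simp
  rw [e]
  exact (eLpNorm_add_le (hf.sub hg) hg (by norm_num)).trans (add_le_add hfg hgb)

theorem eLpNorm_coeFn_le {F : Type*} [NormedAddCommGroup F] {μ : Measure (Eucl N)}
    {f : Lp F 2 μ} {M : ℝ} (h : ‖f‖ ≤ M) : eLpNorm f 2 μ ≤ ENNReal.ofReal M := by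
  rw [Lp.norm_def] at h
  rw [← ENNReal.ofReal_toReal (Lp.eLpNorm_ne_top f)]
  exact ENNReal.ofReal_le_ofReal h

theorem integral_abs_le_of_eLpNorm_two_le {μ : Measure (Eucl N)} [IsFiniteMeasure μ]
    {f : Eucl N → ℝ} (hf : AEStronglyMeasurable f μ) {a : ℝ≥0∞} (ha : a ≠ ⊤)
    (h : eLpNorm f 2 μ ≤ a) :
    ∫ x, |f x| ∂μ ≤ (a * μ univ ^ (1 / 2 : ℝ)).toReal := by
  have e1 : ∫ y, |f y| ∂μ = (eLpNorm f 1 μ).toReal := by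
    rw [eLpNorm_one_eq_lintegral_enorm, ← integral_norm_eq_lintegral_enorm hf]
    rfl
  rw [e1]
  refine ENNReal.toReal_mono (ENNReal.mul_ne_top ha
    (ENNReal.rpow_ne_top_of_nonneg (by norm_num) (measure_ne_top _ _))) ?_
  have h2 := eLpNorm_le_eLpNorm_mul_rpow_measure_univ (μ := μ) (p := 1) (q := 2) (f := f)
    (by norm_num) hf
  refine h2.trans ?_
  refine mul_le_mul' h (le_of_eq ?_)
  norm_num

theorem tendsto_setIntegral_of_close {μ : Measure (Eucl N)} [IsFiniteMeasure μ]
    {u : ℕ → Lp ℝ 2 μ} {φ : ℕ → Eucl N → ℝ} (hφ : ∀ n, AEStronglyMeasurable (φ n) μ)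
    {δ : ℕ → ℝ≥0∞} (hδ : Tendsto δ atTop (𝓝 0))
    (hclose : ∀ n, eLpNorm (fun x => φ n x - u n x) 2 μ ≤ δ n)
    {A : Set (Eucl N)}
    (hu : Tendsto (fun n => ∫ x in A, u n x ∂μ) atTop (𝓝 0)) (hφi : ∀ n, Integrable (φ n) μ) :
    Tendsto (fun n => ∫ x in A, φ n x ∂μ) atTop (𝓝 0) := by
  have hui : ∀ n, Integrable (u n) μ := fun n => (Lp.memLp (u n)).integrable (by norm_num)
  have h1 : Tendsto (fun n => ∫ x in A, (φ n x - u n x) ∂μ) atTop (𝓝 0) := by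
    refine tendsto_zero_iff_enorm_tendsto_zero.2 ?_
    have hlim : Tendsto (fun n => δ n * μ univ ^ (1 / 2 : ℝ)) atTop (𝓝 0) := by
      have := ENNReal.Tendsto.mul_const (b := μ univ ^ (1 / 2 : ℝ)) hδ
        (Or.inr (ENNReal.rpow_ne_top_of_nonneg (by norm_num) (measure_ne_top _ _)))
      simpa using this
    refine tendsto_of_tendsto_of_tendsto_of_le_of_le tendsto_const_nhds hlim
      (fun _ => zero_le) fun n => ?_
    refine (enorm_integral_le_lintegral_enorm _).trans ((setLIntegral_le_lintegral _ _).trans ?_)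
    rw [← eLpNorm_one_eq_lintegral_enorm]
    refine (eLpNorm_le_eLpNorm_mul_rpow_measure_univ (p := 1) (q := 2) (by norm_num)
      ((hφ n).sub (Lp.aestronglyMeasurable _))).trans ?_
    gcongr ?_ * ?_
    · exact hclose n
    · norm_num
  have h2 := h1.add hu
  rw [add_zero] at h2
  refine h2.congr fun n => ?_
  rw [integral_sub (hφi n).integrableOn (hui n).integrableOn, sub_add_cancel]

/-- Compactness of the embedding of `traceZero Ω D` into `L²(Ω)`. -/
theorem tendsto_fnL_of_weak (hΩ : IsOpen Ω) (hΩb : Bornology.IsBounded Ω)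
    (hL : HasLipschitzBoundary Ω) {D : Set (Eucl N)} {x : ℕ → H1 Ω} {M : ℝ}
    (hxD : ∀ n, x n ∈ traceZero Ω D)
    (hx : ∀ n, ‖x n‖ ≤ M)
    (hweak : ∀ f : H1 Ω →L[ℝ] ℝ, Tendsto (fun n => f (x n)) atTop (𝓝 0)) :
    Tendsto (fun n => fnL Ω (x n)) atTop (𝓝 0) := by
  have := isFiniteMeasure_restrict hΩb
  have hpos : ∀ n : ℕ, (0 : ℝ≥0∞) < ((n : ℝ≥0∞) + 1)⁻¹ := fun n => by simp
  have hle1 : ∀ n : ℕ, ((n : ℝ≥0∞) + 1)⁻¹ ≤ 1 := fun n => by simp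
  have hz : Tendsto (fun n : ℕ => ((n : ℝ≥0∞) + 1)⁻¹) atTop (𝓝 0) := by
    have := (tendsto_add_atTop_iff_nat 1).2 ENNReal.tendsto_inv_nat_nhds_zero
    simpa using this
  -- Each `x n` is replaced by a smooth function within `1 / (n + 1)` in both values and gradients,
  -- which preserves the bounds and the limits of set integrals.
  choose φ hφ h1 h2 _ using fun n : ℕ =>
    smoothApprox_iff.1 (hasTraceOn_zero_iff.1 (hxD n)) _ (hpos n)
  have hφc : ∀ n, AEStronglyMeasurable (φ n) (volume.restrict Ω) := fun n =>
    (hφ n).continuous.aestronglyMeasurable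
  have hφi : ∀ n, Integrable (φ n) (volume.restrict Ω) := fun n =>
    (memLp_of_continuous hΩ hΩb (hφ n).continuous).integrable (by norm_num)
  have hnorm : ∀ n, ‖fn (x n)‖ ≤ M ∧ ‖grad (x n)‖ ≤ M := fun n => by
    have h0 : 0 ≤ M := (norm_nonneg _).trans (hx n)
    have e := norm_sq_H1 (x n)
    rw [fnL_apply, gradL_apply] at e
    have hxn : ‖(x n)‖ ≤ M := hx n
    have hsq : ‖(x n)‖ ^ 2 ≤ M ^ 2 := pow_le_pow_left₀ (norm_nonneg _) hxn 2
    constructor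
    · refine le_of_sq_le_sq ?_ h0
      linarith [sq_nonneg ‖grad (x n)‖]
    · refine le_of_sq_le_sq ?_ h0
      linarith [sq_nonneg ‖fn (x n)‖]
  have hφ2 : ∀ n, eLpNorm (φ n) 2 (volume.restrict Ω) ≤ 1 + ENNReal.ofReal M := fun n =>
    eLpNorm_le_add_of_sub (hφc n) (Lp.aestronglyMeasurable _) ((h1 n).trans (hle1 n))
      (eLpNorm_coeFn_le (hnorm n).1)
  have hgφ2 : ∀ n, eLpNorm (gradient (φ n)) 2 (volume.restrict Ω) ≤ 1 + ENNReal.ofReal M :=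
    fun n => eLpNorm_le_add_of_sub (continuous_gradient (hφ n)).aestronglyMeasurable
      (Lp.aestronglyMeasurable _) ((h2 n).trans (hle1 n)) (eLpNorm_coeFn_le (hnorm n).2)
  have hfin : (1 + ENNReal.ofReal M) ≠ ⊤ := by simp
  have hset : ∀ A, MeasurableSet A → A ⊆ Ω →
      Tendsto (fun n => ∫ x in A, φ n x) atTop (𝓝 0) := by
    intro A hA hAΩ
    have hf1 := hweak ((innerSL ℝ (indicatorConstLp 2 hA
      (measure_ne_top (volume.restrict Ω) A) (1 : ℝ))).comp (fnL Ω))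
    have hf2 : Tendsto (fun n => ∫ y in A, fn (x n) y ∂(volume.restrict Ω)) atTop (𝓝 0) := by
      refine hf1.congr fun n => ?_
      exact L2.inner_indicatorConstLp_one hA _ (fn (x n))
    have h3 := tendsto_setIntegral_of_close hφc hz h1 hf2 hφi
    rwa [Measure.restrict_restrict hA, inter_eq_left.2 hAΩ] at h3
  have hL2 : Tendsto (fun n => ∫⁻ y in Ω, ‖φ n y‖ₑ ^ 2) atTop (𝓝 0) :=
    tendsto_lintegral_sq_of_weak hΩ hΩb hL hφ (I := (1 + ENNReal.ofReal M) ^ 2)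
      (ENNReal.pow_ne_top hfin)
      (fun n => by
        rw [← eLpNorm_two_sq_eq_lintegral]
        exact pow_le_pow_left₀ zero_le (hgφ2 n) 2)
      (fun n => integral_abs_le_of_eLpNorm_two_le (hφc n) hfin (hφ2 n)) hset
  have hφ0 : Tendsto (fun n => eLpNorm (φ n) 2 (volume.restrict Ω)) atTop (𝓝 0) := by
    refine tendsto_zero_of_sq_tendsto_zero ?_
    simpa only [eLpNorm_two_sq_eq_lintegral] using hL2
  have hsum := hz.add hφ0
  rw [add_zero] at hsum
  have hfn0 : Tendsto (fun n => eLpNorm (fn (x n)) 2 (volume.restrict Ω)) atTop (𝓝 0) :=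
    tendsto_of_tendsto_of_tendsto_of_le_of_le tendsto_const_nhds hsum (fun _ => zero_le) fun n =>
      eLpNorm_le_add_of_sub (Lp.aestronglyMeasurable _) (hφc n)
        (by
          refine le_trans (le_of_eq ?_) (h1 n)
          exact eLpNorm_sub_comm (fn (x n)) (φ n) 2 _) le_rfl
  rw [tendsto_zero_iff_norm_tendsto_zero]
  have := (ENNReal.tendsto_toReal ENNReal.zero_ne_top).comp hfn0
  exact this

end Compactness

/-! ### Lattice operations and the Hilbert space of zero trace -/

section Lattice

variable {N : ℕ} {Ω : Set (Eucl N)}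

theorem coeFn_fn_add (u v : H1 Ω) :
    fn (u + v) =ᵐ[volume.restrict Ω] fun x => fn u x + fn v x := by
  have h := coeFn_fn_add_smul u v 1
  simpa only [one_smul, one_mul] using h

theorem coeFn_grad_add (u v : H1 Ω) :
    grad (u + v) =ᵐ[volume.restrict Ω] fun x => grad u x + grad v x := by
  have h := coeFn_grad_add_smul u v 1
  simpa only [one_smul] using h

theorem coeFn_fn_sub (u v : H1 Ω) :
    fn (u - v) =ᵐ[volume.restrict Ω] fun x => fn u x - fn v x := by
  have h := coeFn_fn_add_smul u v (-1)
  simpa only [neg_smul, one_smul, neg_one_mul, ← sub_eq_add_neg] using h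

theorem coeFn_grad_sub (u v : H1 Ω) :
    grad (u - v) =ᵐ[volume.restrict Ω] fun x => grad u x - grad v x := by
  have h := coeFn_grad_add_smul u v (-1)
  simpa only [neg_smul, one_smul, ← sub_eq_add_neg] using h

/-- With `z = (w₁ - w₂)⁺`, the minimum is `w₁ - z` and the maximum `w₂ + z`. Pointwise the two
gradients are either kept or exchanged, so the sum of squares is preserved. -/
theorem exists_inf_sup (hΩ : IsOpen Ω) (hΩb : Bornology.IsBounded Ω) {D : Set (Eucl N)}
    {w₁ w₂ : H1 Ω} (h₁ : w₁ ∈ traceZero Ω D) (h₂ : w₂ ∈ traceZero Ω D) :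
    ∃ a ∈ traceZero Ω D, ∃ b ∈ traceZero Ω D, fn a = fn w₁ ⊓ fn w₂ ∧ fn b = fn w₁ ⊔ fn w₂ ∧
      ‖grad a‖ ^ 2 + ‖grad b‖ ^ 2 = ‖grad w₁‖ ^ 2 + ‖grad w₂‖ ^ 2 := by
  obtain ⟨z, hz, hz1, hz2⟩ := exists_trunc hΩ hΩb (sub_mem h₁ h₂) le_rfl
  refine ⟨w₁ - z, sub_mem h₁ hz, w₂ + z, add_mem h₂ hz, ?_, ?_, ?_⟩
  · refine Lp.ext ?_
    filter_upwards [hz1, coeFn_fn_sub w₁ w₂, coeFn_fn_sub w₁ z, Lp.coeFn_inf (fn w₁) (fn w₂)]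
      with x e1 e2 e3 e4
    rw [e3, e4, e1, e2, sub_zero, Pi.inf_apply]
    rcases le_total (fn w₁ x) (fn w₂ x) with h | h
    · rw [inf_eq_left.2 h, max_eq_right (by linarith), sub_zero]
    · rw [inf_eq_right.2 h, max_eq_left (by linarith), sub_sub_cancel]
  · refine Lp.ext ?_
    filter_upwards [hz1, coeFn_fn_sub w₁ w₂, coeFn_fn_add w₂ z, Lp.coeFn_sup (fn w₁) (fn w₂)]
      with x e1 e2 e3 e4
    rw [e3, e4, e1, e2, sub_zero, Pi.sup_apply]
    rcases le_total (fn w₁ x) (fn w₂ x) with h | h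
    · rw [sup_eq_right.2 h, max_eq_right (by linarith), add_zero]
    · rw [sup_eq_left.2 h, max_eq_left (by linarith), add_sub_cancel]
  · simp only [← real_inner_self_eq_norm_sq, L2.inner_def]
    rw [← integral_add (L2.integrable_inner _ _) (L2.integrable_inner _ _),
      ← integral_add (L2.integrable_inner _ _) (L2.integrable_inner _ _)]
    refine integral_congr_ae ?_
    filter_upwards [hz2, coeFn_grad_sub w₁ w₂, coeFn_grad_sub w₁ z, coeFn_grad_add w₂ z]
      with x e1 e2 e3 e4
    rw [e3, e4, e1, e2]
    split_ifs
    · rw [one_smul, sub_sub_cancel, add_sub_cancel, add_comm]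
    · rw [zero_smul, sub_zero, add_zero]

/-- Truncation to `[0, 1]` in the space of functions with zero trace. -/
theorem exists_clamp (hΩ : IsOpen Ω) (hΩb : Bornology.IsBounded Ω) {D : Set (Eucl N)} {w : H1 Ω}
    (hw : w ∈ traceZero Ω D) :
    ∃ z ∈ traceZero Ω D, (∀ᵐ x ∂(volume.restrict Ω), fn z x = max 0 (min 1 (fn w x))) ∧
      ∀ᵐ x ∂(volume.restrict Ω), ‖grad z x‖ ≤ ‖grad w x‖ := by
  -- The clamp of `s` is `s⁺ - (s - 1)⁺`.
  obtain ⟨a, ha, ha1, ha2⟩ := exists_trunc hΩ hΩb hw le_rfl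
  obtain ⟨b, hb, hb1, hb2⟩ := exists_trunc hΩ hΩb hw zero_le_one
  refine ⟨a - b, sub_mem ha hb, ?_, ?_⟩
  · filter_upwards [ha1, hb1, coeFn_fn_sub a b] with x e1 e2 e3
    rw [e3, e1, e2, sub_zero]
    rcases le_total (fn w x) 0 with h | h
    · rw [max_eq_right h, max_eq_right (by linarith), min_eq_right (by linarith), max_eq_left h,
        sub_zero]
    · rw [max_eq_left h]
      rcases le_total (fn w x) 1 with h' | h'
      · rw [max_eq_right (by linarith), min_eq_right h', max_eq_right h, sub_zero]
      · rw [max_eq_left (by linarith), min_eq_left h', max_eq_right zero_le_one, sub_sub_cancel]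
  · filter_upwards [ha2, hb2, coeFn_grad_sub a b] with x e1 e2 e3
    rw [e3, e1, e2, ← sub_smul, norm_smul]
    refine mul_le_of_le_one_left (norm_nonneg _) ?_
    split_ifs <;> norm_num

/-- The Hilbert space of the elements of `H¹(Ω)` with zero trace on `D`. -/
def H1D (Ω D : Set (Eucl N)) : Type := traceZero Ω D

namespace H1D

variable {D : Set (Eucl N)}

noncomputable instance : NormedAddCommGroup (H1D Ω D) :=
  inferInstanceAs (NormedAddCommGroup (traceZero Ω D))

noncomputable instance : InnerProductSpace ℝ (H1D Ω D) :=
  inferInstanceAs (InnerProductSpace ℝ (traceZero Ω D))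

instance : CompleteSpace (H1D Ω D) := inferInstanceAs (CompleteSpace (traceZero Ω D))

instance : SecondCountableTopology (H1D Ω D) :=
  inferInstanceAs (SecondCountableTopology (traceZero Ω D))

/-- The inclusion into `H¹(Ω)`. -/
noncomputable def val : H1D Ω D →L[ℝ] H1 Ω := (traceZero Ω D).subtypeL

theorem val_mem (w : H1D Ω D) : val w ∈ traceZero Ω D := w.2

theorem exists_val_eq {u : H1 Ω} (hu : u ∈ traceZero Ω D) : ∃ w : H1D Ω D, val w = u := ⟨⟨u, hu⟩, rfl⟩

theorem val_injective : Function.Injective (val : H1D Ω D → H1 Ω) := Subtype.val_injective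

theorem norm_val (w : H1D Ω D) : ‖val w‖ = ‖w‖ := rfl

/-- The embedding into `L²(Ω)`. -/
noncomputable def fnD (Ω D : Set (Eucl N)) : H1D Ω D →L[ℝ] Lp ℝ 2 (volume.restrict Ω) :=
  (fnL Ω).comp val

/-- The gradient. -/
noncomputable def gradD (Ω D : Set (Eucl N)) : H1D Ω D →L[ℝ] Lp (Eucl N) 2 (volume.restrict Ω) :=
  (gradL Ω).comp val

theorem fnD_apply (w : H1D Ω D) : fnD Ω D w = fn (val w) := rfl

theorem gradD_apply (w : H1D Ω D) : gradD Ω D w = grad (val w) := rfl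

theorem isSobolevPair (hΩ : IsOpen Ω) (hΩb : Bornology.IsBounded Ω)
    (hL : HasLipschitzBoundary Ω) (D : Set (Eucl N)) :
    IsSobolevPair (fnD Ω D) (gradD Ω D) where
  norm_sq w := by
    rw [fnD_apply, gradD_apply, ← norm_val, norm_sq_H1, fnL_apply, gradL_apply]
  injective := (fnL_injective hΩ hΩb).comp val_injective
  tendsto_zero x M hx hweak :=
    tendsto_fnL_of_weak hΩ hΩb hL (x := fun n => val (x n)) (fun n => val_mem _)
      (fun n => (norm_val _).trans_le (hx n)) fun f => hweak (f.comp val)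
  lattice w₁ w₂ := by
    obtain ⟨a, ha, b, hb, h1, h2, h3⟩ := exists_inf_sup hΩ hΩb (val_mem w₁) (val_mem w₂)
    obtain ⟨a, rfl⟩ := exists_val_eq ha
    obtain ⟨b, rfl⟩ := exists_val_eq hb
    exact ⟨a, b, h1, h2, h3.le⟩

end H1D

end Lattice

/-! ### Translation between phase field and damage -/

section Energy

variable {N : ℕ} {Ω : Set (Eucl N)}

/-- `o` is the constant function `1`. -/
def IsOne (o : H1 Ω) : Prop :=
  (∀ᵐ x ∂(volume.restrict Ω), fn o x = 1) ∧ ∀ᵐ x ∂(volume.restrict Ω), grad o x = 0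

theorem exists_isOne (hΩb : Bornology.IsBounded Ω) : ∃ o : H1 Ω, IsOne o := by
  have := isFiniteMeasure_restrict hΩb
  have m1 : MemLp (fun _ : Eucl N => (1 : ℝ)) 2 (volume.restrict Ω) := memLp_const 1
  have e : gradient (fun _ : Eucl N => (1 : ℝ)) = 0 := by
    funext x
    simp [gradient]
  have m2 : MemLp (gradient (fun _ : Eucl N => (1 : ℝ))) 2 (volume.restrict Ω) := by
    rw [e]; exact MemLp.zero
  refine ⟨⟨WithLp.toLp 2 (m1.toLp _, m2.toLp _), (isWeakGradient_gradient contDiff_const).congr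
    m1.coeFn_toLp.symm m2.coeFn_toLp.symm⟩, m1.coeFn_toLp, ?_⟩
  refine m2.coeFn_toLp.trans ?_
  rw [e]
  exact Eventually.of_forall fun _ => rfl

theorem IsOne.coeFn_fn_sub {o : H1 Ω} (ho : IsOne o) (v : H1 Ω) :
    ∀ᵐ x ∂(volume.restrict Ω), fn (o - v) x = 1 - fn v x := by
  filter_upwards [AmbrosioTortorelli.coeFn_fn_sub o v, ho.1] with x h1 h2
  rw [h1, h2]

theorem IsOne.coeFn_grad_sub {o : H1 Ω} (ho : IsOne o) (v : H1 Ω) :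
    ∀ᵐ x ∂(volume.restrict Ω), grad (o - v) x = -grad v x := by
  filter_upwards [AmbrosioTortorelli.coeFn_grad_sub o v, ho.2] with x h1 h2
  rw [h1, h2, zero_sub]

theorem IsOne.hasTraceOn_sub {o : H1 Ω} (ho : IsOne o) {D : Set (Eucl N)} {v : H1 Ω}
    {h : Eucl N → ℝ} (hv : HasTraceOn D v h) : HasTraceOn D (o - v) (fun x => 1 - h x) := by
  obtain ⟨hm, φ, hφ, h1, h2, h3⟩ := hv
  refine ⟨aestronglyMeasurable_const.sub hm, fun n x => 1 - φ n x,
    fun n => contDiff_const.sub (hφ n), ?_, ?_, ?_⟩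
  · refine h1.congr fun n => eLpNorm_congr_norm_ae ?_
    filter_upwards [ho.coeFn_fn_sub v] with x hx
    rw [hx, sub_sub_sub_cancel_left, norm_sub_rev]
  · refine h2.congr fun n => eLpNorm_congr_norm_ae ?_
    filter_upwards [ho.coeFn_grad_sub v] with x hx
    have e : gradient (fun y => 1 - φ n y) x = -gradient (φ n) x := by
      simp [gradient, fderiv_const_sub]
    rw [hx, e, ← norm_neg]
    congr 1
    abel
  · refine h3.congr fun n => eLpNorm_congr_norm_ae (Eventually.of_forall fun x => ?_)
    simp only
    rw [sub_sub_sub_cancel_left, norm_sub_rev]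

/-- `v ↦ 1 - v` is an involution acting on approximating sequences, so one lemma gives both
directions. -/
theorem IsOne.hasTraceOn_one_iff {o : H1 Ω} (ho : IsOne o) {D : Set (Eucl N)} {v : H1 Ω} :
    HasTraceOn D v (fun _ => 1) ↔ o - v ∈ traceZero Ω D := by
  rw [mem_traceZero]
  constructor
  · intro h
    simpa using ho.hasTraceOn_sub h
  · intro h
    simpa using ho.hasTraceOn_sub h

theorem lintegral_ofReal_norm_sq {α G : Type*} [MeasurableSpace α] {μ : Measure α}
    [NormedAddCommGroup G] [InnerProductSpace ℝ G] (f : Lp G 2 μ) :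
    ∫⁻ x, ENNReal.ofReal (‖f x‖ ^ 2) ∂μ = ENNReal.ofReal (‖f‖ ^ 2) := by
  have hi := L2.integrable_inner (𝕜 := ℝ) f f
  simp only [real_inner_self_eq_norm_sq] at hi
  rw [← ofReal_integral_eq_lintegral_ofReal hi (Eventually.of_forall fun _ => sq_nonneg _),
    ← real_inner_self_eq_norm_sq, L2.inner_def]
  simp only [real_inner_self_eq_norm_sq]

variable {D : Set (Eucl N)}

theorem IsOne.mem_Icc_iff {o : H1 Ω} (ho : IsOne o) {w : Lp ℝ 2 (volume.restrict Ω)} :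
    w ∈ Icc 0 (fn o) ↔ ∀ᵐ x ∂(volume.restrict Ω), 0 ≤ w x ∧ w x ≤ 1 := by
  rw [mem_Icc, ← Lp.coeFn_nonneg, ← Lp.coeFn_le]
  constructor
  · rintro ⟨h1, h2⟩
    filter_upwards [h1, h2, ho.1] with x a b c
    exact ⟨a, b.trans c.le⟩
  · intro h
    constructor
    · filter_upwards [h] with x a using a.1
    · filter_upwards [h, ho.1] with x a c using a.2.trans c.ge

theorem IsOne.weight_eq {o : H1 Ω} (ho : IsOne o) {η : ℝ} {w : H1 Ω} (hw : fn w ∈ Icc 0 (fn o)) :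
    ∀ᵐ x ∂(volume.restrict Ω), weight η (fn w x) = η + fn (o - w) x ^ 2 := by
  filter_upwards [ho.mem_Icc_iff.1 hw, ho.coeFn_fn_sub w] with x h1 h2
  rw [weight_of_mem h1.1 h1.2, h2]

theorem IsOne.power_eq {o : H1 Ω} (ho : IsOne o) {η : ℝ} (hη : 0 < η) {w : H1 Ω}
    (hw : fn w ∈ Icc 0 (fn o)) (u q : H1 Ω) :
    power η u (o - w) q = inner ℝ (weightMul hη (fn w) (grad u)) (grad q) := by
  rw [inner_weightMul, power]
  refine integral_congr_ae ?_
  filter_upwards [ho.weight_eq (η := η) hw] with x hx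
  rw [hx]

theorem IsOne.integrable_power {o : H1 Ω} (ho : IsOne o) {η : ℝ} (hη : 0 < η) {w : H1 Ω}
    (hw : fn w ∈ Icc 0 (fn o)) (u q : H1 Ω) :
    Integrable (fun x => (η + fn (o - w) x ^ 2) * inner ℝ (grad u x) (grad q x))
      (volume.restrict Ω) := by
  refine (integrable_weight_mul_inner hη (fn w) (grad u) (grad q)).congr ?_
  filter_upwards [ho.weight_eq (η := η) hw] with x hx
  rw [hx]

/-- For `0 ≤ w ≤ 1` the phase field is bounded and the clip inactive, so the extended energy is
finite and given by Hilbert space quantities. -/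
theorem IsOne.energy_eq {o : H1 Ω} (ho : IsOne o) {ε η : ℝ} (hε : 0 < ε) (hη : 0 < η)
    {w : H1D Ω D} (hw : H1D.fnD Ω D w ∈ Icc 0 (fn o)) (u : H1 Ω) :
    energy ε η u (o - H1D.val w) = ENNReal.ofReal
      (inner ℝ (weightMul hη (H1D.fnD Ω D w) (grad u)) (grad u)
        + damageEnergy (H1D.fnD Ω D) (H1D.gradD Ω D) ε w) := by
  have hnn : ∀ᵐ x ∂(volume.restrict Ω),
      0 ≤ weight η (H1D.fnD Ω D w x) * inner ℝ (grad u x) (grad u x) :=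
    Eventually.of_forall fun x =>
      mul_nonneg (hη.le.trans (le_weight _ _)) real_inner_self_nonneg
  have e1 : ∫⁻ x in Ω, ENNReal.ofReal ((η + fn (o - H1D.val w) x ^ 2) * ‖grad u x‖ ^ 2)
      = ENNReal.ofReal (inner ℝ (weightMul hη (H1D.fnD Ω D w) (grad u)) (grad u)) := by
    rw [inner_weightMul,
      ofReal_integral_eq_lintegral_ofReal (integrable_weight_mul_inner hη _ _ _) hnn]
    refine lintegral_congr_ae ?_
    filter_upwards [ho.weight_eq (η := η) (w := H1D.val w) hw] with x hx
    rw [H1D.fnD_apply, hx, real_inner_self_eq_norm_sq]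
  have e2 : ∫⁻ x in Ω, ENNReal.ofReal (‖grad (o - H1D.val w) x‖ ^ 2)
      = ENNReal.ofReal (‖H1D.gradD Ω D w‖ ^ 2) := by
    rw [← lintegral_ofReal_norm_sq]
    refine lintegral_congr_ae ?_
    filter_upwards [ho.coeFn_grad_sub (H1D.val w)] with x hx
    rw [hx, norm_neg, H1D.gradD_apply]
  have e3 : ∫⁻ x in Ω, ENNReal.ofReal ((1 - fn (o - H1D.val w) x) ^ 2)
      = ENNReal.ofReal (‖H1D.fnD Ω D w‖ ^ 2) := by
    rw [← lintegral_ofReal_norm_sq]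
    refine lintegral_congr_ae ?_
    filter_upwards [ho.coeFn_fn_sub (H1D.val w)] with x hx
    rw [hx, sub_sub_cancel, H1D.fnD_apply, Real.norm_eq_abs, sq_abs]
  have h1 : 0 ≤ inner ℝ (weightMul hη (H1D.fnD Ω D w) (grad u)) (grad u) :=
    le_trans (by positivity) (mul_norm_sq_le_inner_weightMul hη _ _)
  rw [energy, e1, e2, e3, ← ENNReal.ofReal_mul (by positivity), ← ENNReal.ofReal_mul (by positivity),
    ← ENNReal.ofReal_add h1 (by positivity), ← ENNReal.ofReal_add (by positivity) (by positivity),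
    damageEnergy, add_assoc]

/-- Truncating the phase field to `[0, 1]` decreases the energy. -/
theorem IsOne.exists_clamp_energy_le {o : H1 Ω} (ho : IsOne o) (hΩ : IsOpen Ω)
    (hΩb : Bornology.IsBounded Ω) {v : H1 Ω} (hv : HasTraceOn D v (fun _ => 1)) (ε η : ℝ) :
    ∃ z : H1D Ω D, H1D.fnD Ω D z ∈ Icc 0 (fn o) ∧
      ∀ u : H1 Ω, energy ε η u (o - H1D.val z) ≤ energy ε η u v := by
  obtain ⟨z, hz, hz1, hz2⟩ := exists_clamp hΩ hΩb (ho.hasTraceOn_one_iff.1 hv)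
  obtain ⟨z, rfl⟩ := H1D.exists_val_eq hz
  refine ⟨z, ho.mem_Icc_iff.2 ?_, fun u => ?_⟩
  · filter_upwards [hz1] with x hx
    rw [H1D.fnD_apply, hx]
    exact ⟨le_max_left _ _, max_le zero_le_one (min_le_left _ _)⟩
  unfold energy
  refine add_le_add (add_le_add ?_ (mul_le_mul' le_rfl ?_)) (mul_le_mul' le_rfl ?_)
  · refine lintegral_mono_ae ?_
    filter_upwards [hz1, ho.coeFn_fn_sub v, ho.coeFn_fn_sub (H1D.val z)] with x h1 h2 h3
    refine ENNReal.ofReal_le_ofReal (mul_le_mul_of_nonneg_right ?_ (sq_nonneg _))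
    rw [h3, h1, h2]
    refine add_le_add le_rfl (sq_le_sq.2 ?_)
    rcases le_total (1 - fn v x) 0 with h | h
    · rw [min_eq_right (by linarith), max_eq_left h, abs_of_nonneg (by norm_num),
        abs_of_nonneg (by linarith)]
      linarith
    · rcases le_total (1 - fn v x) 1 with h' | h'
      · rw [min_eq_right h', max_eq_right h, sub_sub_cancel]
      · rw [min_eq_left h', max_eq_right zero_le_one, sub_self, abs_zero]
        exact abs_nonneg _
  · refine lintegral_mono_ae ?_
    filter_upwards [hz2, ho.coeFn_grad_sub v, ho.coeFn_grad_sub (H1D.val z)] with x h1 h2 h3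
    refine ENNReal.ofReal_le_ofReal (pow_le_pow_left₀ (norm_nonneg _) ?_ 2)
    rwa [h2, norm_neg, ← norm_neg, ← h3] at h1
  · refine lintegral_mono_ae ?_
    filter_upwards [hz1, ho.coeFn_fn_sub v, ho.coeFn_fn_sub (H1D.val z)] with x h1 h2 h3
    refine ENNReal.ofReal_le_ofReal (sq_le_sq.2 ?_)
    rw [h3, sub_sub_cancel, h1, h2, abs_of_nonneg (le_max_left _ _)]
    exact max_le (abs_nonneg _) ((min_le_right _ _).trans (le_abs_self _))

theorem IsOne.fn_sub_mem {o : H1 Ω} (ho : IsOne o) {w : H1D Ω D}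
    (hw : H1D.fnD Ω D w ∈ Icc 0 (fn o)) :
    ∀ᵐ x ∂(volume.restrict Ω), 0 ≤ fn (o - H1D.val w) x ∧ fn (o - H1D.val w) x ≤ 1 := by
  filter_upwards [ho.mem_Icc_iff.1 hw, ho.coeFn_fn_sub (H1D.val w)] with x h1 h2
  rw [H1D.fnD_apply] at h1
  rw [h2]
  exact ⟨by linarith [h1.2], by linarith [h1.1]⟩

theorem IsOne.fn_sub_le {o : H1 Ω} (ho : IsOne o) {w w' : H1D Ω D}
    (hw : H1D.fnD Ω D w ≤ H1D.fnD Ω D w') :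
    ∀ᵐ x ∂(volume.restrict Ω), fn (o - H1D.val w') x ≤ fn (o - H1D.val w) x := by
  filter_upwards [(Lp.coeFn_le _ _).2 hw, ho.coeFn_fn_sub (H1D.val w),
    ho.coeFn_fn_sub (H1D.val w')] with x h1 h2 h3
  rw [H1D.fnD_apply, H1D.fnD_apply] at h1
  rw [h2, h3]
  linarith

theorem IsOne.hasTraceOn_sub_val {o : H1 Ω} (ho : IsOne o) (w : H1D Ω D) :
    HasTraceOn D (o - H1D.val w) (fun _ => 1) := by
  rw [ho.hasTraceOn_one_iff, sub_sub_cancel]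
  exact H1D.val_mem _

theorem IsOne.exists_eq_sub_val {o : H1 Ω} (ho : IsOne o) {w : H1D Ω D} {v : H1 Ω}
    (hv : ∀ᵐ x ∂(volume.restrict Ω), 0 ≤ fn v x ∧ fn v x ≤ fn (o - H1D.val w) x)
    (hvD : HasTraceOn D v (fun _ => 1)) :
    ∃ y : H1D Ω D, v = o - H1D.val y ∧ H1D.fnD Ω D y ∈ Icc (H1D.fnD Ω D w) (fn o) := by
  obtain ⟨y, hy⟩ := H1D.exists_val_eq (ho.hasTraceOn_one_iff.1 hvD)
  refine ⟨y, by rw [hy, sub_sub_cancel], ?_, ?_⟩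
  · rw [← Lp.coeFn_le, H1D.fnD_apply, H1D.fnD_apply, hy]
    filter_upwards [hv, ho.coeFn_fn_sub v, ho.coeFn_fn_sub (H1D.val w)] with x h1 h2 h3
    rw [h3] at h1
    rw [h2]
    linarith [h1.2]
  · rw [← Lp.coeFn_le, H1D.fnD_apply, hy]
    filter_upwards [hv, ho.coeFn_fn_sub v, ho.1] with x h1 h2 h3
    rw [h2, h3]
    linarith [h1.1]

theorem eqOnBoundary_iff_exists {u g : H1 Ω} :
    EqOnBoundary D u g ↔ ∃ ψ : H1D Ω D, u = g + H1D.val ψ := by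
  rw [EqOnBoundary, ← mem_traceZero]
  constructor
  · intro h
    obtain ⟨ψ, hψ⟩ := H1D.exists_val_eq h
    exact ⟨ψ, by rw [hψ, add_sub_cancel]⟩
  · rintro ⟨ψ, rfl⟩
    rw [add_sub_cancel_left]
    exact H1D.val_mem _

end Energy

/-! ### Measurability in time and extension of the datum -/

section Time

/-- The L² curve is measurable, being continuous outside a countable set. By Lusin–Souslin the
continuous injection `j` is a measurable embedding, so measurability lifts to the stronger topology
of `V`. -/
theorem IsSobolevPair.stronglyMeasurable_of_monotone {α : Type*} [MeasurableSpace α]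
    {μ : Measure α} {G : Type*} [NormedAddCommGroup G] [InnerProductSpace ℝ G]
    {V : Type*} [NormedAddCommGroup V] [InnerProductSpace ℝ V] [CompleteSpace V]
    [SecondCountableTopology V] {j : V →L[ℝ] Lp ℝ 2 μ} {d : V →L[ℝ] Lp G 2 μ}
    (h : IsSobolevPair j d) {w : ℝ → V} (hw : Monotone fun t => j (w t))
    (h0 : ∀ t, 0 ≤ j (w t)) : StronglyMeasurable w := by
  borelize V
  borelize ↥(Lp ℝ 2 μ)
  have hm : Measurable fun t => j (w t) :=
    measurable_of_countable_not_continuousAt (countable_not_continuousAt_Lp hw h0)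
  exact ((j.continuous.measurableEmbedding h.injective).measurable_comp_iff.1 hm).stronglyMeasurable

/-- Setting the derivative to zero outside (0,1] gives a curve on the whole line with integrable
derivative, as the abstract evolution requires. -/
theorem IsW11.exists_extension {X : Type*} [NormedAddCommGroup X] [NormedSpace ℝ X]
    [CompleteSpace X] {g g' : ℝ → X} (hg : IsW11 g g') :
    ∃ G G' : ℝ → X, Integrable G' ∧ (∀ t, G t = G 0 + ∫ τ in (0 : ℝ)..t, G' τ) ∧
      (∀ t ∈ Icc (0 : ℝ) 1, G t = g t) ∧ ∀ t ∈ Ioc (0 : ℝ) 1, G' t = g' t := by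
  have hint : Integrable ((Ioc (0 : ℝ) 1).indicator g') :=
    (integrable_indicator_iff measurableSet_Ioc).2
      ((intervalIntegrable_iff_integrableOn_Ioc_of_le zero_le_one).1 hg.intervalIntegrable)
  refine ⟨fun t => g 0 + ∫ τ in (0 : ℝ)..t, (Ioc (0 : ℝ) 1).indicator g' τ, _, hint,
    fun t => by simp, fun t ht => ?_, fun t ht => indicator_of_mem ht _⟩
  have e : ∫ τ in (0 : ℝ)..t, (Ioc (0 : ℝ) 1).indicator g' τ = ∫ τ in (0 : ℝ)..t, g' τ := by
    refine intervalIntegral.integral_congr_ae (Eventually.of_forall fun τ hτ => ?_)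
    rw [uIoc_of_le ht.1] at hτ
    have hτ1 : τ ∈ Ioc (0 : ℝ) 1 := ⟨hτ.1, hτ.2.trans ht.2⟩
    exact indicator_of_mem hτ1 g'
  simp only [e, ← hg.eq_integral t ht]

end Time

/-! ### The evolution in H¹ -/

section Evolution

variable {N : ℕ} {Ω : Set (Eucl N)}

theorem energy_ge {D : Set (Eucl N)} {o : H1 Ω} (ho : IsOne o) {ε η : ℝ} (hε : 0 < ε) (hη : 0 < η)
    (hS : IsSobolevPair (H1D.fnD Ω D) (H1D.gradD Ω D)) {w : H1D Ω D}
    (hw : H1D.fnD Ω D w ∈ Icc 0 (fn o)) (u : H1 Ω) (ψ : H1D Ω D) :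
    ENNReal.ofReal (hS.totalEnergy hη ε w (gradL Ω u))
      ≤ energy ε η (u + H1D.val ψ) (o - H1D.val w) := by
  have e : grad (u + H1D.val ψ) = gradL Ω u + H1D.gradD Ω D ψ := map_add (gradL Ω) _ _
  rw [ho.energy_eq hε hη hw, hS.totalEnergy_eq, e]
  exact ENNReal.ofReal_le_ofReal (add_le_add (hS.elasticEnergy_le hη _ _ _) le_rfl)

theorem energy_elastic {D : Set (Eucl N)} {o : H1 Ω} (ho : IsOne o) {ε η : ℝ} (hε : 0 < ε)
    (hη : 0 < η) (hS : IsSobolevPair (H1D.fnD Ω D) (H1D.gradD Ω D)) {w : H1D Ω D}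
    (hw : H1D.fnD Ω D w ∈ Icc 0 (fn o)) (u : H1 Ω) :
    energy ε η (u + H1D.val (hS.elastic hη (H1D.fnD Ω D w) (gradL Ω u))) (o - H1D.val w)
      = ENNReal.ofReal (hS.totalEnergy hη ε w (gradL Ω u)) := by
  have e : ∀ ψ : H1D Ω D, grad (u + H1D.val ψ) = gradL Ω u + H1D.gradD Ω D ψ := fun ψ =>
    map_add (gradL Ω) _ _
  rw [ho.energy_eq hε hη hw, e, hS.totalEnergy_eq, hS.elasticEnergy_eq]

/-- The factor `1 / 2` compensates the 2 that `stressPower` carries from differentiating a square.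
-/
theorem power_elastic {D : Set (Eucl N)} {o : H1 Ω} (ho : IsOne o) {η : ℝ}
    (hη : 0 < η) (hS : IsSobolevPair (H1D.fnD Ω D) (H1D.gradD Ω D)) {w : H1D Ω D}
    (hw : H1D.fnD Ω D w ∈ Icc 0 (fn o)) (u q : H1 Ω) :
    power η (u + H1D.val (hS.elastic hη (H1D.fnD Ω D w) (gradL Ω u))) (o - H1D.val w) q
      = 1 / 2 * hS.stressPower hη (H1D.fnD Ω D w) (gradL Ω u) (gradL Ω q) := by
  have e : ∀ ψ : H1D Ω D, grad (u + H1D.val ψ) = gradL Ω u + H1D.gradD Ω D ψ := fun ψ =>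
    map_add (gradL Ω) _ _
  have h := ho.power_eq hη (w := H1D.val w) hw
    (u + H1D.val (hS.elastic hη (H1D.fnD Ω D w) (gradL Ω u))) q
  rw [h, e, IsSobolevPair.stressPower, hS.stress_apply, ← H1D.fnD_apply, gradL_apply q]
  ring

/-- Quasistatic evolution of the Ambrosio–Tortorelli functional driven by `G`, in terms of the
elastic corrector `z = u - G` and of the damage `w = 1 - v`. -/
theorem exists_evolution_H1 (hΩ : IsOpen Ω) (hΩb : Bornology.IsBounded Ω)
    (hΩL : HasLipschitzBoundary Ω) (D : Set (Eucl N)) {o : H1 Ω} (ho : IsOne o) {ε η : ℝ}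
    (hε : 0 < ε) (hη : 0 < η) {G G' : ℝ → H1 Ω} (hG' : Integrable G')
    (hG : ∀ t, G t = G 0 + ∫ τ in (0 : ℝ)..t, G' τ) :
    ∃ (z w : ℝ → H1D Ω D) (E : ℝ → ℝ), StronglyMeasurable z ∧ StronglyMeasurable w ∧
      Monotone (fun t => H1D.fnD Ω D (w t)) ∧ (∀ t, H1D.fnD Ω D (w t) ∈ Icc 0 (fn o)) ∧
      (∀ t, 0 ≤ E t) ∧
      (∀ t, energy ε η (G t + H1D.val (z t)) (o - H1D.val (w t)) = ENNReal.ofReal (E t)) ∧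
      (∀ ψ w₁ : H1D Ω D, H1D.fnD Ω D w₁ ∈ Icc 0 (fn o) →
        ENNReal.ofReal (E 0) ≤ energy ε η (G 0 + H1D.val ψ) (o - H1D.val w₁)) ∧
      (∀ t ∈ Icc (0 : ℝ) 1, ∀ ψ w₁ : H1D Ω D,
        H1D.fnD Ω D w₁ ∈ Icc (H1D.fnD Ω D (w t)) (fn o) →
        ENNReal.ofReal (E t) ≤ energy ε η (G t + H1D.val ψ) (o - H1D.val w₁)) ∧
      Integrable (fun τ => power η (G τ + H1D.val (z τ)) (o - H1D.val (w τ)) (G' τ)) ∧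
      ∀ t ∈ Icc (0 : ℝ) 1, E t = E 0
        + 2 * ∫ τ in (0 : ℝ)..t, power η (G τ + H1D.val (z τ)) (o - H1D.val (w τ)) (G' τ) := by
  have hS := H1D.isSobolevPair hΩ hΩb hΩL D
  have hp' : Integrable fun t => gradL Ω (G' t) := (gradL Ω).integrable_comp hG'
  have hp : ∀ t, gradL Ω (G t) = gradL Ω (G 0) + ∫ τ in (0 : ℝ)..t, gradL Ω (G' τ) := fun t => by
    rw [(gradL Ω).intervalIntegral_comp_comm hG'.intervalIntegrable, ← map_add, ← hG t]
  have ho0 : 0 ≤ fn o := by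
    rw [← Lp.coeFn_nonneg]
    filter_upwards [ho.1] with x hx
    rw [hx]
    exact zero_le_one
  obtain ⟨w, hmono, hmem, hmin0, hmin, hbal⟩ := hS.exists_evolution hη hε ho0 hp' hp
  have hint := hS.integrable_stressPower hη hmono (fun t => (hmem t).1) hp' hp
  have hwm := hS.stronglyMeasurable_of_monotone hmono fun t => (hmem t).1
  have hpow := fun τ => power_elastic ho hη hS (hmem τ) (G τ) (G' τ)
  refine ⟨fun t => hS.elastic hη (H1D.fnD Ω D (w t)) (gradL Ω (G t)), w,
    fun t => hS.totalEnergy hη ε (w t) (gradL Ω (G t)), ?_, hwm, hmono, hmem,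
    fun t => hS.totalEnergy_nonneg hη hε _ _, fun t => energy_elastic ho hε hη hS (hmem t) (G t),
    fun ψ w₁ hw₁ => ?_, fun t ht ψ w₁ hw₁ => ?_, ?_, fun t ht => ?_⟩
  -- The corrector depends continuously on the damage and the datum, so it inherits their
  -- measurability.
  · exact (hS.continuous_elastic hη).comp_stronglyMeasurable
      (((H1D.fnD Ω D).continuous.comp_stronglyMeasurable hwm).prodMk
        (continuous_curve hp' hp).stronglyMeasurable)
  · exact (ENNReal.ofReal_le_ofReal (hmin0 w₁ hw₁)).trans (energy_ge ho hε hη hS hw₁ _ _)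
  · exact (ENNReal.ofReal_le_ofReal (hmin t ht w₁ hw₁)).trans
      (energy_ge ho hε hη hS ⟨(hmem t).1.trans hw₁.1, hw₁.2⟩ _ _)
  · simp only [hpow]
    exact hint.const_mul _
  · simp only [hpow]
    rw [intervalIntegral.integral_const_mul, hbal t ht]
    ring

theorem stronglyMeasurable_pair {D : Set (Eucl N)} (o : H1 Ω) {G : ℝ → H1 Ω} (hG : Continuous G)
    {z w : ℝ → H1D Ω D} (hz : StronglyMeasurable z) (hw : StronglyMeasurable w) :
    StronglyMeasurable fun t => (G t + H1D.val (z t), o - H1D.val (w t)) :=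
  (hG.stronglyMeasurable.add (H1D.val.continuous.comp_stronglyMeasurable hz)).prodMk
    (stronglyMeasurable_const.sub (H1D.val.continuous.comp_stronglyMeasurable hw))

end Evolution

end AmbrosioTortorelli

/-! ### The main theorem -/

theorem theorem3p1 {N : ℕ}
    (Ω : Set (EuclideanSpace ℝ (Fin N))) (hΩ : IsOpen Ω) (hΩb : Bornology.IsBounded Ω)
    (hΩL : HasLipschitzBoundary Ω)
    (D : Set (EuclideanSpace ℝ (Fin N)))
    (hD : ∃ O : Set (EuclideanSpace ℝ (Fin N)), IsOpen O ∧ D = frontier Ω ∩ O)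
    (ε η : ℝ) (hε : 0 < ε) (hη : 0 < η)
    (g g' : ℝ → H1 Ω) (hg : IsW11 g g') :
    ∃ u v : ℝ → H1 Ω,
      StronglyMeasurable (fun t : Icc (0 : ℝ) 1 => (u t, v t)) ∧
      (∀ t ∈ Icc (0 : ℝ) 1,
        (∀ᵐ x ∂(volume.restrict Ω), 0 ≤ fn (v t) x ∧ fn (v t) x ≤ 1) ∧
        EqOnBoundary D (u t) (g t) ∧
        HasTraceOn D (v t) (fun _ => 1)) ∧
      -- (a) irreversibility
      (∀ s t : ℝ, 0 ≤ s → s ≤ t → t ≤ 1 →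
        ∀ᵐ x ∂(volume.restrict Ω), fn (v t) x ≤ fn (v s) x) ∧
      -- (b) global minimality at time zero
      (∀ u₁ v₁ : H1 Ω,
        EqOnBoundary D u₁ (g 0) →
        HasTraceOn D v₁ (fun _ => 1) →
        energy ε η (u 0) (v 0) ≤ energy ε η u₁ v₁) ∧
      -- (c) unilateral minimality at positive times
      (∀ t ∈ Ioc (0 : ℝ) 1, ∀ u₁ v₁ : H1 Ω,
        (∀ᵐ x ∂(volume.restrict Ω), 0 ≤ fn v₁ x ∧ fn v₁ x ≤ fn (v t) x) →
        EqOnBoundary D u₁ (g t) →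
        HasTraceOn D v₁ (fun _ => 1) →
        energy ε η (u t) (v t) ≤ energy ε η u₁ v₁) ∧
      -- (d) finite, absolutely continuous energy, and the energy identity
      (∀ t ∈ Icc (0 : ℝ) 1, energy ε η (u t) (v t) ≠ ⊤) ∧
      AbsolutelyContinuousOnInterval
        (fun t => (energy ε η (u t) (v t)).toReal) 0 1 ∧
      (∀ t ∈ Icc (0 : ℝ) 1, Integrable (fun x =>
        (η + fn (v t) x ^ 2) * inner ℝ (grad (u t) x) (grad (g' t) x)) (volume.restrict Ω)) ∧
      IntervalIntegrable (fun τ => power η (u τ) (v τ) (g' τ)) volume 0 1 ∧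
      (∀ t ∈ Icc (0 : ℝ) 1,
        (energy ε η (u t) (v t)).toReal
          = (energy ε η (u 0) (v 0)).toReal
            + 2 * ∫ τ in (0 : ℝ)..t, power η (u τ) (v τ) (g' τ)) := by
  obtain ⟨o, ho⟩ := exists_isOne hΩb
  obtain ⟨G, G', hG', hG, hGg, hGg'⟩ := hg.exists_extension
  obtain ⟨z, w, E, hzm, hwm, hmono, hmem, hE, hen, hmin0, hmin, hint, hbal⟩ :=
    exists_evolution_H1 hΩ hΩb hΩL D ho hε hη hG' hG
  have h01 : (0 : ℝ) ∈ Icc (0 : ℝ) 1 := left_mem_Icc.2 zero_le_one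
  obtain ⟨u, hu⟩ : ∃ u : ℝ → H1 Ω, ∀ t, u t = G t + H1D.val (z t) := ⟨_, fun _ => rfl⟩
  obtain ⟨v, hv⟩ : ∃ v : ℝ → H1 Ω, ∀ t, v t = o - H1D.val (w t) := ⟨_, fun _ => rfl⟩
  simp only [← hu, ← hv] at hen hint hbal
  have hreal : ∀ t, (energy ε η (u t) (v t)).toReal = E t :=
    fun t => by rw [hen, ENNReal.toReal_ofReal (hE t)]
  refine ⟨u, v, ?_, fun t ht => ⟨?_, ?_, ?_⟩, fun s t _ hst _ => ?_, ?_, ?_, fun t _ => ?_, ?_,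
    fun t _ => ?_, ?_, ?_⟩
  · simp only [hu, hv]
    exact (stronglyMeasurable_pair o (continuous_curve hG' hG) hzm hwm).comp_measurable
      measurable_subtype_coe
  · rw [hv]
    exact ho.fn_sub_mem (hmem t)
  · exact eqOnBoundary_iff_exists.2 ⟨z t, by rw [hu, hGg t ht]⟩
  · rw [hv]
    exact ho.hasTraceOn_sub_val _
  · rw [hv, hv]
    exact ho.fn_sub_le (hmono hst)
  · intro u₁ v₁ hu₁ hv₁
    -- Competitors at time zero are not confined to [0,1] and may have infinite energy; clamping
    -- brings them into the range where `hmin0` applies.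
    obtain ⟨y, hy, hle⟩ := ho.exists_clamp_energy_le hΩ hΩb hv₁ ε η
    refine le_trans ?_ (hle u₁)
    obtain ⟨ψ, rfl⟩ := eqOnBoundary_iff_exists.1 hu₁
    rw [hen 0, ← hGg 0 h01]
    exact hmin0 ψ y hy
  · intro t ht u₁ v₁ hv₁ hu₁ hv₁D
    have ht' : t ∈ Icc (0 : ℝ) 1 := Ioc_subset_Icc_self ht
    rw [hv] at hv₁
    obtain ⟨y, rfl, hy⟩ := ho.exists_eq_sub_val hv₁ hv₁D
    obtain ⟨ψ, rfl⟩ := eqOnBoundary_iff_exists.1 hu₁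
    rw [hen t, ← hGg t ht']
    exact hmin t ht' ψ y hy
  · rw [hen]
    exact ENNReal.ofReal_ne_top
  -- By the energy identity the energy differs by a constant from twice the primitive of the power,
  -- whence `C = 2`.
  · refine absolutelyContinuousOnInterval_of_dist_le (C := 2)
      (hint.intervalIntegrable.absolutelyContinuousOnInterval_intervalIntegral
        (left_mem_uIcc (a := (0 : ℝ)) (b := 1))) fun s hs t ht => ?_
    rw [uIcc_of_le zero_le_one] at hs ht
    rw [hreal, hreal, hbal s hs, hbal t ht, dist_add_left, Real.dist_eq, Real.dist_eq, ← mul_sub,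
      abs_mul, abs_two]
  · rw [hv]
    exact ho.integrable_power hη (hmem t) _ _
  · rw [intervalIntegrable_iff_integrableOn_Ioc_of_le zero_le_one]
    refine (hint.integrableOn (s := Ioc 0 1)).congr ?_
    filter_upwards [ae_restrict_mem measurableSet_Ioc] with τ hτ
    rw [hGg' τ hτ]
  · intro t ht
    rw [hreal, hreal, hbal t ht]
    congr 2
    refine intervalIntegral.integral_congr_ae (Eventually.of_forall fun τ hτ => ?_)
    rw [uIoc_of_le ht.1] at hτ
    have hτ1 : τ ∈ Ioc (0 : ℝ) 1 := ⟨hτ.1, hτ.2.trans ht.2⟩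
    rw [hGg' τ hτ1]
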